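/- Let $r\in\{\infty,\omega\}$ ($\omega$ = real-analytic), let $M$ be a $C^r$ manifold of dimension $2n$ with a real nondegenerate metric $g$ of class $C^r$ and arbitrary signature, and let $\varepsilon$ be a $C^r$ volume form of $g$ (so $\varepsilon(v_1,\dots,v_{2n})^2=|\det g(v_i,v_j)|$). Extend $g$ and the Lie bracket complex-bilinearly to $TM\otimes\mathbb C$. Let $N'$ be a null $n$-form: locally $N'_{\mu_1\dots\mu_n}=V_{1[\mu_1}\cdots V_{n\,\mu_n]}$ with pointwise linearly independent complex vector fields $V_1,\dots,V_n$ of class $C^r$ (indices lowered with $g$) such that $g(V_i,V_j)=0$ for all $i,j$; let $D\subset TM\otimes\mathbb C$ be the distribution that it generates, spanned by the $V_i$. For an $n$-form $K$ let $(*K)_{\mu_1\dots\mu_n}=\frac1{n!}\varepsilon^{\nu_1\dots\nu_n}{}_{\mu_1\dots\mu_n}K_{\nu_1\dots\nu_n}$. Consider the following conditions. - (Inv) $D$ is involutive: for all complex vector fields $X,Y$ of class $C^r$ on an open set and tangent to $D$ there, $[X,Y]$ is tangent to $D$. - (Int) $D$ is locally integrable: near every point there are complex-valued $C^r$ functions $z^1,\dots,z^n$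 with pointwise $\mathbb C$-linearly independent differentials such that $D=\bigcap_j\ker dz^j$. - (Closed) Near every point there is a nowhere vanishing complex-valued $C^r$ function $h$ such that $N=hN'$ satisfies $dN=0$ and $d(*N)=0$. Then $D_x$ is a maximal isotropic subspace of $T_xM\otimes\mathbb C$ for every $x$, and: 1. If $r=\omega$, or if $D$ is real (each $D_x$ is the complexification of a real subspace of $T_xM$), then $D$ is integrable if and only if (Closed) holds, in either sense of integrability: (Inv) $\Leftrightarrow$ (Closed) and (Int) $\Leftrightarrow$ (Closed). 2. In all cases, also for $r=\infty$ and complex $D$, (Int) $\Rightarrow$ (Closed) and (Closed) $\Rightarrow$ (Inv). No condition is imposed on the curvature. -/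

import Mathlib

open scoped Manifold ContDiff TensorProduct
open Bundle Module

noncomputable section

namespace NullForms

section Algebra

variable {V : Type*} [AddCommGroup V] [Module ℝ V] [TopologicalSpace V]

/-- The simple form `α¹ ∧ … ∧ αᵖ` in the normalisation `K_{μ₁…μₚ} = α¹_[μ₁ … αᵖ_μₚ]`, that is
`K(w₁, …, wₚ) = (1/p!) ∑_σ sgn(σ) ∏ᵢ αⁱ(w_{σ i})`. -/
def simpleForm {p : ℕ} (α : Fin p → V →L[ℝ] ℂ) : V [⋀^Fin p]→L[ℝ] ℂ :=
  ((p.factorial : ℝ)⁻¹) • ContinuousMultilinearMap.alternatization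
    ((ContinuousMultilinearMap.mkPiAlgebra ℝ (Fin p) ℂ).compContinuousLinearMap α)

/-- The `q`-form `w ↦ ε(v₁, …, vₚ, w₁, …, w_q)` obtained by filling the first `p` slots of `ε`. -/
def contractFirst {p q : ℕ} (ε : V [⋀^Fin (p + q)]→L[ℝ] ℝ) (v : Fin p → V) :
    V [⋀^Fin q]→L[ℝ] ℝ where
  toFun w := ε (Fin.append v w)
  map_update_add' {inst} w i x y := by
    have key : ∀ z, Fin.append v (Function.update w i z) =
        Function.update (Fin.append v w) (Fin.natAdd p i) z := by
      intro z
      funext j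
      refine Fin.addCases (fun a => ?_) (fun a => ?_) j
      · simp [Function.update_apply, Fin.ext_iff]
        intro h; have := a.2; omega
      · by_cases h : a = i <;> simp [h]
    simp [key]
  map_update_smul' {inst} w i c x := by
    have key : ∀ z, Fin.append v (Function.update w i z) =
        Function.update (Fin.append v w) (Fin.natAdd p i) z := by
      intro z
      funext j
      refine Fin.addCases (fun a => ?_) (fun a => ?_) j
      · simp [Function.update_apply, Fin.ext_iff]
        intro h; have := a.2; omega
      · by_cases h : a = i <;> simp [h]
    simp [key]
  cont := by
    refine ε.cont.comp (continuous_pi fun j => ?_)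
    refine Fin.addCases (fun a => ?_) (fun a => ?_) j
    · simpa using continuous_const
    · simpa using continuous_apply a
  map_eq_zero_of_eq' w i j hw hij := by
    refine ε.map_eq_zero_of_eq (i := Fin.natAdd p i) (j := Fin.natAdd p j) _ (by simpa using hw) ?_
    simpa [Fin.ext_iff] using hij

/-- The Hodge dual of a complex-valued `p`-form `K` with respect to a nondegenerate symmetric
bilinear form `B` and a volume form `ε`, where `dim V = p + q`:
`K̃_{μ₁…μ_q} = (1/p!) ε^{ν₁…νₚ}_{μ₁…μ_q} K_{ν₁…νₚ}`.
The indices `ν` are raised by replacing the basis vectors by those of the `B`-dual basis. -/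
def hodgeDual [Module.Finite ℝ V] {p q : ℕ} (B : LinearMap.BilinForm ℝ V) (hB : B.Nondegenerate)
    (ε : V [⋀^Fin (p + q)]→L[ℝ] ℝ) (K : V [⋀^Fin p]→L[ℝ] ℂ) : V [⋀^Fin q]→L[ℝ] ℂ :=
  ((p.factorial : ℝ)⁻¹) • ∑ ν : Fin p → Fin (finrank ℝ V),
    K (fun i => finBasis ℝ V (ν i)) •
      Complex.ofRealCLM.compContinuousAlternatingMap
        (contractFirst ε (fun i => B.dualBasis hB (finBasis ℝ V) (ν i)))

end Algebra

section Manifold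

variable {E : Type*} [NormedAddCommGroup E] [NormedSpace ℝ E]
  {M : Type*} [TopologicalSpace M] [ChartedSpace E M]

instance tangentSpace_finite [FiniteDimensional ℝ E] (x : M) :
    Module.Finite ℝ (TangentSpace 𝓘(ℝ, E) x) :=
  inferInstanceAs (Module.Finite ℝ E)

/-- A real pseudo-Riemannian metric of class `C^r` and arbitrary signature. -/
structure PseudoMetric (r : WithTop ℕ∞) (E : Type*) [NormedAddCommGroup E] [NormedSpace ℝ E]
    (M : Type*) [TopologicalSpace M] [ChartedSpace E M] [IsManifold 𝓘(ℝ, E) 1 M] where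
  /-- the inner product on each tangent space -/
  inner (x : M) : TangentSpace 𝓘(ℝ, E) x →L[ℝ] TangentSpace 𝓘(ℝ, E) x →L[ℝ] ℝ
  symm (x : M) (v w : TangentSpace 𝓘(ℝ, E) x) : inner x v w = inner x w v
  nondegenerate (x : M) (v : TangentSpace 𝓘(ℝ, E) x) (hv : ∀ w, inner x v w = 0) : v = 0
  contMDiff : ContMDiff 𝓘(ℝ, E) (𝓘(ℝ, E).prod 𝓘(ℝ, E →L[ℝ] E →L[ℝ] ℝ)) r
    (fun x => TotalSpace.mk' (E →L[ℝ] E →L[ℝ] ℝ)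
      (E := fun x : M => TangentSpace 𝓘(ℝ, E) x →L[ℝ] TangentSpace 𝓘(ℝ, E) x →L[ℝ] ℝ)
      x (inner x))

section Metric

variable [IsManifold 𝓘(ℝ, E) 1 M] {r : WithTop ℕ∞}

/-- The metric at `x` as a bilinear form. -/
def PseudoMetric.bilin (g : PseudoMetric r E M) (x : M) :
    LinearMap.BilinForm ℝ (TangentSpace 𝓘(ℝ, E) x) :=
  LinearMap.mk₂ ℝ (fun v w => g.inner x v w) (by simp) (by simp) (by simp) (by simp)

theorem PseudoMetric.bilin_nondegenerate (g : PseudoMetric r E M) (x : M) :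
    (g.bilin x).Nondegenerate := by
  refine ⟨fun v hv => g.nondegenerate x v hv, fun v hv => g.nondegenerate x v fun w => ?_⟩
  rw [g.symm]
  exact hv w

/-- The metric at `x`, extended complex-bilinearly to the complexified tangent space. -/
def PseudoMetric.complexBilin (g : PseudoMetric r E M) (x : M) :
    LinearMap.BilinForm ℂ (ℂ ⊗[ℝ] TangentSpace 𝓘(ℝ, E) x) :=
  LinearMap.BilinForm.baseChange ℂ (g.bilin x)

end Metric

/-- A section `re + i im` of the complexified tangent bundle. -/
structure ComplexVectorField (E : Type*) [NormedAddCommGroup E] [NormedSpace ℝ E]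
    (M : Type*) [TopologicalSpace M] [ChartedSpace E M] where
  /-- the real part -/
  re (x : M) : TangentSpace 𝓘(ℝ, E) x
  /-- the imaginary part -/
  im (x : M) : TangentSpace 𝓘(ℝ, E) x

namespace ComplexVectorField

/-- The value of a complex vector field at `x`. -/
def value (X : ComplexVectorField E M) (x : M) : ℂ ⊗[ℝ] TangentSpace 𝓘(ℝ, E) x :=
  (1 : ℂ) ⊗ₜ[ℝ] X.re x + Complex.I ⊗ₜ[ℝ] X.im x

/-- A complex vector field is of class `C^r` on `U`. -/
def SmoothOn [IsManifold 𝓘(ℝ, E) 1 M] (r : WithTop ℕ∞) (X : ComplexVectorField E M)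
    (U : Set M) : Prop :=
  ContMDiffOn 𝓘(ℝ, E) 𝓘(ℝ, E).tangent r
      (fun x => (⟨x, X.re x⟩ : TangentBundle 𝓘(ℝ, E) M)) U ∧
    ContMDiffOn 𝓘(ℝ, E) 𝓘(ℝ, E).tangent r
      (fun x => (⟨x, X.im x⟩ : TangentBundle 𝓘(ℝ, E) M)) U

/-- The complex-bilinear extension of the Lie bracket of vector fields. -/
def bracket (X Y : ComplexVectorField E M) : ComplexVectorField E M where
  re x := VectorField.mlieBracket 𝓘(ℝ, E) X.re Y.re x -
    VectorField.mlieBracket 𝓘(ℝ, E) X.im Y.im x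
  im x := VectorField.mlieBracket 𝓘(ℝ, E) X.re Y.im x +
    VectorField.mlieBracket 𝓘(ℝ, E) X.im Y.re x

end ComplexVectorField

/-- The complex covector `w ↦ g(X, w)` associated to a complex vector field. -/
def PseudoMetric.flat [IsManifold 𝓘(ℝ, E) 1 M] {r : WithTop ℕ∞} (g : PseudoMetric r E M)
    (X : ComplexVectorField E M) (x : M) : TangentSpace 𝓘(ℝ, E) x →L[ℝ] ℂ :=
  Complex.ofRealCLM ∘L g.inner x (X.re x) +
    Complex.I • (Complex.ofRealCLM ∘L g.inner x (X.im x))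

variable (E M) in
/-- A differential `p`-form on `M` with values in `F` (no smoothness is built in). -/
abbrev Form (p : ℕ) (F : Type*) [NormedAddCommGroup F] [NormedSpace ℝ F] :=
  ∀ x : M, TangentSpace 𝓘(ℝ, E) x [⋀^Fin p]→L[ℝ] F

namespace Form

variable {p : ℕ} {F : Type*} [NormedAddCommGroup F] [NormedSpace ℝ F]

/-- The pullback of a differential form. -/
def pullback {M' : Type*} [TopologicalSpace M'] [ChartedSpace E M'] (f : M → M')
    (α : Form E M' p F) : Form E M p F := fun x =>
  (α (f x)).compContinuousLinearMap (mfderiv 𝓘(ℝ, E) 𝓘(ℝ, E) f x)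

/-- The expression of a differential form in the preferred chart at `x₀`, that is, its pullback
under the inverse of this chart. -/
def inChart (α : Form E M p F) (x₀ : M) : E → E [⋀^Fin p]→L[ℝ] F :=
  pullback (M := E) (extChartAt 𝓘(ℝ, E) x₀).symm α

/-- A differential form is of class `C^r` when its expressions in charts are. -/
def Smooth (r : WithTop ℕ∞) (α : Form E M p F) : Prop :=
  ∀ x₀ : M, ContDiffOn ℝ r (α.inChart x₀) (extChartAt 𝓘(ℝ, E) x₀).target

/-- The exterior derivative of a differential form, computed at `x` in the chart at `x`. -/
def extDeriv (α : Form E M p F) : Form E M (p + 1) F := fun x =>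
  pullback (M' := E) (extChartAt 𝓘(ℝ, E) x) (_root_.extDeriv (α.inChart x)) x

end Form

section Main

variable [IsManifold 𝓘(ℝ, E) 1 M] {r : WithTop ℕ∞} {n : ℕ}

/-- `ε` is a volume form of `g`: it takes the values `± |det g|^{1/2}` on frames. -/
def IsVolumeForm {d : ℕ} (g : PseudoMetric r E M) (ε : Form E M d ℝ) : Prop :=
  ε.Smooth r ∧ ∀ (x : M) (v : Fin d → TangentSpace 𝓘(ℝ, E) x),
    ε x v ^ 2 = |(Matrix.of fun i j => g.inner x (v i) (v j)).det|

/-- The Hodge dual of a differential form. -/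
def Form.hodge [FiniteDimensional ℝ E] {p q : ℕ} (g : PseudoMetric r E M)
    (ε : Form E M (p + q) ℝ) (K : Form E M p ℂ) : Form E M q ℂ := fun x =>
  hodgeDual (g.bilin x) (g.bilin_nondegenerate x) (ε x) (K x)

variable (E M) in
/-- A distribution in the complexified tangent bundle. -/
abbrev Distribution := ∀ x : M, Submodule ℂ (ℂ ⊗[ℝ] TangentSpace 𝓘(ℝ, E) x)

/-- The nowhere vanishing simple `p`-form `K` generates the distribution `D`: locally
`K_{μ₁…μₚ} = V₁_[μ₁ … Vₚ_μₚ]` with pointwise linearly independent complex vector fields `Vᵢ`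
of class `C^r` that span `D`. -/
def Generates {p : ℕ} (g : PseudoMetric r E M) (K : Form E M p ℂ) (D : Distribution E M) : Prop :=
  ∀ x₀ : M, ∃ U : Set M, IsOpen U ∧ x₀ ∈ U ∧ ∃ V : Fin p → ComplexVectorField E M,
    (∀ i, (V i).SmoothOn r U) ∧
    ∀ x ∈ U, LinearIndependent ℂ (fun i => (V i).value x) ∧
      D x = Submodule.span ℂ (Set.range fun i => (V i).value x) ∧
      K x = simpleForm (fun i => g.flat (V i) x)

/-- Any two vectors of the subspace `W` of the complexified tangent space are orthogonal. -/
def IsIsotropic (g : PseudoMetric r E M) (x : M)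
    (W : Submodule ℂ (ℂ ⊗[ℝ] TangentSpace 𝓘(ℝ, E) x)) : Prop :=
  ∀ X ∈ W, ∀ Y ∈ W, g.complexBilin x X Y = 0

/-- `K` is a null `p`-form, and `D` is the isotropic distribution that it generates. -/
def IsNullFormGenerating {p : ℕ} (g : PseudoMetric r E M) (K : Form E M p ℂ)
    (D : Distribution E M) : Prop :=
  Generates g K D ∧ ∀ x, IsIsotropic g x (D x)

/-- The distribution is maximal, at every point, among the isotropic subspaces. -/
def IsMaximallyIsotropic (g : PseudoMetric r E M) (D : Distribution E M) : Prop :=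
  ∀ x, Maximal (IsIsotropic g x) (D x)

variable (r) in
/-- Integrability in the sense of brackets: the bracket of any two complex vector fields of
class `C^r`, defined on an open set and tangent to `D`, is tangent to `D`. -/
def IsInvolutive (D : Distribution E M) : Prop :=
  ∀ U : Set M, IsOpen U → ∀ X Y : ComplexVectorField E M, X.SmoothOn r U → Y.SmoothOn r U →
    (∀ x ∈ U, X.value x ∈ D x) → (∀ x ∈ U, Y.value x ∈ D x) →
    ∀ x ∈ U, (X.bracket Y).value x ∈ D x

/-- The differential at `x` of a complex-valued function, extended complex-linearly to the
complexified tangent space. -/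
def complexDifferential (z : M → ℂ) (x : M) : ℂ ⊗[ℝ] TangentSpace 𝓘(ℝ, E) x →ₗ[ℂ] ℂ :=
  let dz : TangentSpace 𝓘(ℝ, E) x →L[ℝ] ℂ := mfderiv 𝓘(ℝ, E) 𝓘(ℝ, ℂ) z x
  LinearMap.liftBaseChange ℂ dz.toLinearMap

variable (r) in
/-- Integrability in the sense of coordinates: near every point there are `k` complex-valued
functions of class `C^r`, with linearly independent differentials, such that `D` is the
distribution annihilated by these differentials. -/
def IsLocallyIntegrable (k : ℕ) (D : Distribution E M) : Prop :=
  ∀ x₀ : M, ∃ U : Set M, IsOpen U ∧ x₀ ∈ U ∧ ∃ z : Fin k → M → ℂ,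
    (∀ j, ContMDiffOn 𝓘(ℝ, E) 𝓘(ℝ, ℂ) r (z j) U) ∧
    ∀ x ∈ U, LinearIndependent ℂ (fun j => complexDifferential (E := E) (z j) x) ∧
      D x = ⨅ j, LinearMap.ker (complexDifferential (E := E) (z j) x)

/-- At every point the distribution is the complexification of a real subspace. -/
def IsReal (D : Distribution E M) : Prop :=
  ∀ x, ∃ W : Submodule ℝ (TangentSpace 𝓘(ℝ, E) x), D x = W.baseChange ℂ

/-- Near every point some nowhere vanishing complex function `h` of class `C^r` makes the
`n`-form `h N'` closed and co-closed. -/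
def HasClosedCoclosedMultiple [FiniteDimensional ℝ E] (g : PseudoMetric r E M)
    (ε : Form E M (n + n) ℝ) (N' : Form E M n ℂ) : Prop :=
  ∀ x₀ : M, ∃ U : Set M, IsOpen U ∧ x₀ ∈ U ∧ ∃ h : M → ℂ,
    ContMDiffOn 𝓘(ℝ, E) 𝓘(ℝ, ℂ) r h U ∧ (∀ x ∈ U, h x ≠ 0) ∧
    ∀ x ∈ U, Form.extDeriv (fun y => h y • N' y) x = 0 ∧
      Form.extDeriv (Form.hodge g ε (fun y => h y • N' y)) x = 0

end Main

end Manifold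

end NullForms

end

/-! Put θᵢ = g(Vᵢ, ·), so that N' is the simple form built from the θᵢ. An isotropic subspace of
half the dimension is its own orthogonal complement. Hence D is maximal isotropic, and it is cut out
by the very covectors θᵢ (`mem_iff_flat`): a complex vector lies in D exactly when its contraction
with N' vanishes.

At a point, *N' is, up to a factor, the volume form with its first n slots filled by V₁, …, Vₙ. The
product of two values of the volume form is ± a Gram determinant, and isotropy puts a zero block
into that Gram matrix; so *N' = c N' with c⁴ = 1 (`exists_hodgeDual_simpleForm`). As c is
continuous, it is locally constant. Therefore a closed multiple of N' is automatically co-closed,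
and curvature never enters.

(Int) ⇒ (Closed): the dzʲ and the θᵢ have the same common kernel, so dz¹ ∧ … ∧ dzⁿ = h N' with h
nowhere zero, and this form is closed. (Closed) ⇒ (Inv): if dN = 0 and the contractions of N with X
and Y vanish, then the formula for dN(X, Y, …) shows that the contraction with [X, Y] vanishes too
(`apply_bracket_eq_zero`).

(Inv) ⇒ (Int) is Frobenius' theorem, the only step in which D has to be real or analytic. A frame of
D normalised to have n constant coordinates has brackets that lie in D and vanish in these
coordinates; hence it commutes. For commuting fields P(·)u, the time-one map Φ(k, q) of the field
P(·)k satisfies ∂Φ/∂k = P(Φ); so Φ straightens the fields, and the coordinates of a transversal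
slice become first integrals (`exists_firstIntegrals`). Dependence on k and q, smooth or analytic,
over ℝ or ℂ, comes from the implicit function theorem applied to the integral equation in C([0,1],
E), where the composition operator γ ↦ P ∘ γ inherits its regularity from P. A real distribution has
a real normalised frame. A real-analytic one is extended holomorphically to a neighbourhood in ℂᵈ,
where the same theorem holds over ℂ, and the first integrals are restricted to ℝᵈ. -/

noncomputable section

namespace NullForms

open Filter Topology Set

/-! ### Composition operators on spaces of continuous maps -/

section Nemytskii

variable {α : Type*} [TopologicalSpace α]
  {𝕜 : Type*} [RCLike 𝕜]
  {E : Type*} [NormedAddCommGroup E] [NormedSpace 𝕜 E]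
  {F : Type*} [NormedAddCommGroup F] [NormedSpace 𝕜 F]

open Classical in
/-- The composition operator `γ ↦ A ∘ γ` on continuous maps (zero when `A ∘ γ` is discontinuous). -/
def postcomp (A : E → F) (γ : C(α, E)) : C(α, F) :=
  if h : Continuous (A ∘ γ) then ⟨A ∘ γ, h⟩ else 0

theorem postcomp_apply {A : E → F} {T : Set E} (hA : ContinuousOn A T) {γ : C(α, E)}
    (hγ : ∀ s, γ s ∈ T) (s : α) : postcomp A γ s = A (γ s) := by
  have h : Continuous (A ∘ γ) := hA.comp_continuous γ.continuous hγ
  simp [postcomp, h]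

variable [CompactSpace α]

variable (𝕜 E) in
/-- Evaluation at a point as a continuous linear map. -/
def evalMap (s : α) : C(α, E) →L[𝕜] E :=
  LinearMap.mkContinuous { toFun := fun γ => γ s, map_add' := by simp, map_smul' := by simp } 1
    (fun γ => by simpa using γ.norm_coe_le_norm s)

@[simp] theorem evalMap_apply (s : α) (γ : C(α, E)) : evalMap 𝕜 E s γ = γ s := rfl

variable (α 𝕜 E) in
/-- Constant maps as a continuous linear map. -/
def constMap : E →L[𝕜] C(α, E) :=
  LinearMap.mkContinuous
    { toFun := fun x => ContinuousMap.const α x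
      map_add' := fun _ _ => rfl
      map_smul' := fun _ _ => rfl } 1
    (fun x => by
      rw [one_mul]
      exact (ContinuousMap.norm_le _ (norm_nonneg x)).2 fun s => le_rfl)

@[simp] theorem constMap_apply (x : E) (s : α) : constMap α 𝕜 E x s = x := rfl

variable (α 𝕜 E F) in
/-- Pointwise application of continuous families of linear maps. -/
def pointwiseApply : C(α, E →L[𝕜] F) →L[𝕜] C(α, E) →L[𝕜] C(α, F) :=
  LinearMap.mkContinuous₂
    (LinearMap.mk₂ 𝕜 (fun (M : C(α, E →L[𝕜] F)) (η : C(α, E)) =>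
        (⟨fun s => M s (η s), M.continuous.clm_apply η.continuous⟩ : C(α, F)))
      (fun _ _ _ => by ext; simp) (fun _ _ _ => by ext; simp) (fun _ _ _ => by ext; simp)
      (fun _ _ _ => by ext; simp)) 1
    (fun M η => by
      rw [one_mul]
      refine (ContinuousMap.norm_le _ (by positivity)).2 fun s => ?_
      exact (M s).le_of_opNorm_le_of_le (M.norm_coe_le_norm s) (η.norm_coe_le_norm s))

@[simp] theorem pointwiseApply_apply (M : C(α, E →L[𝕜] F)) (η : C(α, E)) (s : α) :
    pointwiseApply α 𝕜 E F M η s = M s (η s) := rfl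

theorem isOpen_setOf_forall_mem {T : Set E} (hT : IsOpen T) :
    IsOpen {γ : C(α, E) | ∀ s, γ s ∈ T} := by
  have := ContinuousMap.isOpen_setOfPred_mapsTo (X := α) isCompact_univ hT
  convert this using 2
  ext γ
  simp [MapsTo]

/-- The first-order expansion of `A` is uniform near the compact image of `γ`; the Lebesgue number
lemma provides one `δ` for all points of the image. -/
theorem hasFDerivAt_postcomp {A : E → F} {T : Set E} (hT : IsOpen T) (hA : ContDiffOn 𝕜 1 A T)
    {γ : C(α, E)} (hγ : ∀ s, γ s ∈ T) :
    HasFDerivAt (postcomp A) (pointwiseApply α 𝕜 E F (postcomp (fderiv 𝕜 A) γ)) γ := by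
  have hA' : ContinuousOn (fderiv 𝕜 A) T := hA.continuousOn_fderiv_of_isOpen hT le_rfl
  rw [hasFDerivAt_iff_isLittleO, Asymptotics.isLittleO_iff]
  intro c hc
  have hK : IsCompact (range γ) := isCompact_range γ.continuous
  -- Strict differentiability at `a` costs `c / 2` with the derivative frozen at `a`; continuity of
  -- the derivative costs another `c / 2` to move the base point to `x`.
  choose! N hN using fun (a : E) (ha : a ∈ range γ) =>
    show ∃ N ∈ 𝓝 a, ∀ x ∈ N, ∀ y ∈ N, ‖A y - A x - fderiv 𝕜 A x (y - x)‖ ≤ c * ‖y - x‖ by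
      obtain ⟨s, rfl⟩ := ha
      have hs := hT.mem_nhds (hγ s)
      have h1 : HasStrictFDerivAt A (fderiv 𝕜 A (γ s)) (γ s) :=
        (hA.contDiffAt hs).hasStrictFDerivAt (by simp)
      have h2 := h1.isLittleO.def (half_pos hc)
      rw [nhds_prod_eq] at h2
      obtain ⟨N₁, hN₁, h3⟩ := (eventually_prod_self_iff (r := fun y x =>
        ‖A y - A x - fderiv 𝕜 A (γ s) (y - x)‖ ≤ c / 2 * ‖y - x‖)).1 h2
      have h4 : ∀ᶠ x in 𝓝 (γ s), ‖fderiv 𝕜 A x - fderiv 𝕜 A (γ s)‖ < c / 2 := by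
        have := (hA'.continuousAt hs).tendsto.sub_const (fderiv 𝕜 A (γ s))
        rw [sub_self] at this
        have := this.norm
        rw [norm_zero] at this
        exact this.eventually_lt_const (half_pos hc)
      refine ⟨N₁ ∩ {x | ‖fderiv 𝕜 A x - fderiv 𝕜 A (γ s)‖ < c / 2}, inter_mem hN₁ h4, ?_⟩
      rintro x ⟨hx, hx'⟩ y ⟨hy, -⟩
      have e : A y - A x - fderiv 𝕜 A x (y - x) = (A y - A x - fderiv 𝕜 A (γ s) (y - x)) -
          (fderiv 𝕜 A x - fderiv 𝕜 A (γ s)) (y - x) := by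
        simp
      rw [e]
      refine (norm_sub_le _ _).trans ?_
      have h5 := h3 y hy x hx
      have h6 := (fderiv 𝕜 A x - fderiv 𝕜 A (γ s)).le_of_opNorm_le (le_of_lt hx') (y - x)
      linarith
  obtain ⟨V, hV, hVN⟩ := lebesgue_number_lemma_nhds' hK (U := fun a _ => N a)
    fun a ha => (hN a ha).1
  obtain ⟨δ, hδ, hδV⟩ := Metric.mem_uniformity_dist.1 hV
  have hopen := (isOpen_setOf_forall_mem (α := α) hT).mem_nhds hγ
  filter_upwards [hopen, Metric.ball_mem_nhds γ hδ] with γ' hγ' hd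
  refine (ContinuousMap.norm_le _ (by positivity)).2 fun s => ?_
  have hs : (postcomp A γ' - postcomp A γ - pointwiseApply α 𝕜 E F (postcomp (fderiv 𝕜 A) γ)
      (γ' - γ)) s = A (γ' s) - A (γ s) - fderiv 𝕜 A (γ s) (γ' s - γ s) := by
    simp [postcomp_apply hA.continuousOn hγ, postcomp_apply hA.continuousOn hγ',
      postcomp_apply hA' hγ]
  rw [hs]
  obtain ⟨⟨a, ha1⟩, ha2⟩ := hVN (γ s) (mem_range_self s)
  have hd' : dist (γ s) (γ' s) < δ := by
    rw [dist_comm]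
    exact (ContinuousMap.dist_apply_le_dist s).trans_lt hd
  have := (hN a ha1).2 (γ s) (ha2 (UniformSpace.mem_ball_self _ hV)) (γ' s) (ha2 (hδV hd'))
  refine this.trans ?_
  gcongr
  exact (γ' - γ).norm_coe_le_norm s

end Nemytskii

universe u

/-- The derivative of a composition operator is the composition operator of `fderiv 𝕜 A` followed by
a continuous linear map, which permits induction. One derivative is lost because continuity, the
case `k = 0`, is read off from differentiability. The target is quantified inside the induction,
since it changes from `F` to `E →L[𝕜] F`; this forces `E` and `F` into one universe. -/
theorem contDiffOn_postcomp_nat {α : Type*} [TopologicalSpace α] [CompactSpace α]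
    {𝕜 : Type*} [RCLike 𝕜] {E : Type u} [NormedAddCommGroup E] [NormedSpace 𝕜 E]
    (T : Set E) (hT : IsOpen T) (k : ℕ) :
    ∀ (F : Type u) [NormedAddCommGroup F] [NormedSpace 𝕜 F] (A : E → F),
      ContDiffOn 𝕜 (k + 1) A T →
      ContDiffOn 𝕜 k (postcomp (α := α) A) {γ : C(α, E) | ∀ s, γ s ∈ T} := by
  have hO := isOpen_setOf_forall_mem (α := α) hT
  induction k with
  | zero =>
    intro F _ _ A hA
    simp only [Nat.cast_zero, zero_add] at hA ⊢
    rw [contDiffOn_zero]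
    exact fun γ hγ => (hasFDerivAt_postcomp hT hA hγ).continuousAt.continuousWithinAt
  | succ k ih =>
    intro F _ _ A hA
    have hA1 : ContDiffOn 𝕜 1 A T := hA.of_le (by simp)
    have hA2 := ((contDiffOn_succ_iff_fderiv_of_isOpen hT).1 hA).2.2
    have h3 := ih (E →L[𝕜] F) (fderiv 𝕜 A) (by exact_mod_cast hA2)
    have h4 := (pointwiseApply α 𝕜 E F).contDiff.comp_contDiffOn h3
    push_cast
    rw [contDiffOn_succ_iff_fderiv_of_isOpen hO]
    refine ⟨fun γ hγ =>
      (hasFDerivAt_postcomp hT hA1 hγ).differentiableAt.differentiableWithinAt, by simp, ?_⟩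
    exact h4.congr fun γ hγ => (hasFDerivAt_postcomp hT hA1 hγ).fderiv

section

variable {α : Type*} [TopologicalSpace α] [CompactSpace α]
  {𝕜 : Type*} [RCLike 𝕜]
  {E : Type*} [NormedAddCommGroup E] [NormedSpace 𝕜 E]
  {F : Type*} [NormedAddCommGroup F] [NormedSpace 𝕜 F]

variable (α) in
/-- The pointwise extension of a power series to continuous maps. -/
def postcompSeries (p : FormalMultilinearSeries 𝕜 E F) :
    FormalMultilinearSeries 𝕜 C(α, E) C(α, F) := fun k =>
  MultilinearMap.mkContinuous
    { toFun := fun η => ⟨fun s => p k fun j => η j s, by fun_prop⟩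
      map_update_add' := fun η i x y => by
        ext s
        have h (z : C(α, E)) : (fun j => Function.update η i z j s) =
            Function.update (fun j => η j s) i (z s) := by
          ext j; by_cases hj : j = i
          · subst hj; simp
          · simp [hj]
        simp [h]
      map_update_smul' := fun η i c x => by
        ext s
        have h (z : C(α, E)) : (fun j => Function.update η i z j s) =
            Function.update (fun j => η j s) i (z s) := by
          ext j; by_cases hj : j = i
          · subst hj; simp
          · simp [hj]
        simp [h] } ‖p k‖
    (fun η => (ContinuousMap.norm_le _ (by positivity)).2 fun s =>
      (p k).le_opNorm_mul_prod_of_le fun j => (η j).norm_coe_le_norm s)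

theorem radius_le_radius_postcompSeries (p : FormalMultilinearSeries 𝕜 E F) :
    p.radius ≤ (postcompSeries α p).radius := by
  refine ENNReal.le_of_forall_nnreal_lt fun r hr => ?_
  obtain ⟨C, -, hC⟩ := p.norm_mul_pow_le_of_lt_radius hr
  refine FormalMultilinearSeries.le_radius_of_bound _ C fun n => le_trans ?_ (hC n)
  gcongr
  exact MultilinearMap.mkContinuous_norm_le _ (norm_nonneg _) _

/-- The sup norm bounds the coefficients of the pointwise series by those of `A`, so it converges in
`C(α, F)`; evaluation at each `s` identifies its sum. A constant centre suffices, because the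
solution curves to be constructed are close to a constant one. -/
theorem analyticAt_postcomp [CompleteSpace F] {A : E → F} {a : E} (hA : AnalyticAt 𝕜 A a) :
    AnalyticAt 𝕜 (postcomp A) (ContinuousMap.const α a) := by
  obtain ⟨p, r, hp⟩ := hA
  refine ⟨postcompSeries α p, r, hp.r_le.trans (radius_le_radius_postcompSeries p), hp.r_pos,
    fun {y} hy => ?_⟩
  have hy' : y ∈ Metric.eball 0 (postcompSeries α p).radius :=
    Metric.eball_subset_eball (hp.r_le.trans (radius_le_radius_postcompSeries p)) hy
  have hys (s : α) : y s ∈ Metric.eball 0 r := by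
    rw [Metric.mem_eball, edist_zero_right] at hy ⊢
    refine lt_of_le_of_lt ?_ hy
    rw [← ofReal_norm, ← ofReal_norm]
    exact ENNReal.ofReal_le_ofReal (y.norm_coe_le_norm s)
  have hsum := (postcompSeries α p).hasSum hy'
  convert hsum using 1
  ext s
  rw [postcomp_apply (T := Metric.eball a r) hp.continuousOn]
  · refine (hp.hasSum (hys s)).unique ?_
    exact hsum.mapL (evalMap 𝕜 F s)
  · intro s
    have := hys s
    rw [Metric.mem_eball] at this ⊢
    simpa [edist_eq_enorm_sub] using this

end

/-- For `∞` the loss of one derivative is harmless; for `ω` analyticity at the constant map spreads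
to a neighbourhood. -/
theorem eventually_contDiffAt_postcomp {α : Type*} [TopologicalSpace α] [CompactSpace α]
    {𝕜 : Type*} [RCLike 𝕜] {E : Type u} [NormedAddCommGroup E] [NormedSpace 𝕜 E]
    {F : Type u} [NormedAddCommGroup F] [NormedSpace 𝕜 F] [CompleteSpace F]
    {r : WithTop ℕ∞} (hr : r = ∞ ∨ r = ω) {A : E → F} {a : E}
    (hA : ∀ᶠ p in 𝓝 a, ContDiffAt 𝕜 r A p) :
    ∀ᶠ γ in 𝓝 (ContinuousMap.const α a), ContDiffAt 𝕜 r (postcomp A) γ := by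
  rcases hr with rfl | rfl
  · obtain ⟨T, hT, hTo, haT⟩ := eventually_nhds_iff.1 hA
    have hO := isOpen_setOf_forall_mem (α := α) hTo
    have hmem : ContinuousMap.const α a ∈ {γ : C(α, E) | ∀ s, γ s ∈ T} := fun _ => haT
    filter_upwards [hO.mem_nhds hmem] with γ hγ
    refine ContDiffOn.contDiffAt (s := {γ : C(α, E) | ∀ s, γ s ∈ T}) ?_ (hO.mem_nhds hγ)
    rw [contDiffOn_infty]
    intro k
    refine contDiffOn_postcomp_nat T hTo k F A fun p hp => ?_
    exact ((hT p hp).of_le (by exact_mod_cast le_top)).contDiffWithinAt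
  · have h1 := analyticAt_postcomp (α := α) hA.self_of_nhds.analyticAt
    exact (AnalyticAt.contDiffAt h1 (n := ω)).eventually (by simp)

/-- The inverse function theorem, with regularity of the inverse on a whole neighbourhood: the
derivative stays invertible near `a`, as invertible operators form an open set. -/
theorem exists_smooth_localInverse {𝕜 : Type*} [RCLike 𝕜]
    {E : Type*} [NormedAddCommGroup E] [NormedSpace 𝕜 E] [CompleteSpace E]
    {F : Type*} [NormedAddCommGroup F] [NormedSpace 𝕜 F]
    {r : WithTop ℕ∞} (hr : 1 ≤ r) {f : E → F} {a : E}
    (hf : ∀ᶠ x in 𝓝 a, ContDiffAt 𝕜 r f x) (e : E ≃L[𝕜] F)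
    (he : HasFDerivAt f (e : E →L[𝕜] F) a) :
    ∃ g : F → E, g (f a) = a ∧ (∀ᶠ y in 𝓝 (f a), ContDiffAt 𝕜 r g y) ∧
      (∀ᶠ y in 𝓝 (f a), f (g y) = y) ∧ ∀ᶠ x in 𝓝 a, g (f x) = x := by
  have hr0 : r ≠ 0 := (zero_lt_one.trans_le hr).ne'
  have hfa := hf.self_of_nhds
  let φ := hfa.toOpenPartialHomeomorph f he hr0
  have hφ : (φ : E → F) = f := rfl
  have ha : a ∈ φ.source := hfa.mem_toOpenPartialHomeomorph_source he hr0
  have hfa' : f a ∈ φ.target := hfa.image_mem_toOpenPartialHomeomorph_target he hr0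
  have hga : φ.symm (f a) = a := φ.left_inv ha
  have hcont : ContinuousAt φ.symm (f a) := φ.continuousAt_symm hfa'
  refine ⟨φ.symm, hga, ?_, ?_, ?_⟩
  · have h1 : ∀ᶠ x in 𝓝 a, ∃ e' : E ≃L[𝕜] F, HasFDerivAt f (e' : E →L[𝕜] F) x := by
      have hc : ContinuousAt (fderiv 𝕜 f) a :=
        ((hfa.fderiv_right (m := 0) (by simpa using hr)).continuousAt)
      have := hc.preimage_mem_nhds (t := range ((↑) : (E ≃L[𝕜] F) → (E →L[𝕜] F)))
        (by rw [he.fderiv]; exact e.nhds)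
      filter_upwards [this, hf] with x ⟨e', he'⟩ hx
      exact ⟨e', he' ▸ (hx.differentiableAt hr0).hasFDerivAt⟩
    have h2 : Tendsto φ.symm (𝓝 (f a)) (𝓝 a) := by
      have := hcont.tendsto
      rwa [hga] at this
    filter_upwards [h2.eventually h1, h2.eventually hf, φ.open_target.mem_nhds hfa']
      with y ⟨e', he'⟩ hy hyt
    exact φ.contDiffAt_symm hyt he' hy
  · filter_upwards [φ.open_target.mem_nhds hfa'] with y hy
    exact φ.right_inv hy
  · filter_upwards [φ.open_source.mem_nhds ha] with x hx
    exact φ.left_inv hx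

/-! ### Solution curves as fixed points in the space of paths -/

section

variable {𝕜 : Type*} [RCLike 𝕜]
  {E : Type u} [NormedAddCommGroup E] [NormedSpace 𝕜 E] [NormedSpace ℝ E] [IsScalarTower ℝ 𝕜 E]
  [CompleteSpace E]
  {K : Type u} [NormedAddCommGroup K] [NormedSpace 𝕜 K]

/-- The continuous extension of a path to the real line. -/
def extendPath (γ : C(unitInterval, E)) (s : ℝ) : E := γ (projIcc 0 1 zero_le_one s)

omit [NormedSpace ℝ E] [CompleteSpace E] in
@[fun_prop]
theorem continuous_extendPath (γ : C(unitInterval, E)) : Continuous (extendPath γ) :=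
  γ.continuous.comp continuous_projIcc

omit [NormedSpace ℝ E] [CompleteSpace E] in
theorem extendPath_of_mem (γ : C(unitInterval, E)) (s : unitInterval) :
    extendPath γ s = γ s := by
  simp [extendPath]

variable (𝕜 E) in
/-- The primitive vanishing at `0`, as a continuous linear map on paths. -/
def primitive : C(unitInterval, E) →L[𝕜] C(unitInterval, E) :=
  LinearMap.mkContinuous
    { toFun := fun γ => ⟨fun t => ∫ s in (0 : ℝ)..t, extendPath γ s,
        (intervalIntegral.continuous_primitive
          (fun a b => (continuous_extendPath γ).intervalIntegrable a b) 0).comp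
            continuous_subtype_val⟩
      map_add' := fun γ γ' => by
        ext t
        exact intervalIntegral.integral_add ((continuous_extendPath γ).intervalIntegrable _ _)
          ((continuous_extendPath γ').intervalIntegrable _ _)
      map_smul' := fun c γ => by
        ext t
        exact intervalIntegral.integral_smul c (extendPath γ) } 1
    (fun γ => (ContinuousMap.norm_le _ (by positivity)).2 fun t => by
      have h := intervalIntegral.norm_integral_le_of_norm_le_const (a := (0 : ℝ)) (b := t)
        (f := extendPath γ) (C := ‖γ‖) fun s _ => γ.norm_coe_le_norm _
      refine h.trans ?_
      rw [sub_zero, abs_of_nonneg t.2.1, mul_comm]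
      exact mul_le_mul_of_nonneg_right t.2.2 (norm_nonneg _))

omit [CompleteSpace E] in
theorem primitive_apply (γ : C(unitInterval, E)) (t : unitInterval) :
    primitive 𝕜 E γ t = ∫ s in (0 : ℝ)..t, extendPath γ s := rfl

omit [CompleteSpace E] in
theorem norm_primitive_le (γ : C(unitInterval, E)) : ‖primitive 𝕜 E γ‖ ≤ ‖γ‖ := by
  have := (primitive 𝕜 E).le_of_opNorm_le (LinearMap.mkContinuous_norm_le _ zero_le_one _) γ
  simpa using this

theorem _root_.HasFDerivAt.continuousLinearMap_comp {X Y Z : Type*}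
    [NormedAddCommGroup X] [NormedSpace 𝕜 X] [NormedAddCommGroup Y] [NormedSpace 𝕜 Y]
    [NormedAddCommGroup Z] [NormedSpace 𝕜 Z] {f : X → Y} {f' : X →L[𝕜] Y} {x : X}
    (hf : HasFDerivAt f f' x) (B : Y →L[𝕜] Z) : HasFDerivAt (fun y => B (f y)) (B ∘L f') x :=
  B.hasFDerivAt.comp x hf

omit [NormedSpace ℝ E] [IsScalarTower ℝ 𝕜 E] in
/-- An implicit function theorem for equations `γ = c q + G(k, q, γ)` whose nonlinear part has no
derivative in the directions of `q` and `γ` at `k = 0`. -/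
theorem exists_smooth_fixedPoint {C : Type*} [NormedAddCommGroup C] [NormedSpace 𝕜 C]
    [CompleteSpace C] [CompleteSpace K] {L : Type*} [NormedAddCommGroup L] [NormedSpace 𝕜 L]
    {r : WithTop ℕ∞} (hr : 1 ≤ r) (cE : E →L[𝕜] C) (B : L →L[𝕜] K →L[𝕜] C) {p₀ : E} {N : C → L}
    (hN : ∀ᶠ γ in 𝓝 (cE p₀), ContDiffAt 𝕜 r N γ) :
    ∃ Γ : K × E → C, Γ (0, p₀) = cE p₀ ∧
      ∀ᶠ y in 𝓝 ((0, p₀) : K × E), ContDiffAt 𝕜 r Γ y ∧ Γ y = cE y.2 + B (N (Γ y)) y.1 := by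
  let G : K × E × C → C := fun y => B (N y.2.2) y.1
  let M := B (N (cE p₀))
  have ht : Tendsto (fun y : K × E × C => y.2.2) (𝓝 (0, p₀, cE p₀)) (𝓝 (cE p₀)) :=
    (continuous_snd.comp continuous_snd).tendsto (0, p₀, cE p₀)
  have hG0 : G (0, p₀, cE p₀) = 0 := map_zero _
  have hG : ∀ᶠ y in 𝓝 (0, p₀, cE p₀), ContDiffAt 𝕜 r G y := by
    filter_upwards [ht.eventually hN] with y hy
    have h0 : ContDiffAt 𝕜 r (fun y : K × E × C => N y.2.2) y :=
      ContDiffAt.comp y hy contDiffAt_snd.snd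
    exact (B.contDiff.contDiffAt.comp y h0).clm_apply contDiffAt_fst
  have hGd : HasFDerivAt G (M ∘L ContinuousLinearMap.fst 𝕜 K (E × C)) (0, p₀, cE p₀) := by
    have h0 : DifferentiableAt 𝕜 (fun y : K × E × C => N y.2.2) (0, p₀, cE p₀) :=
      DifferentiableAt.comp (f := fun y : K × E × C => y.2.2) _
        (hN.self_of_nhds.differentiableAt (zero_lt_one.trans_le hr).ne') differentiableAt_snd.snd
    have h1 : DifferentiableAt 𝕜 (fun y : K × E × C => B (N y.2.2)) (0, p₀, cE p₀) :=
      B.differentiableAt.comp _ h0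
    refine (h1.hasFDerivAt.clm_apply hasFDerivAt_fst).congr_fderiv ?_
    refine ContinuousLinearMap.ext fun y => ?_
    simp [M]
  -- `H` keeps `(k, q)` and records the defect of the equation, so solutions are the preimages of
  -- `(k, q, 0)`. Since `G` is linear in `k`, its derivative at `k = 0` only sees `k`; the
  -- derivative of `H` is then block triangular with identity diagonal and is inverted explicitly by
  -- `e`.
  let H : K × E × C → K × E × C := fun y => (y.1, y.2.1, y.2.2 - cE y.2.1 - G y)
  let a : K × E × C := (0, p₀, cE p₀)
  have hH : ∀ᶠ y in 𝓝 a, ContDiffAt 𝕜 r H y := by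
    filter_upwards [hG] with y hy
    have h3 : ContDiffAt 𝕜 r (fun y : K × E × C => cE y.2.1) y :=
      cE.contDiff.contDiffAt.comp y (contDiffAt_snd.fst)
    exact contDiffAt_fst.prodMk ((contDiffAt_snd.fst).prodMk
      (((contDiffAt_snd.snd).sub h3).sub hy))
  let e₁ : K × E × C →L[𝕜] C := ContinuousLinearMap.snd 𝕜 E C ∘L ContinuousLinearMap.snd 𝕜 K (E × C)
  let e₂ : K × E × C →L[𝕜] E := ContinuousLinearMap.fst 𝕜 E C ∘L ContinuousLinearMap.snd 𝕜 K (E × C)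
  let e₃ : K × E × C →L[𝕜] K := ContinuousLinearMap.fst 𝕜 K (E × C)
  let e : (K × E × C) ≃L[𝕜] (K × E × C) := ContinuousLinearEquiv.equivOfInverse
    (e₃.prod (e₂.prod (e₁ - cE ∘L e₂ - M ∘L e₃)))
    (e₃.prod (e₂.prod (e₁ + cE ∘L e₂ + M ∘L e₃)))
    (fun y => by ext <;> (simp [e₁, e₂, e₃]; try abel))
    (fun y => by ext <;> (simp [e₁, e₂, e₃]; try abel))
  have hHd : HasFDerivAt H (e : (K × E × C) →L[𝕜] (K × E × C)) a :=
    e₃.hasFDerivAt.prodMk (e₂.hasFDerivAt.prodMk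
      ((e₁.hasFDerivAt.sub (cE ∘L e₂).hasFDerivAt).sub hGd))
  have hHa : H a = (0, p₀, 0) := by
    simp [H, a, hG0]
  obtain ⟨g, hga, hgs, hgr, -⟩ := exists_smooth_localInverse hr hH e hHd
  rw [hHa] at hga hgs hgr
  let ι : K × E → K × E × C := fun y => (y.1, y.2, 0)
  have hι : ContDiff 𝕜 r ι := contDiff_fst.prodMk (contDiff_snd.prodMk contDiff_const)
  have hιt : Tendsto ι (𝓝 (0, p₀)) (𝓝 (0, p₀, 0)) := hι.continuous.tendsto (0, p₀)
  refine ⟨fun y => (g (ι y)).2.2, by simp [ι, hga, a], ?_⟩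
  filter_upwards [hιt.eventually hgs, hιt.eventually hgr] with y hy1 hy2
  refine ⟨(ContDiffAt.comp y hy1 hι.contDiffAt).snd.snd, ?_⟩
  have e1 : (g (ι y)).1 = y.1 := congrArg Prod.fst hy2
  have e2 : (g (ι y)).2.1 = y.2 := congrArg (fun z => z.2.1) hy2
  have e3 : (g (ι y)).2.2 - cE (g (ι y)).2.1 - G (g (ι y)) = 0 := congrArg (fun z => z.2.2) hy2
  have e4 : g (ι y) = (y.1, y.2, (g (ι y)).2.2) := by rw [← e1, ← e2]
  rw [e2, sub_sub, sub_eq_zero, e4] at e3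
  exact e3

-- Differentiating the fixed-point equation in `k` alone gives the linearised equation; for solution
-- curves this is the variational equation in integrated form.
omit [NormedSpace ℝ E] [IsScalarTower ℝ 𝕜 E] [CompleteSpace E] in
theorem fderiv_of_fixedPoint {C : Type*} [NormedAddCommGroup C] [NormedSpace 𝕜 C]
    {L : Type*} [NormedAddCommGroup L] [NormedSpace 𝕜 L]
    (cE : E →L[𝕜] C) (B : L →L[𝕜] K →L[𝕜] C) {N : C → L} {Γ : K × E → C} {y : K × E}
    (h : ∀ᶠ y in 𝓝 y, Γ y = cE y.2 + B (N (Γ y)) y.1) (hΓ : DifferentiableAt 𝕜 Γ y)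
    {N' : C →L[𝕜] L} (hN : HasFDerivAt N N' (Γ y)) (u : K) :
    fderiv 𝕜 Γ y (u, 0) = B (N' (fderiv 𝕜 Γ y (u, 0))) y.1 + B (N (Γ y)) u := by
  have h1 : HasFDerivAt (fun y => B (N (Γ y))) (B ∘L (N' ∘L fderiv 𝕜 Γ y)) y :=
    B.hasFDerivAt.comp y (hN.comp y hΓ.hasFDerivAt)
  have h2 : HasFDerivAt (fun y : K × E => cE y.2) (cE ∘L ContinuousLinearMap.snd 𝕜 K E) y :=
    (cE ∘L ContinuousLinearMap.snd 𝕜 K E).hasFDerivAt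
  have h3 := (h2.add (h1.clm_apply hasFDerivAt_fst)).congr_of_eventuallyEq (f₁ := Γ) h
  have h4 := congrArg (fun M => M (u, (0 : E))) h3.fderiv
  simp only [ContinuousLinearMap.comp_apply, ContinuousLinearMap.flip_apply,
    ContinuousLinearMap.coe_fst', ContinuousLinearMap.coe_snd', _root_.add_apply, map_zero,
    zero_add] at h4
  conv_lhs => rw [h4]
  exact add_comm _ _

set_option synthInstance.maxHeartbeats 200000 in
/-- Time-one solution curves of the family of vector fields `P(·) k`, as a smooth function of the
parameter `k` and of the initial point. -/
theorem exists_smooth_solutionCurves [CompleteSpace K] {r : WithTop ℕ∞} (hr : r = ∞ ∨ r = ω)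
    {P : E → K →L[𝕜] E} {p₀ : E} (hP : ∀ᶠ p in 𝓝 p₀, ContDiffAt 𝕜 r P p) :
    ∃ Γ : K × E → C(unitInterval, E), Γ (0, p₀) = constMap _ 𝕜 E p₀ ∧
      ∀ᶠ y in 𝓝 ((0, p₀) : K × E), ContDiffAt 𝕜 r Γ y ∧
        Γ y = constMap _ 𝕜 E y.2 + primitive 𝕜 E
          (pointwiseApply unitInterval 𝕜 K E (postcomp P (Γ y)) (constMap _ 𝕜 K y.1)) ∧
        ∀ T, IsOpen T → ContDiffOn 𝕜 1 P T → (∀ s, Γ y s ∈ T) → ∀ u, ∃ η : C(unitInterval, E),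
          fderiv 𝕜 Γ y (u, 0) = η ∧ η = primitive 𝕜 E (pointwiseApply unitInterval 𝕜 K E
              (pointwiseApply unitInterval 𝕜 E (K →L[𝕜] E) (postcomp (fderiv 𝕜 P) (Γ y)) η)
              (constMap _ 𝕜 K y.1) +
            pointwiseApply unitInterval 𝕜 K E (postcomp P (Γ y)) (constMap _ 𝕜 K u)) := by
  have hr1 : 1 ≤ r := by rcases hr with rfl | rfl <;> simp
  -- The integral equation has the shape required by the fixed-point theorem, because integration of
  -- `M(s) k` is bounded and bilinear in `(M, k)`.
  obtain ⟨B, hB⟩ : ∃ B : C(unitInterval, K →L[𝕜] E) →L[𝕜] K →L[𝕜] C(unitInterval, E),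
      ∀ M k, B M k = primitive 𝕜 E
        (pointwiseApply unitInterval 𝕜 K E M (constMap unitInterval 𝕜 K k)) :=
    ⟨(ContinuousLinearMap.compL 𝕜 K C(unitInterval, K) C(unitInterval, E)).flip
      (constMap unitInterval 𝕜 K) ∘L
      (ContinuousLinearMap.compL 𝕜 C(unitInterval, K) C(unitInterval, E) C(unitInterval, E)
        (primitive 𝕜 E) ∘L pointwiseApply unitInterval 𝕜 K E), fun _ _ => rfl⟩
  have hN := eventually_contDiffAt_postcomp (α := unitInterval) hr hP
  simp_rw [map_add, ← hB]
  obtain ⟨Γ, h0, hΓ⟩ := exists_smooth_fixedPoint hr1 (constMap unitInterval 𝕜 E) B hN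
  refine ⟨Γ, h0, ?_⟩
  filter_upwards [hΓ, hΓ.eventually_nhds] with y hy hy'
  refine ⟨hy.1, hy.2, fun T hT hPT hyT u => ⟨_, rfl, ?_⟩⟩
  exact fderiv_of_fixedPoint (constMap unitInterval 𝕜 E) B (hy'.mono fun z hz => hz.2)
    (hy.1.differentiableAt (zero_lt_one.trans_le hr1).ne') (hasFDerivAt_postcomp hT hPT hyT) u

/-- If `γ` solves `γ' = P(γ) k`, then `t P(γ) u` is the primitive of
`P(γ) u + t DP(γ)(P(γ) k) u`. -/
theorem primitive_of_solutionCurve {T : Set E} (hT : IsOpen T) {P : E → K →L[𝕜] E}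
    (hP : ContDiffOn 𝕜 1 P T) {γ : C(unitInterval, E)} (hγ : ∀ s, γ s ∈ T) {q : E} {k : K}
    (h : γ = constMap _ 𝕜 E q + primitive 𝕜 E
      (pointwiseApply unitInterval 𝕜 K E (postcomp P γ) (constMap _ 𝕜 K k))) (u : K)
    (m : C(unitInterval, E))
    (hm : ∀ s, m s = P (γ s) u + (s : ℝ) • fderiv 𝕜 P (γ s) (P (γ s) k) u) (t : unitInterval) :
    (t : ℝ) • P (γ t) u = primitive 𝕜 E m t := by
  set κ := pointwiseApply unitInterval 𝕜 K E (postcomp P γ) (constMap _ 𝕜 K k) with hκ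
  have hκs (s : unitInterval) : κ s = P (γ s) k := by
    simp [hκ, postcomp_apply hP.continuousOn hγ]
  -- The right-hand side of the integral equation extends `γ` to a differentiable curve on the whole
  -- real line, so no one-sided derivatives occur at the end points.
  let c : ℝ → E := fun t => q + ∫ s in (0 : ℝ)..t, extendPath κ s
  have hc (t : unitInterval) : c t = γ t := by
    have := congrArg (fun γ : C(unitInterval, E) => γ t) h
    simpa [c, primitive_apply] using this.symm
  have hcd (t : ℝ) : HasDerivAt c (extendPath κ t) t :=
    ((continuous_extendPath κ).integral_hasStrictDerivAt 0 t).hasDerivAt.const_add q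
  have hcc : Continuous c := continuous_iff_continuousAt.2 fun t => (hcd t).continuousAt
  have hmem (s : ℝ) (hs : s ∈ Icc (0 : ℝ) 1) : c s ∈ T := by
    have := hγ ⟨s, hs⟩
    rwa [← hc ⟨s, hs⟩] at this
  rw [primitive_apply]
  have hsub : Icc (0 : ℝ) t ⊆ Icc 0 1 := Icc_subset_Icc le_rfl t.2.2
  have hd (s : ℝ) (hs : s ∈ Icc (0 : ℝ) t) :
      HasDerivAt (fun s => s • P (c s) u) (extendPath m s) s := by
    have hs' := hsub hs
    have h1 : HasFDerivAt (fun p => P p u) ((fderiv 𝕜 P (c s)).flip u) (c s) := by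
      have := ((hP.contDiffAt (hT.mem_nhds (hmem s hs'))).differentiableAt one_ne_zero).hasFDerivAt
      simpa using this.clm_apply (hasFDerivAt_const u (c s))
    have h2 := (h1.restrictScalars ℝ).comp_hasDerivAt s (hcd s)
    have h3 := (hasDerivAt_id s).smul h2
    refine (h3 : HasDerivAt (fun s => s • P (c s) u) _ s).congr_deriv ?_
    have e1 : extendPath m s = m ⟨s, hs'⟩ := extendPath_of_mem m ⟨s, hs'⟩
    have e2 : extendPath κ s = κ ⟨s, hs'⟩ := extendPath_of_mem κ ⟨s, hs'⟩
    have e3 : c s = γ ⟨s, hs'⟩ := hc ⟨s, hs'⟩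
    rw [e1, hm, e2, hκs]
    simp [e3, add_comm]
  rw [intervalIntegral.integral_eq_sub_of_hasDerivAt_of_le t.2.1
    (fun s hs => (hd s hs).continuousAt.continuousWithinAt)
    (fun s hs => hd s (Ioo_subset_Icc_self hs))
    ((continuous_extendPath m).intervalIntegrable _ _)]
  simp [hc]

end

/-! ### Commuting flows and Frobenius' theorem over ℝ and ℂ -/

section

variable {𝕜 : Type*} [RCLike 𝕜]
  {E : Type u} [NormedAddCommGroup E] [NormedSpace 𝕜 E] [NormedSpace ℝ E] [IsScalarTower ℝ 𝕜 E]
  [CompleteSpace E]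
  {K : Type u} [NormedAddCommGroup K] [NormedSpace 𝕜 K]

/-- The vector fields `P(·) u` commute at `p`. -/
def CommutingAt (P : E → K →L[𝕜] E) (p : E) : Prop :=
  ∀ u v, fderiv 𝕜 P p (P p u) v = fderiv 𝕜 P p (P p v) u

theorem exists_eventually_norm_lt {X Z : Type*} [TopologicalSpace X] [SeminormedAddCommGroup Z]
    {f : X → Z} {x : X} (hf : ContinuousAt f x) : ∃ c, 0 ≤ c ∧ ∀ᶠ p in 𝓝 x, ‖f p‖ < c :=
  ⟨‖f x‖ + 1, by positivity, hf.norm.eventually_lt_const (lt_add_one _)⟩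

set_option synthInstance.maxHeartbeats 200000 in
/-- For commuting vector fields, the time-one map of the field `P(·) k` has derivative
`P(Γ(k, q)) u` in the direction `u` of the parameter `k`. -/
theorem exists_commuting_flow [CompleteSpace K] {r : WithTop ℕ∞} (hr : r = ∞ ∨ r = ω)
    {P : E → K →L[𝕜] E} {p₀ : E} (hP : ∀ᶠ p in 𝓝 p₀, ContDiffAt 𝕜 r P p)
    (hc : ∀ᶠ p in 𝓝 p₀, CommutingAt P p) :
    ∃ Φ : K × E → E, (∀ᶠ q in 𝓝 p₀, Φ (0, q) = q) ∧
      ∀ᶠ y in 𝓝 ((0, p₀) : K × E), ContDiffAt 𝕜 r Φ y ∧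
        ∀ u, fderiv 𝕜 Φ y (u, 0) = P (Φ y) u := by
  have hr1 : 1 ≤ r := by rcases hr with rfl | rfl <;> simp
  obtain ⟨Γ, hΓ0, hΓ⟩ := exists_smooth_solutionCurves hr hP
  have hPc : ContinuousAt (fderiv 𝕜 P) p₀ :=
    (hP.self_of_nhds.fderiv_right (m := 0) (by simpa using hr1)).continuousAt
  obtain ⟨c, hc0, hbd⟩ : ∃ c, 0 ≤ c ∧ ∀ᶠ p in 𝓝 p₀, ‖fderiv 𝕜 P p‖ < c :=
    exists_eventually_norm_lt (Z := E →L[𝕜] K →L[𝕜] E) hPc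
  obtain ⟨T, hT, hTo, hpT⟩ := eventually_nhds_iff.1 (hP.and (hc.and hbd))
  have hPT : ContDiffOn 𝕜 1 P T := fun p hp => ((hT p hp).1.of_le hr1).contDiffWithinAt
  have hO := isOpen_setOf_forall_mem (α := unitInterval) hTo
  have hΓT : ∀ᶠ y in 𝓝 ((0, p₀) : K × E), ∀ s, Γ y s ∈ T := by
    refine hΓ.self_of_nhds.1.continuousAt.preimage_mem_nhds (hO.mem_nhds ?_)
    rw [hΓ0]
    exact fun _ => hpT
  -- Smallness of `k` makes the linear variational equation a contraction, so its solution is unique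
  -- without Gronwall's inequality.
  have hk : ∀ᶠ y in 𝓝 ((0, p₀) : K × E), c * ‖y.1‖ < 1 := by
    have : Tendsto (fun y : K × E => c * ‖y.1‖) (𝓝 (0, p₀)) (𝓝 (c * ‖(0 : K)‖)) :=
      (continuous_const.mul continuous_fst.norm).tendsto _
    rw [norm_zero, mul_zero] at this
    exact this.eventually_lt_const zero_lt_one
  let ev := evalMap (α := unitInterval) 𝕜 E 1
  refine ⟨fun y => Γ y 1, ?_, ?_⟩
  · have ht : Tendsto (fun q : E => ((0, q) : K × E)) (𝓝 p₀) (𝓝 (0, p₀)) :=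
      (continuous_const.prodMk continuous_id).tendsto _
    filter_upwards [ht.eventually hΓ] with q hq
    rw [hq.2.1]
    have : pointwiseApply unitInterval 𝕜 K E (postcomp P (Γ (0, q)))
        (constMap unitInterval 𝕜 K (0, q).1) = 0 := by simp
    rw [this]
    simp
  filter_upwards [hΓ, hΓ.eventually_nhds, hΓT, hk] with y hy hy' hyT hyk
  obtain ⟨k, q⟩ := y
  refine ⟨ev.contDiff.contDiffAt.comp _ hy.1, fun u => ?_⟩
  set γ := Γ (k, q) with hγ
  have hΓd : HasFDerivAt Γ (fderiv 𝕜 Γ (k, q)) (k, q) :=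
    (hy.1.differentiableAt (zero_lt_one.trans_le hr1).ne').hasFDerivAt
  have hΦd : HasFDerivAt (fun y => Γ y 1) (ev ∘L fderiv 𝕜 Γ (k, q)) (k, q) :=
    hΓd.continuousLinearMap_comp ev
  rw [hΦd.fderiv]
  obtain ⟨η, hη, hηm⟩ := hy.2.2 T hTo hPT hyT u
  change fderiv 𝕜 Γ (k, q) (u, 0) 1 = P (γ 1) u
  rw [hη]
  have hcont := hPT.continuousOn_fderiv_of_isOpen hTo le_rfl
  set m : C(unitInterval, E) := pointwiseApply unitInterval 𝕜 K E
      (pointwiseApply unitInterval 𝕜 E (K →L[𝕜] E) (postcomp (fderiv 𝕜 P) γ) η)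
      (constMap unitInterval 𝕜 K k) +
    pointwiseApply unitInterval 𝕜 K E (postcomp P γ) (constMap unitInterval 𝕜 K u) with hm
  -- The candidate for the variation `η`: when the fields commute, changing `k` by `u` moves the
  -- curve at time `s` by `s P(γ s) u`. At `s = 1` this is the claim.
  let ζ : C(unitInterval, E) := ⟨fun s => (s : ℝ) • P (γ s) u,
    continuous_subtype_val.smul
      ((hPT.continuousOn.comp_continuous γ.continuous hyT).clm_apply continuous_const)⟩
  let m' : C(unitInterval, E) := ⟨fun s => P (γ s) u +
      (s : ℝ) • fderiv 𝕜 P (γ s) (P (γ s) k) u, by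
    have h1 := hPT.continuousOn.comp_continuous γ.continuous hyT
    have h2 := hcont.comp_continuous γ.continuous hyT
    exact (h1.clm_apply continuous_const).add (continuous_subtype_val.smul
      ((h2.clm_apply (h1.clm_apply continuous_const)).clm_apply continuous_const))⟩
  have hζm : ζ = primitive 𝕜 E m' := by
    ext t
    exact primitive_of_solutionCurve hTo hPT hyT hy.2.1 u m' (fun _ => rfl) t
  have hsub : η - ζ = primitive 𝕜 E (m - m') := by
    rw [map_sub, ← hηm, ← hζm]
  have hle : ‖η - ζ‖ ≤ c * ‖k‖ * ‖η - ζ‖ := by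
    conv_lhs => rw [hsub]
    refine (norm_primitive_le _).trans ?_
    refine (ContinuousMap.norm_le _ (by positivity)).2 fun s => ?_
    -- Commutativity replaces `DP(P k) u` by `DP(P u) k`; so `ζ` solves the same linear equation as
    -- `η`, and only the term in `η - ζ` is left.
    have e : (m - m') s = fderiv 𝕜 P (γ s) ((η - ζ) s) k := by
      have hcs := (hT _ (hyT s)).2.1 k u
      have hsm (a : ℝ) (v : E) : fderiv 𝕜 P (γ s) (a • v) k = a • fderiv 𝕜 P (γ s) v k := by
        have := ((fderiv 𝕜 P (γ s)).flip k).map_smul_of_tower a v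
        simpa using this
      simp only [m, m', ζ, ContinuousMap.sub_apply, ContinuousMap.add_apply,
        pointwiseApply_apply, constMap_apply, postcomp_apply hcont hyT,
        postcomp_apply hPT.continuousOn hyT, ContinuousMap.coe_mk, map_sub]
      rw [_root_.sub_apply, hsm, hcs]
      abel
    rw [e]
    calc ‖fderiv 𝕜 P (γ s) ((η - ζ) s) k‖ ≤ ‖fderiv 𝕜 P (γ s) ((η - ζ) s)‖ * ‖k‖ :=
          ContinuousLinearMap.le_opNorm _ _
      _ ≤ (c * ‖η - ζ‖) * ‖k‖ := by
          gcongr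
          exact (fderiv 𝕜 P (γ s)).le_of_opNorm_le_of_le (hT _ (hyT s)).2.2.le
            ((η - ζ).norm_coe_le_norm s)
      _ = c * ‖k‖ * ‖η - ζ‖ := by ring
  have hz : ‖η - ζ‖ = 0 := by
    have h0 := norm_nonneg (η - ζ)
    have : c * ‖k‖ < 1 := hyk
    nlinarith
  have hηζ : η = ζ := sub_eq_zero.1 (norm_eq_zero.1 hz)
  rw [hηζ]
  simp [ζ]

end

/-- Frobenius' theorem for a frame of commuting vector fields: near `p₀` there are
`dim E - dim K` independent functions that are constant along the fields `P(·) u`. -/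
theorem exists_firstIntegrals {𝕜 : Type*} [RCLike 𝕜]
    {E : Type u} [NormedAddCommGroup E] [NormedSpace 𝕜 E] [NormedSpace ℝ E] [IsScalarTower ℝ 𝕜 E]
    [FiniteDimensional 𝕜 E]
    {K : Type u} [NormedAddCommGroup K] [NormedSpace 𝕜 K] [FiniteDimensional 𝕜 K]
    {r : WithTop ℕ∞} (hr : r = ∞ ∨ r = ω) {P : E → K →L[𝕜] E} {p₀ : E}
    (hP : ∀ᶠ p in 𝓝 p₀, ContDiffAt 𝕜 r P p) (hc : ∀ᶠ p in 𝓝 p₀, CommutingAt P p)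
    (Q : E →L[𝕜] K) (hQ : ∀ u, Q (P p₀ u) = u) {m : ℕ}
    (hm : m + finrank 𝕜 K = finrank 𝕜 E) :
    ∃ z : Fin m → E → 𝕜, ∀ᶠ p in 𝓝 p₀, (∀ j, ContDiffAt 𝕜 r (z j) p) ∧
      (∀ j u, fderiv 𝕜 (z j) p (P p u) = 0) ∧
      LinearIndependent 𝕜 (fun j => fderiv 𝕜 (z j) p) := by
  have hr1 : 1 ≤ r := by rcases hr with rfl | rfl <;> simp
  have hr0 : r ≠ 0 := (zero_lt_one.trans_le hr1).ne'
  have : CompleteSpace E := FiniteDimensional.complete 𝕜 E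
  have : CompleteSpace K := FiniteDimensional.complete 𝕜 K
  obtain ⟨Φ, hΦ0, hΦ⟩ := exists_commuting_flow hr hP hc
  -- `p₀ + Y` is a slice transversal to the fields; `Ψ` below flows out of it and is a flow box.
  let Y : Submodule 𝕜 E := LinearMap.ker Q.toLinearMap
  let ι : K × Y → K × E := fun y => (y.1, p₀ + y.2)
  let ι' : K × Y →L[𝕜] K × E :=
    (ContinuousLinearMap.fst 𝕜 K Y).prod (Y.subtypeL ∘L ContinuousLinearMap.snd 𝕜 K Y)
  have hιd (y : K × Y) : HasFDerivAt ι ι' y :=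
    hasFDerivAt_fst.prodMk ((Y.subtypeL ∘L ContinuousLinearMap.snd 𝕜 K Y).hasFDerivAt.const_add p₀)
  have hιs : ContDiff 𝕜 r ι :=
    contDiff_fst.prodMk (contDiff_const.add
      (Y.subtypeL ∘L ContinuousLinearMap.snd 𝕜 K Y).contDiff)
  have hι0 : ι 0 = (0, p₀) := by simp [ι]
  have hιt : Tendsto ι (𝓝 0) (𝓝 (0, p₀)) := hι0 ▸ hιs.continuous.tendsto 0
  let Ψ : K × Y → E := fun y => Φ (ι y)
  have hΨs : ∀ᶠ y in 𝓝 (0 : K × Y), ContDiffAt 𝕜 r Ψ y := by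
    filter_upwards [hιt.eventually hΦ] with y hy
    exact ContDiffAt.comp y hy.1 hιs.contDiffAt
  have hΨP : ∀ᶠ y in 𝓝 (0 : K × Y), ∀ u, fderiv 𝕜 Ψ y (u, 0) = P (Ψ y) u := by
    filter_upwards [hιt.eventually hΦ] with y hy u
    have h1 : HasFDerivAt Φ (fderiv 𝕜 Φ (ι y)) (ι y) := (hy.1.differentiableAt hr0).hasFDerivAt
    have h2 : HasFDerivAt Ψ (fderiv 𝕜 Φ (ι y) ∘L ι') y := h1.comp y (hιd y)
    rw [h2.fderiv, ← hy.2 u]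
    simp [ι']
  have hΨ0 : Ψ 0 = p₀ := by
    change Φ (ι 0) = p₀
    rw [hι0]
    exact hΦ0.self_of_nhds
  let R : E →L[𝕜] Y := (ContinuousLinearMap.id 𝕜 E - P p₀ ∘L Q).codRestrict Y
    (fun x => by simp [Y, hQ])
  -- The derivative of `Ψ` at `0` is `(u, y) ↦ P p₀ u + y`; as `Q ∘ P p₀ = id`, the space splits
  -- into the range of `P p₀` and `ker Q`.
  let e : (K × Y) ≃L[𝕜] E := ContinuousLinearEquiv.equivOfInverse
    ((P p₀).coprod Y.subtypeL) (Q.prod R)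
    (fun y => by
      have hy : Q y.2 = 0 := y.2.2
      ext <;> simp [R, hQ, hy])
    (fun x => by simp [R])
  have hΨd : HasFDerivAt Ψ (e : (K × Y) →L[𝕜] E) 0 := by
    have h1 : HasFDerivAt Φ (fderiv 𝕜 Φ (0, p₀)) (0, p₀) :=
      (hΦ.self_of_nhds.1.differentiableAt hr0).hasFDerivAt
    have h2 : HasFDerivAt (fun q : E => Φ (0, q))
        (fderiv 𝕜 Φ (0, p₀) ∘L ContinuousLinearMap.inr 𝕜 K E) p₀ :=
      HasFDerivAt.comp (f := fun q : E => ((0, q) : K × E)) p₀ h1 (hasFDerivAt_prodMk_right 0 p₀)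
    have h3 := (h2.congr_of_eventuallyEq (f₁ := id) (hΦ0.mono fun q hq => hq.symm)).unique
      (hasFDerivAt_id p₀)
    have h4 : HasFDerivAt Ψ (fderiv 𝕜 Φ (0, p₀) ∘L ι') 0 := by
      rw [← hι0] at h1
      have := h1.comp (0 : K × Y) (hιd 0)
      rwa [hι0] at this
    refine h4.congr_fderiv (ContinuousLinearMap.ext fun y => ?_)
    have h5 : fderiv 𝕜 Φ (0, p₀) (0, (y.2 : E)) = y.2 := congrArg (fun M => M (y.2 : E)) h3
    have h6 : fderiv 𝕜 Φ (0, p₀) (y.1, 0) = P p₀ y.1 := by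
      rw [hΦ.self_of_nhds.2, hΦ0.self_of_nhds]
    change fderiv 𝕜 Φ (0, p₀) (y.1, (y.2 : E)) = P p₀ y.1 + y.2
    rw [← h6]
    nth_rw 2 [← h5]
    rw [← map_add]
    simp
  obtain ⟨g, hg0, hgs, hgr, hgl⟩ := exists_smooth_localInverse hr1 hΨs e hΨd
  rw [hΨ0] at hg0 hgs hgr
  have hgt : Tendsto g (𝓝 p₀) (𝓝 0) := by
    have := hgs.self_of_nhds.continuousAt.tendsto
    rwa [hg0] at this
  have hY : finrank 𝕜 Y = m := by
    have h1 : Function.Surjective Q := fun u => ⟨P p₀ u, hQ u⟩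
    have h2 := LinearMap.finrank_range_add_finrank_ker Q.toLinearMap
    rw [LinearMap.range_eq_top.2 h1, finrank_top] at h2
    change finrank 𝕜 (LinearMap.ker Q.toLinearMap) = m
    omega
  let b : Basis (Fin m) 𝕜 Y := finBasisOfFinrankEq 𝕜 Y hY
  let c : Fin m → Y →L[𝕜] 𝕜 := fun j => LinearMap.toContinuousLinearMap (b.coord j)
  let c' : Fin m → K × Y →L[𝕜] 𝕜 := fun j => c j ∘L ContinuousLinearMap.snd 𝕜 K Y
  -- The first integrals are the slice coordinates of the inverse flow box: there the fields `P(·)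
  -- u` become constant fields in the `K`-directions.
  refine ⟨fun j p => c' j (g p), ?_⟩
  filter_upwards [hgs, hgr, hgt.eventually hΨs, hgt.eventually hΨP,
    hgt.eventually hgl.eventually_nhds] with p hp1 hp2 hp3 hp4 hp5
  have hgd : HasFDerivAt g (fderiv 𝕜 g p) p := (hp1.differentiableAt hr0).hasFDerivAt
  have hzd (j : Fin m) : fderiv 𝕜 (fun p => c' j (g p)) p = c' j ∘L fderiv 𝕜 g p :=
    ((c' j).hasFDerivAt.comp p hgd).fderiv
  have hΨd : HasFDerivAt Ψ (fderiv 𝕜 Ψ (g p)) (g p) := (hp3.differentiableAt hr0).hasFDerivAt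
  have key (y : K × Y) : fderiv 𝕜 g p (fderiv 𝕜 Ψ (g p) y) = y := by
    rw [← hp2] at hgd
    have h1 := ((hgd.comp (g p) hΨd).congr_of_eventuallyEq (f₁ := id)
      (hp5.mono fun x hx => hx.symm)).unique (hasFDerivAt_id (g p))
    rw [hp2] at h1
    exact congrArg (fun M => M y) h1
  refine ⟨fun j => (c' j).contDiff.contDiffAt.comp p hp1, fun j u => ?_, ?_⟩
  · have h1 := key (u, 0)
    rw [hp4 u, hp2] at h1
    rw [hzd, ContinuousLinearMap.comp_apply, h1]
    simp [c']
  · simp_rw [hzd]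
    rw [Fintype.linearIndependent_iff]
    intro a ha i
    have h1 := congrArg (fun M => M (fderiv 𝕜 Ψ (g p) (0, b i))) ha
    simp only [_root_.sum_apply, _root_.smul_apply, ContinuousLinearMap.comp_apply, key] at h1
    simpa [c', c, Finsupp.single_apply, Finset.sum_ite_eq] using h1

/-! ### Holomorphic extension of real-analytic maps -/

section

variable {ι : Type*}

variable (ι) in
/-- The inclusion of the real coordinate space into the complex one. -/
def ofRealPi : (ι → ℝ) →L[ℝ] (ι → ℂ) :=
  ContinuousLinearMap.pi fun i => Complex.ofRealCLM ∘L ContinuousLinearMap.proj i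

variable (ι) in
/-- The real part of a complex coordinate vector. -/
def rePi : (ι → ℂ) →L[ℝ] (ι → ℝ) :=
  ContinuousLinearMap.pi fun i => Complex.reCLM ∘L ContinuousLinearMap.proj i

variable (ι) in
/-- The imaginary part of a complex coordinate vector. -/
def imPi : (ι → ℂ) →L[ℝ] (ι → ℝ) :=
  ContinuousLinearMap.pi fun i => Complex.imCLM ∘L ContinuousLinearMap.proj i

@[simp] theorem ofRealPi_apply (v : ι → ℝ) (i : ι) : ofRealPi ι v i = v i := rfl

@[simp] theorem rePi_apply (w : ι → ℂ) (i : ι) : rePi ι w i = (w i).re := rfl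

@[simp] theorem imPi_apply (w : ι → ℂ) (i : ι) : imPi ι w i = (w i).im := rfl

theorem ofRealPi_rePi_add (w : ι → ℂ) :
    ofRealPi ι (rePi ι w) + Complex.I • ofRealPi ι (imPi ι w) = w := by
  ext i
  simp [mul_comm Complex.I, Complex.re_add_im]

variable [Fintype ι]

theorem norm_rePi_le (w : ι → ℂ) : ‖rePi ι w‖ ≤ ‖w‖ :=
  (pi_norm_le_iff_of_nonneg (norm_nonneg _)).2 fun i =>
    (Complex.abs_re_le_norm _).trans (norm_le_pi_norm w i)

theorem norm_imPi_le (w : ι → ℂ) : ‖imPi ι w‖ ≤ ‖w‖ :=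
  (pi_norm_le_iff_of_nonneg (norm_nonneg _)).2 fun i =>
    (Complex.abs_im_le_norm _).trans (norm_le_pi_norm w i)

theorem norm_ofRealPi (v : ι → ℝ) : ‖ofRealPi ι v‖ = ‖v‖ := by
  simp [Pi.norm_def]

variable {F : Type*} [NormedAddCommGroup F] [NormedSpace ℂ F] [NormedSpace ℝ F]
  [IsScalarTower ℝ ℂ F]

open Classical in
/-- The complex-multilinear extension of the coefficients of a real power series. -/
def complexSeries (p : FormalMultilinearSeries ℝ (ι → ℝ) F) :
    FormalMultilinearSeries ℂ (ι → ℂ) F := fun k =>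
  ∑ ν : Fin k → ι, ((ContinuousMultilinearMap.mkPiAlgebra ℂ (Fin k) ℂ).compContinuousLinearMap
    fun j => ContinuousLinearMap.proj (ν j)).smulRight (p k fun j => Pi.single (ν j) 1)

open Classical in
omit [IsScalarTower ℝ ℂ F] in
theorem complexSeries_apply (p : FormalMultilinearSeries ℝ (ι → ℝ) F) (k : ℕ)
    (w : Fin k → ι → ℂ) : complexSeries p k w =
      ∑ ν : Fin k → ι, (∏ j, w j (ν j)) • p k fun j => Pi.single (ν j) 1 := by
  simp [complexSeries]

theorem complexSeries_ofRealPi (p : FormalMultilinearSeries ℝ (ι → ℝ) F) (k : ℕ) (v : ι → ℝ) :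
    complexSeries p k (fun _ => ofRealPi ι v) = p k fun _ => v := by
  classical
  rw [complexSeries_apply]
  have hv : (fun _ : Fin k => v) = fun _ => ∑ i, v i • (Pi.single i 1 : ι → ℝ) := by
    ext; simp [Finset.sum_apply, Pi.single_apply]
  rw [hv, ContinuousMultilinearMap.map_sum]
  refine Finset.sum_congr rfl fun ν _ => ?_
  rw [(p k).map_smul_univ (fun j => v (ν j))]
  simp only [ofRealPi_apply, ← Complex.ofReal_prod]
  exact algebraMap_smul ℂ (∏ j, v (ν j)) (p k fun j => (Pi.single (ν j) 1 : ι → ℝ))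

-- The factor is the number of terms in the expansion over basis vectors. It grows only
-- geometrically, so the radius of convergence stays positive.
omit [IsScalarTower ℝ ℂ F] in
theorem norm_complexSeries_le (p : FormalMultilinearSeries ℝ (ι → ℝ) F) (k : ℕ) :
    ‖complexSeries p k‖ ≤ (Fintype.card ι : ℝ) ^ k * ‖p k‖ := by
  classical
  refine ContinuousMultilinearMap.opNorm_le_bound (by positivity) fun w => ?_
  rw [complexSeries_apply]
  refine (norm_sum_le _ _).trans ?_
  have h (ν : Fin k → ι) : ‖(∏ j, w j (ν j)) • p k fun j => (Pi.single (ν j) 1 : ι → ℝ)‖ ≤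
      ‖p k‖ * ∏ j, ‖w j‖ := by
    rw [norm_smul, norm_prod, mul_comm]
    have h1 : ‖p k fun j => (Pi.single (ν j) 1 : ι → ℝ)‖ ≤ ‖p k‖ := by
      refine ((p k).le_opNorm _).trans (le_of_eq ?_)
      simp [Pi.norm_single]
    have h2 : ∏ j, ‖w j (ν j)‖ ≤ ∏ j, ‖w j‖ :=
      Finset.prod_le_prod (fun _ _ => norm_nonneg _) fun j _ => norm_le_pi_norm (w j) _
    gcongr
  refine (Finset.sum_le_card_nsmul _ _ _ fun ν _ => h ν).trans (le_of_eq ?_)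
  simp [mul_assoc]

omit [IsScalarTower ℝ ℂ F] in
theorem radius_complexSeries_pos {p : FormalMultilinearSeries ℝ (ι → ℝ) F} (hp : 0 < p.radius) :
    0 < (complexSeries p).radius := by
  obtain ⟨s, hs0, hs⟩ := ENNReal.lt_iff_exists_nnreal_btwn.1 hp
  obtain ⟨C, -, hC⟩ := p.norm_mul_pow_le_of_lt_radius hs
  have hs0' : 0 < s := by exact_mod_cast hs0
  -- One is added so that `N` is positive also for an empty index type.
  let N : NNReal := Fintype.card ι + 1
  have hN : 0 < N := by positivity
  refine lt_of_lt_of_le (b := ((s / N : NNReal) : ENNReal))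
    (ENNReal.coe_pos.2 (div_pos hs0' hN)) ?_
  refine FormalMultilinearSeries.le_radius_of_bound _ C fun n => le_trans ?_ (hC n)
  have hle : (Fintype.card ι : ℝ) ≤ N := by simp [N]
  have hN' : (0 : ℝ) < N := by exact_mod_cast hN
  calc ‖complexSeries p n‖ * ((s / N : NNReal) : ℝ) ^ n
      ≤ ((N : ℝ) ^ n * ‖p n‖) * ((s : ℝ) / N) ^ n := by
        have := norm_complexSeries_le p n
        have h2 : (Fintype.card ι : ℝ) ^ n ≤ (N : ℝ) ^ n := by gcongr
        push_cast
        gcongr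
        exact this.trans (by gcongr)
    _ = ‖p n‖ * (s : ℝ) ^ n := by
        rw [div_pow]
        field_simp

/-- A real-analytic function on a real coordinate space extends to a complex-analytic function
on the complex coordinate space, locally. -/
theorem exists_complexExtension [CompleteSpace F] {f : (ι → ℝ) → F} {p₀ : ι → ℝ}
    (hf : AnalyticAt ℝ f p₀) : ∃ g : (ι → ℂ) → F, AnalyticAt ℂ g (ofRealPi ι p₀) ∧
      ∀ᶠ p in 𝓝 p₀, g (ofRealPi ι p) = f p := by
  obtain ⟨p, r, hp⟩ := hf
  have hpos := radius_complexSeries_pos (hp.r_pos.trans_le hp.r_le)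
  have hP := (complexSeries p).hasFPowerSeriesOnBall hpos
  refine ⟨fun w => (complexSeries p).sum (w - ofRealPi ι p₀), ?_, ?_⟩
  · have h0 : AnalyticAt ℂ (complexSeries p).sum (ofRealPi ι p₀ - ofRealPi ι p₀) := by
      rw [sub_self]
      exact hP.analyticAt
    exact h0.comp (f := fun w => w - ofRealPi ι p₀) (analyticAt_id.sub analyticAt_const)
  · have ht : Tendsto (fun q : ι → ℝ => q - p₀) (𝓝 p₀) (𝓝 0) := by
      have := (continuous_sub_right p₀).tendsto p₀
      rwa [sub_self] at this
    have ht' : Tendsto (fun q : ι → ℝ => ofRealPi ι (q - p₀)) (𝓝 p₀) (𝓝 0) := by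
      have := ((ofRealPi ι).continuous.tendsto 0).comp ht
      rwa [map_zero] at this
    filter_upwards [ht.eventually (Metric.eball_mem_nhds 0 hp.r_pos),
      ht'.eventually (Metric.eball_mem_nhds 0 hpos)] with q hq hq'
    rw [← map_sub]
    refine ((complexSeries p).hasSum hq').unique ?_
    simp_rw [complexSeries_ofRealPi]
    have := hp.hasSum hq
    rwa [add_sub_cancel] at this

omit [NormedSpace ℝ F] [IsScalarTower ℝ ℂ F] in
/-- A complex-analytic function that vanishes at the real points vanishes identically. -/
theorem eventually_eq_zero_of_real [CompleteSpace F] {f : (ι → ℂ) → F} {p₀ : ι → ℝ}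
    (hf : AnalyticAt ℂ f (ofRealPi ι p₀)) (h0 : ∀ᶠ p in 𝓝 p₀, f (ofRealPi ι p) = 0) :
    ∀ᶠ w in 𝓝 (ofRealPi ι p₀), f w = 0 := by
  obtain ⟨δ₁, hδ₁, h1⟩ := Metric.eventually_nhds_iff.1 hf.eventually_analyticAt
  obtain ⟨δ₂, hδ₂, h2⟩ := Metric.eventually_nhds_iff.1 h0
  set δ := min δ₁ δ₂
  have hδ : 0 < δ := lt_min hδ₁ hδ₂
  refine Metric.eventually_nhds_iff.2 ⟨δ / 3, by positivity, fun w hw => ?_⟩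
  set v := w - ofRealPi ι p₀ with hv
  have hvn : ‖v‖ < δ / 3 := by rwa [dist_eq_norm] at hw
  set a := rePi ι v
  set b := imPi ι v
  have ha : ‖a‖ < δ / 3 := (norm_rePi_le v).trans_lt hvn
  have hb : ‖b‖ < δ / 3 := (norm_imPi_le v).trans_lt hvn
  -- With `w - p₀ = a + i b`, this complex line passes through `w` at `ζ = i` and through real
  -- points for real `ζ`. On the disc of radius `2` it stays within `δ` of the centre, as `‖a‖ + 2
  -- ‖b‖ < δ`; the identity theorem in one variable then carries the zeros on the real axis to `ζ =
  -- i`.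
  let c : ℂ → ι → ℂ := fun ζ => ofRealPi ι p₀ + (ofRealPi ι a + ζ • ofRealPi ι b)
  have hc (ζ : ℂ) : AnalyticAt ℂ c ζ :=
    analyticAt_const.add (analyticAt_const.add (analyticAt_id.smul analyticAt_const))
  have hcn (ζ : ℂ) (hζ : ζ ∈ Metric.ball (0 : ℂ) 2) : dist (c ζ) (ofRealPi ι p₀) < δ := by
    have hζ' : ‖ζ‖ < 2 := by simpa using hζ
    rw [dist_eq_norm]
    simp only [c, add_sub_cancel_left]
    refine (norm_add_le _ _).trans_lt ?_
    rw [norm_smul, norm_ofRealPi, norm_ofRealPi]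
    nlinarith [norm_nonneg b]
  have han : AnalyticOnNhd ℂ (f ∘ c) (Metric.ball 0 2) := fun ζ hζ =>
    (h1 ((hcn ζ hζ).trans_le (min_le_left _ _))).comp (hc ζ)
  have hzero (t : ℝ) (ht : (t : ℂ) ∈ Metric.ball (0 : ℂ) 2) : (f ∘ c) t = 0 := by
    have e : c t = ofRealPi ι (p₀ + (a + t • b)) := by
      simp [c]
    have := hcn t ht
    simp only [Function.comp_apply, e]
    apply h2
    rw [e, dist_eq_norm, ← map_sub, norm_ofRealPi] at this
    rw [dist_eq_norm]
    exact this.trans_le (min_le_right _ _)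
  have hfreq : ∃ᶠ ζ in 𝓝[≠] (0 : ℂ), (f ∘ c) ζ = 0 := by
    have ht : Tendsto (fun k : ℕ => (((1 : ℝ) / (k + 1) : ℝ) : ℂ)) atTop (𝓝[≠] 0) := by
      refine tendsto_nhdsWithin_iff.2 ⟨?_, Eventually.of_forall fun k => ?_⟩
      · have := (Complex.continuous_ofReal.tendsto 0).comp
          (tendsto_one_div_add_atTop_nhds_zero_nat (𝕜 := ℝ))
        rwa [Complex.ofReal_zero] at this
      · simp only [mem_compl_iff, mem_singleton_iff, Complex.ofReal_eq_zero]
        positivity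
    refine ht.frequently (Eventually.frequently (Eventually.of_forall fun k => hzero _ ?_))
    rw [mem_ball_zero_iff, Complex.norm_real, Real.norm_of_nonneg (by positivity)]
    have : (1 : ℝ) / (k + 1) ≤ 1 := by
      rw [div_le_one (by positivity)]
      linarith [Nat.cast_nonneg (α := ℝ) k]
    linarith
  have := han.eqOn_zero_of_preconnected_of_frequently_eq_zero
    (convex_ball (0 : ℂ) 2).isPreconnected (by simp) hfreq
  have hI := this (x := Complex.I) (by simp)
  have hcI : c Complex.I = w := by
    simp only [c, a, b, ofRealPi_rePi_add]
    simp [hv]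
  simpa [hcI] using hI

end

/-! ### Frobenius' theorem for complex distributions on ℝᵈ -/

section

variable {d n m : ℕ}

/-- The derivative of `Y` along the complex vector `w`. -/
def complexDeriv {F : Type*} [NormedAddCommGroup F] [NormedSpace ℂ F] [NormedSpace ℝ F]
    (Y : (Fin d → ℝ) → F) (p : Fin d → ℝ) (w : Fin d → ℂ) : F :=
  fderiv ℝ Y p (rePi _ w) + Complex.I • fderiv ℝ Y p (imPi _ w)

/-- The Lie bracket of complex vector fields on the real coordinate space. -/
def complexBracket (X Y : (Fin d → ℝ) → Fin d → ℂ) (p : Fin d → ℝ) : Fin d → ℂ :=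
  complexDeriv Y p (X p) - complexDeriv X p (Y p)

/-- By injectivity the coordinate functionals composed with `V` span the dual of ℂⁿ, so `n` of them
form a basis of it. -/
theorem exists_coordinates_injective (V : (Fin n → ℂ) →ₗ[ℂ] (Fin d → ℂ))
    (hV : Function.Injective V) : ∃ f : Fin n → Fin d, ∀ u, (∀ i, V u (f i) = 0) → u = 0 := by
  let ρ : Fin d → Dual ℂ (Fin n → ℂ) := fun i => LinearMap.proj i ∘ₗ V
  have hspan : Submodule.span ℂ (range ρ) = ⊤ := by
    rw [eq_top_iff]
    intro φ _
    refine mem_span_of_iInf_ker_le_ker fun u hu => ?_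
    have : u = 0 := hV <| by
      ext i
      have := (Submodule.mem_iInf _).1 hu i
      simpa [ρ] using this
    simp [this]
  have hfr : finrank ℂ (Submodule.span ℂ (range ρ)) = n := by
    rw [hspan, finrank_top, Subspace.dual_finrank_eq, finrank_fin_fun]
  obtain ⟨g, hg, hgs, -⟩ := Submodule.exists_fun_fin_finrank_span_eq ℂ (range ρ)
  choose f hf using hg
  refine ⟨fun i => f (Fin.cast hfr.symm i), fun u hu => ?_⟩
  have h0 : ∀ φ ∈ Submodule.span ℂ (range g), φ u = 0 := fun φ hφ => by
    induction hφ using Submodule.span_induction with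
    | mem x hx =>
      obtain ⟨i, rfl⟩ := hx
      rw [← hf i]
      exact hu (Fin.cast hfr i)
    | zero => rfl
    | add x y _ _ hx hy => simp [hx, hy]
    | smul a x _ hx => simp [hx]
  rw [hgs, hspan] at h0
  ext i
  exact h0 (LinearMap.proj i) trivial

/-- A complex frame can be normalised so that some of the real coordinates of its members are
constant. -/
theorem exists_normalized_frame {r : WithTop ℕ∞}
    {V : (Fin d → ℝ) → (Fin n → ℂ) →L[ℂ] (Fin d → ℂ)} {p₀ : Fin d → ℝ}
    (hV : ∀ᶠ p in 𝓝 p₀, ContDiffAt ℝ r V p)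
    (hinj : Function.Injective (V p₀)) :
    ∃ (f : Fin n → Fin d) (P : (Fin d → ℝ) → (Fin n → ℂ) →L[ℂ] (Fin d → ℂ)),
      ∀ᶠ p in 𝓝 p₀, ContDiffAt ℝ r P p ∧ (∀ u i, P p u (f i) = u i) ∧
        ∀ w, w ∈ range (P p) ↔ w ∈ range (V p) := by
  obtain ⟨f, hf⟩ := exists_coordinates_injective (V p₀).toLinearMap hinj
  let Q : (Fin d → ℂ) →L[ℂ] (Fin n → ℂ) :=
    ContinuousLinearMap.pi fun i => ContinuousLinearMap.proj (f i)
  let B : (Fin d → ℝ) → (Fin n → ℂ) →L[ℂ] (Fin n → ℂ) := fun p => Q ∘L V p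
  have hB0 : Function.Injective (B p₀) := by
    rw [injective_iff_map_eq_zero]
    intro u hu
    exact hf u fun i => congrFun hu i
  let e₀ : (Fin n → ℂ) ≃L[ℂ] (Fin n → ℂ) :=
    (LinearEquiv.ofInjectiveEndo (B p₀).toLinearMap hB0).toContinuousLinearEquiv
  have he₀ : (e₀ : (Fin n → ℂ) →L[ℂ] (Fin n → ℂ)) = B p₀ := by
    ext u; rfl
  have hBc : ContinuousAt B p₀ := continuousAt_const.clm_comp hV.self_of_nhds.continuousAt
  have hBe : ∀ᶠ p in 𝓝 p₀, ∃ e : (Fin n → ℂ) ≃L[ℂ] (Fin n → ℂ),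
      (e : (Fin n → ℂ) →L[ℂ] (Fin n → ℂ)) = B p := by
    filter_upwards [hBc.preimage_mem_nhds (t := range
      fun e : (Fin n → ℂ) ≃L[ℂ] (Fin n → ℂ) => (e : (Fin n → ℂ) →L[ℂ] (Fin n → ℂ)))
      (by rw [← he₀]; exact e₀.nhds)] with p ⟨e, he⟩
    exact ⟨e, he⟩
  -- The frame is multiplied by the inverse of its square block of selected coordinates, which is
  -- invertible near `p₀`; this leaves its span unchanged.
  refine ⟨f, fun p => V p ∘L (B p).inverse, ?_⟩
  filter_upwards [hV, hBe] with p hp ⟨e, he⟩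
  have hinv : (B p).inverse = e.symm := by rw [← he, ContinuousLinearMap.inverse_equiv]
  refine ⟨?_, fun u i => ?_, fun w => ?_⟩
  · have h1 : ContDiffAt ℂ r (fun A : (Fin n → ℂ) →L[ℂ] (Fin d → ℂ) => A ∘L (Q ∘L A).inverse)
        (V p) := by
      refine contDiffAt_id.clm_comp ?_
      have h2 : ContDiffAt ℂ r ContinuousLinearMap.inverse (Q ∘L V p) := by
        change ContDiffAt ℂ r ContinuousLinearMap.inverse (B p)
        rw [← he]
        exact contDiffAt_map_inverse e
      exact ContDiffAt.comp (f := fun A : (Fin n → ℂ) →L[ℂ] (Fin d → ℂ) => Q ∘L A) (V p) h2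
        (contDiffAt_const.clm_comp contDiffAt_id)
    exact (h1.restrict_scalars ℝ).comp p hp
  · have : B p (e.symm u) = u := by rw [← he]; simp
    change V p ((B p).inverse u) (f i) = u i
    rw [hinv]
    exact congrFun this i
  · constructor
    · rintro ⟨u, rfl⟩
      exact ⟨_, rfl⟩
    · rintro ⟨u, rfl⟩
      refine ⟨e u, ?_⟩
      change V p ((B p).inverse (e u)) = V p u
      rw [hinv]
      simp

theorem complexDeriv_clm_apply {K F : Type*} [NormedAddCommGroup K] [NormedSpace ℂ K]
    [NormedAddCommGroup F] [NormedSpace ℂ F]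
    {P : (Fin d → ℝ) → K →L[ℂ] F} {p : Fin d → ℝ} (hP : DifferentiableAt ℝ P p) (w : Fin d → ℂ)
    (u : K) : complexDeriv (fun q => P q u) p w = complexDeriv P p w u := by
  have h : HasFDerivAt (fun q => P q u)
      (((ContinuousLinearMap.apply ℂ F u).restrictScalars ℝ) ∘L fderiv ℝ P p) p :=
    ((ContinuousLinearMap.apply ℂ F u).restrictScalars ℝ).hasFDerivAt.comp p hP.hasFDerivAt
  simp [complexDeriv, h.fderiv]

/-- Members of a normalised frame of an involutive distribution commute. -/
theorem complexDeriv_normalized_symm {r : WithTop ℕ∞} (hr : 1 ≤ r)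
    {P : (Fin d → ℝ) → (Fin n → ℂ) →L[ℂ] (Fin d → ℂ)} {U : Set (Fin d → ℝ)} (hU : IsOpen U)
    (hP : ContDiffOn ℝ r P U) {f : Fin n → Fin d} (hf : ∀ p ∈ U, ∀ u i, P p u (f i) = u i)
    (hinv : ∀ X Y : (Fin d → ℝ) → Fin d → ℂ, ContDiffOn ℝ r X U → ContDiffOn ℝ r Y U →
      (∀ p ∈ U, X p ∈ range (P p)) → (∀ p ∈ U, Y p ∈ range (P p)) →
      ∀ p ∈ U, complexBracket X Y p ∈ range (P p)) {p : Fin d → ℝ} (hp : p ∈ U)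
    (u v : Fin n → ℂ) : complexDeriv P p (P p u) v = complexDeriv P p (P p v) u := by
  have hdiff : DifferentiableAt ℝ P p :=
    (hP.contDiffAt (hU.mem_nhds hp)).differentiableAt (zero_lt_one.trans_le hr).ne'
  have hs (u : Fin n → ℂ) : ContDiffOn ℝ r (fun p => P p u) U :=
    ((ContinuousLinearMap.apply ℂ (Fin d → ℂ) u).restrictScalars ℝ).contDiff.comp_contDiffOn hP
  obtain ⟨c, hc⟩ := hinv (fun p => P p u) (fun p => P p v) (hs u) (hs v)
    (fun p _ => ⟨u, rfl⟩) (fun p _ => ⟨v, rfl⟩) p hp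
  rw [complexBracket, complexDeriv_clm_apply hdiff, complexDeriv_clm_apply hdiff] at hc
  -- The selected coordinates of the frame are constant, so they vanish in every derivative and
  -- hence in the bracket. The bracket is also `P p c`, whose selected coordinates are `c`; thus `c
  -- = 0`.
  have hQ (w : Fin d → ℂ) (v : Fin n → ℂ) (i : Fin n) : complexDeriv P p w v (f i) = 0 := by
    have h1 : HasFDerivAt (fun q => P q v (f i))
        ((((ContinuousLinearMap.proj (R := ℂ) (φ := fun _ : Fin d => ℂ) (f i)) ∘L
          (ContinuousLinearMap.apply ℂ (Fin d → ℂ) v)).restrictScalars ℝ) ∘L fderiv ℝ P p) p :=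
      (((ContinuousLinearMap.proj (R := ℂ) (φ := fun _ : Fin d => ℂ) (f i)) ∘L
          (ContinuousLinearMap.apply ℂ (Fin d → ℂ) v)).restrictScalars ℝ).hasFDerivAt.comp p
        hdiff.hasFDerivAt
    have h2 : (fun _ => v i) =ᶠ[𝓝 p] fun q => P q v (f i) := by
      filter_upwards [hU.mem_nhds hp] with q hq
      exact (hf q hq v i).symm
    have h3 := (h1.congr_of_eventuallyEq h2).unique (hasFDerivAt_const (v i) p)
    have h4 (x : Fin d → ℝ) : fderiv ℝ P p x v (f i) = 0 := congrArg (fun M => M x) h3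
    simp [complexDeriv, h4]
  have hc0 : c = 0 := by
    ext i
    rw [← hf p hp c i, hc]
    simp [hQ]
  rw [hc0, map_zero] at hc
  exact sub_eq_zero.1 hc.symm

/-- Frobenius' theorem for a real distribution, given by a normalised complex frame. -/
theorem exists_firstIntegrals_real {r : WithTop ℕ∞} (hr : r = ∞ ∨ r = ω) (hmn : m + n = d)
    {P : (Fin d → ℝ) → (Fin n → ℂ) →L[ℂ] (Fin d → ℂ)} {p₀ : Fin d → ℝ} {f : Fin n → Fin d}
    (hP : ∀ᶠ p in 𝓝 p₀, ContDiffAt ℝ r P p) (hf : ∀ᶠ p in 𝓝 p₀, ∀ u i, P p u (f i) = u i)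
    (hc : ∀ᶠ p in 𝓝 p₀, ∀ u v, complexDeriv P p (P p u) v = complexDeriv P p (P p v) u)
    (hreal : ∀ᶠ p in 𝓝 p₀, ∀ w ∈ range (P p), star w ∈ range (P p)) :
    ∃ z : Fin m → (Fin d → ℝ) → ℂ, ∀ᶠ p in 𝓝 p₀, (∀ j, ContDiffAt ℝ r (z j) p) ∧
      (∀ j u, complexDeriv (z j) p (P p u) = 0) ∧
      LinearIndependent ℂ (fun j => fderiv ℝ (z j) p) := by
  have hr1 : 1 ≤ r := by rcases hr with rfl | rfl <;> simp
  have hr0 : r ≠ 0 := (zero_lt_one.trans_le hr1).ne'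
  let L : ((Fin n → ℂ) →L[ℂ] (Fin d → ℂ)) →ₗ[ℝ] ((Fin n → ℝ) →L[ℝ] (Fin d → ℝ)) :=
    { toFun := fun A => rePi _ ∘L (A.restrictScalars ℝ) ∘L ofRealPi _
      map_add' := fun A B => by ext; simp
      map_smul' := fun c A => by ext; simp }
  let L' := LinearMap.toContinuousLinearMap L
  have hL (A : (Fin n → ℂ) →L[ℂ] (Fin d → ℂ)) (u : Fin n → ℝ) :
    L' A u = rePi _ (A (ofRealPi _ u)) := rfl
  let R : (Fin d → ℝ) → (Fin n → ℝ) →L[ℝ] (Fin d → ℝ) := fun p => L' (P p)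
  -- The conjugate of `P p u`, for real `u`, lies in the distribution and has the selected
  -- coordinates `u`, so it is `P p u` again: the normalised frame is real, namely the
  -- complexification of `R`.
  have him : ∀ᶠ p in 𝓝 p₀, ∀ u, P p (ofRealPi _ u) = ofRealPi _ (R p u) := by
    filter_upwards [hf, hreal] with p hfp hrp u
    obtain ⟨c, hc⟩ := hrp _ ⟨ofRealPi _ u, rfl⟩
    have hcu : c = ofRealPi _ u := by
      ext i
      rw [← hfp c i, hc]
      simp [hfp]
    rw [hcu] at hc
    ext i
    have h1 := congrFun hc i
    change _ = (((P p (ofRealPi _ u) i).re : ℝ) : ℂ)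
    exact (Complex.conj_eq_iff_re.1 h1.symm).symm
  have hR : ∀ᶠ p in 𝓝 p₀, ContDiffAt ℝ r R p := hP.mono fun p hp =>
    L'.contDiff.contDiffAt.comp p hp
  have hRc : ∀ᶠ p in 𝓝 p₀, CommutingAt R p := by
    filter_upwards [him, hc, hP] with p h1 h2 h3 u v
    have hd : HasFDerivAt R (L' ∘L fderiv ℝ P p) p :=
      L'.hasFDerivAt.comp p (h3.differentiableAt hr0).hasFDerivAt
    have h4 := congrArg (rePi _) (h2 (ofRealPi _ u) (ofRealPi _ v))
    have e1 (x : Fin d → ℝ) : rePi _ (ofRealPi (Fin d) x) = x := by ext; simp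
    have e2 (x : Fin d → ℝ) : imPi _ (ofRealPi (Fin d) x) = 0 := by ext; simp
    simp only [complexDeriv, h1, e1, e2, map_zero, smul_zero, add_zero] at h4
    rw [hd.fderiv]
    exact h4
  let Q : (Fin d → ℝ) →L[ℝ] (Fin n → ℝ) :=
    ContinuousLinearMap.pi fun i => ContinuousLinearMap.proj (f i)
  have hQ (u : Fin n → ℝ) : Q (R p₀ u) = u := by
    ext i
    change (P p₀ (ofRealPi _ u) (f i)).re = u i
    rw [hf.self_of_nhds]
    simp
  obtain ⟨z, hz⟩ := exists_firstIntegrals hr hR hRc Q hQ (m := m) (by simp [hmn])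
  refine ⟨fun j p => (z j p : ℂ), ?_⟩
  filter_upwards [hz, him] with p ⟨hz1, hz2, hz3⟩ h1
  have hzd (j : Fin m) : HasFDerivAt (fun p => (z j p : ℂ)) (Complex.ofRealCLM ∘L fderiv ℝ (z j) p)
      p := Complex.ofRealCLM.hasFDerivAt.comp p ((hz1 j).differentiableAt hr0).hasFDerivAt
  refine ⟨fun j => Complex.ofRealCLM.contDiff.contDiffAt.comp p (hz1 j), fun j u => ?_, ?_⟩
  · have e : P p u = ofRealPi _ (R p (rePi _ u)) + Complex.I • ofRealPi _ (R p (imPi _ u)) := by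
      conv_lhs => rw [← ofRealPi_rePi_add u]
      rw [map_add, map_smul, h1, h1]
    have e1 : rePi _ (P p u) = R p (rePi _ u) := by rw [e]; ext; simp
    have e2 : imPi _ (P p u) = R p (imPi _ u) := by rw [e]; ext; simp
    rw [complexDeriv, (hzd j).fderiv, e1, e2]
    simp [hz2]
  · simp_rw [fun j => (hzd j).fderiv]
    rw [Fintype.linearIndependent_iff] at hz3 ⊢
    intro a ha i
    have key (v : Fin d → ℝ) : ∑ j, a j * (fderiv ℝ (z j) p v : ℂ) = 0 := by
      have := congrArg (fun M => M v) ha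
      simpa using this
    have h2 := hz3 (fun j => (a j).re) (by
      ext1 v
      simpa using congrArg Complex.re (key v)) i
    have h3 := hz3 (fun j => (a j).im) (by
      ext1 v
      simpa using congrArg Complex.im (key v)) i
    exact Complex.ext h2 h3

/-- Frobenius' theorem for a real-analytic complex distribution, given by a normalised frame. -/
theorem exists_firstIntegrals_analytic (hmn : m + n = d)
    {P : (Fin d → ℝ) → (Fin n → ℂ) →L[ℂ] (Fin d → ℂ)} {p₀ : Fin d → ℝ} {f : Fin n → Fin d}
    (hP : ContDiffAt ℝ ω P p₀) (hf : ∀ᶠ p in 𝓝 p₀, ∀ u i, P p u (f i) = u i)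
    (hc : ∀ᶠ p in 𝓝 p₀, ∀ u v, complexDeriv P p (P p u) v = complexDeriv P p (P p v) u) :
    ∃ z : Fin m → (Fin d → ℝ) → ℂ, ∀ᶠ p in 𝓝 p₀, (∀ j, ContDiffAt ℝ ω (z j) p) ∧
      (∀ j u, complexDeriv (z j) p (P p u) = 0) ∧
      LinearIndependent ℂ (fun j => fderiv ℝ (z j) p) := by
  obtain ⟨R, hRa, hRP⟩ := exists_complexExtension hP.analyticAt
  have hcont : Tendsto (ofRealPi (Fin d)) (𝓝 p₀) (𝓝 (ofRealPi _ p₀)) :=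
    (ofRealPi (Fin d)).continuous.tendsto p₀
  have hR0 : ContDiffAt ℂ ω R (ofRealPi _ p₀) := hRa.contDiffAt
  have hR : ∀ᶠ w in 𝓝 (ofRealPi _ p₀), ContDiffAt ℂ ω R w := hR0.eventually (by simp)
  have hfd {F : Type} [NormedAddCommGroup F] [NormedSpace ℂ F] {g : (Fin d → ℂ) → F}
      {p : Fin d → ℝ} (hg : DifferentiableAt ℂ g (ofRealPi _ p)) :
      HasFDerivAt (fun q => g (ofRealPi _ q))
        ((fderiv ℂ g (ofRealPi _ p)).restrictScalars ℝ ∘L ofRealPi _) p :=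
    HasFDerivAt.comp (f := ofRealPi (Fin d)) p (hg.hasFDerivAt.restrictScalars ℝ)
      (ofRealPi _).hasFDerivAt
  have hcd {F : Type} [NormedAddCommGroup F] [NormedSpace ℂ F] {g : (Fin d → ℂ) → F}
      {h : (Fin d → ℝ) → F} {p : Fin d → ℝ} (hg : DifferentiableAt ℂ g (ofRealPi _ p))
      (hgh : ∀ᶠ q in 𝓝 p, g (ofRealPi _ q) = h q) (w : Fin d → ℂ) :
      complexDeriv h p w = fderiv ℂ g (ofRealPi _ p) w := by
    rw [complexDeriv, ((hfd hg).congr_of_eventuallyEq (hgh.mono fun q hq => hq.symm)).fderiv]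
    conv_rhs => rw [← ofRealPi_rePi_add w, map_add, map_smul]
    rfl
  -- The commutators of the extended fields are analytic and vanish at real points, hence vanish
  -- near `p₀`. Only the finitely many pairs of basis vectors are treated this way, so that a common
  -- neighbourhood exists; bilinearity gives the rest.
  have hRc : ∀ᶠ w in 𝓝 (ofRealPi _ p₀), CommutingAt R w := by
    have hb (i j : Fin n) : ∀ᶠ w in 𝓝 (ofRealPi _ p₀),
        fderiv ℂ R w (R w (Pi.single i 1)) (Pi.single j 1) -
          fderiv ℂ R w (R w (Pi.single j 1)) (Pi.single i 1) = 0 := by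
      refine eventually_eq_zero_of_real ?_ ?_
      · have h1 : ContDiffAt ℂ ω (fderiv ℂ R) (ofRealPi _ p₀) := hR0.fderiv_right (by simp)
        have h2 (i j : Fin n) : ContDiffAt ℂ ω
            (fun w => fderiv ℂ R w (R w (Pi.single i 1)) (Pi.single j 1)) (ofRealPi _ p₀) :=
          (h1.clm_apply (hR0.clm_apply contDiffAt_const)).clm_apply contDiffAt_const
        exact ((h2 i j).sub (h2 j i)).analyticAt
      · filter_upwards [hc, hRP.eventually_nhds, hcont.eventually hR] with p h1 h2 h3
        have h4 := h1 (Pi.single i 1) (Pi.single j 1)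
        rw [hcd (h3.differentiableAt (by simp)) h2, hcd (h3.differentiableAt (by simp)) h2,
          ← h2.self_of_nhds] at h4
        exact sub_eq_zero.2 h4
    have hall := eventually_all.2 fun i => eventually_all.2 fun j => hb i j
    filter_upwards [hall] with w hw u v
    have hsum (u v : Fin n → ℂ) : fderiv ℂ R w (R w u) v =
        ∑ i, ∑ j, (u i * v j) • fderiv ℂ R w (R w (Pi.single i 1)) (Pi.single j 1) := by
      conv_lhs => rw [pi_eq_sum_univ' u, pi_eq_sum_univ' v]
      simp only [map_sum, map_smul, _root_.sum_apply, _root_.smul_apply, Finset.smul_sum, smul_smul]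
      rw [Finset.sum_comm]
      refine Finset.sum_congr rfl fun i _ => Finset.sum_congr rfl fun j _ => ?_
      rw [mul_comm]
    rw [hsum u v, hsum v u, Finset.sum_comm]
    refine Finset.sum_congr rfl fun i _ => Finset.sum_congr rfl fun j _ => ?_
    rw [sub_eq_zero.1 (hw j i), mul_comm]
  let Q : (Fin d → ℂ) →L[ℂ] (Fin n → ℂ) :=
    ContinuousLinearMap.pi fun i => ContinuousLinearMap.proj (f i)
  have hQ (u : Fin n → ℂ) : Q (R (ofRealPi _ p₀) u) = u := by
    rw [hRP.self_of_nhds]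
    ext i
    exact hf.self_of_nhds u i
  obtain ⟨z, hz⟩ := exists_firstIntegrals (Or.inr rfl) hR hRc Q hQ (m := m) (by simp [hmn])
  refine ⟨fun j p => z j (ofRealPi _ p), ?_⟩
  filter_upwards [hcont.eventually hz, hRP] with p ⟨hz1, hz2, hz3⟩ h1
  have hzd (j : Fin m) := (hz1 j).differentiableAt (by simp)
  refine ⟨fun j => ContDiffAt.comp (g := z j) (f := ofRealPi (Fin d)) p
    ((hz1 j).restrict_scalars ℝ) (ofRealPi (Fin d)).contDiff.contDiffAt,
    fun j u => ?_, ?_⟩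
  · rw [hcd (hzd j) (Eventually.of_forall fun _ => rfl), ← h1]
    exact hz2 j u
  · simp_rw [fun j => (hfd (hzd j)).fderiv]
    rw [Fintype.linearIndependent_iff] at hz3 ⊢
    intro a ha
    refine hz3 a ?_
    ext1 w
    -- A relation between the differentials on real vectors extends to ℂᵈ by complex linearity, so
    -- independence survives the restriction to real points.
    have key (v : Fin d → ℝ) : ∑ j, a j * fderiv ℂ (z j) (ofRealPi _ p) (ofRealPi _ v) = 0 := by
      have := congrArg (fun M => M v) ha
      simpa using this
    rw [← ofRealPi_rePi_add w]
    have h2 := key (rePi _ w)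
    have h3 := key (imPi _ w)
    simp only [_root_.sum_apply, _root_.smul_apply, map_add, map_smul, smul_eq_mul, h2, zero_add,
      _root_.zero_apply]
    rw [h3]

/-- Frobenius' theorem for complex distributions which are real or real-analytic: near `p₀` an
involutive distribution of rank `n` in dimension `m + n` is annihilated by the differentials of
`m` functions, linearly independent over `ℂ`. -/
theorem exists_complexFirstIntegrals {r : WithTop ℕ∞} (hr : r = ∞ ∨ r = ω) (hmn : m + n = d)
    {V : (Fin d → ℝ) → (Fin n → ℂ) →L[ℂ] (Fin d → ℂ)} {p₀ : Fin d → ℝ}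
    (hV : ∀ᶠ p in 𝓝 p₀, ContDiffAt ℝ r V p) (hinj : Function.Injective (V p₀))
    {T : Set (Fin d → ℝ)} (hT : T ∈ 𝓝 p₀)
    (hinv : ∀ U ⊆ T, IsOpen U → ∀ X Y : (Fin d → ℝ) → Fin d → ℂ, ContDiffOn ℝ r X U →
      ContDiffOn ℝ r Y U → (∀ p ∈ U, X p ∈ range (V p)) → (∀ p ∈ U, Y p ∈ range (V p)) →
      ∀ p ∈ U, complexBracket X Y p ∈ range (V p))
    (hreal : r = ω ∨ ∀ᶠ p in 𝓝 p₀, ∀ w ∈ range (V p), star w ∈ range (V p)) :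
    ∃ z : Fin m → (Fin d → ℝ) → ℂ, ∀ᶠ p in 𝓝 p₀, (∀ j, ContDiffAt ℝ r (z j) p) ∧
      (∀ j, ∀ w ∈ range (V p), complexDeriv (z j) p w = 0) ∧
      LinearIndependent ℂ (fun j => fderiv ℝ (z j) p) := by
  have hr1 : 1 ≤ r := by rcases hr with rfl | rfl <;> simp
  -- The normalised frame lives on a smaller neighbourhood only, which is why involutivity is
  -- assumed on all open subsets of `T`.
  obtain ⟨f, P, hP⟩ := exists_normalized_frame hV hinj
  obtain ⟨U, hU, hUo, hpU⟩ := eventually_nhds_iff.1 (hP.and hT)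
  have hUn : U ∈ 𝓝 p₀ := hUo.mem_nhds hpU
  have hPr : ∀ p ∈ U, range (P p) = range (V p) := fun p hp => Set.ext (hU p hp).1.2.2
  have hc : ∀ p ∈ U, ∀ u v, complexDeriv P p (P p u) v = complexDeriv P p (P p v) u := by
    intro p hp u v
    refine complexDeriv_normalized_symm hr1 hUo (fun q hq => (hU q hq).1.1.contDiffWithinAt)
      (fun q hq => (hU q hq).1.2.1) (fun X Y hX hY hXV hYV q hq => ?_) hp u v
    rw [hPr q hq]
    exact hinv U (fun q hq => (hU q hq).2) hUo X Y hX hY (fun q hq => hPr q hq ▸ hXV q hq)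
      (fun q hq => hPr q hq ▸ hYV q hq) q hq
  have hc' := (eventually_of_mem hUn hc)
  have hf : ∀ᶠ p in 𝓝 p₀, ∀ u i, P p u (f i) = u i := hP.mono fun p hp => hp.2.1
  have key : ∃ z : Fin m → (Fin d → ℝ) → ℂ, ∀ᶠ p in 𝓝 p₀, (∀ j, ContDiffAt ℝ r (z j) p) ∧
      (∀ j u, complexDeriv (z j) p (P p u) = 0) ∧
      LinearIndependent ℂ (fun j => fderiv ℝ (z j) p) := by
    rcases hreal with rfl | hreal
    · exact exists_firstIntegrals_analytic hmn hP.self_of_nhds.1 hf hc'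
    · refine exists_firstIntegrals_real hr hmn (hP.mono fun p hp => hp.1) hf hc' ?_
      filter_upwards [hreal, hUn] with p hp hpU
      rwa [hPr p hpU]
  obtain ⟨z, hz⟩ := key
  refine ⟨z, ?_⟩
  filter_upwards [hz, hUn] with p hp hpU
  refine ⟨hp.1, fun j w hw => ?_, hp.2.2⟩
  rw [← hPr p hpU] at hw
  obtain ⟨u, rfl⟩ := hw
  exact hp.2.1 j u

end

end NullForms

namespace NullForms

/-! ### Simple forms and complex covectors -/

section LinearAlgebra

variable {V : Type*} [AddCommGroup V] [Module ℝ V] [TopologicalSpace V]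

/-- The complex-linear extension of a complex covector to the complexification. -/
def complexCovector (θ : V →L[ℝ] ℂ) : ℂ ⊗[ℝ] V →ₗ[ℂ] ℂ :=
  LinearMap.liftBaseChange ℂ θ.toLinearMap

@[simp] theorem complexCovector_tmul (θ : V →L[ℝ] ℂ) (a : ℂ) (v : V) :
    complexCovector θ (a ⊗ₜ v) = a * θ v := by
  simp [complexCovector]

theorem exists_eq_tmul_add_tmul {V : Type*} [AddCommGroup V] [Module ℝ V] (X : ℂ ⊗[ℝ] V) :
    ∃ a b : V, X = (1 : ℂ) ⊗ₜ[ℝ] a + Complex.I ⊗ₜ[ℝ] b := by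
  induction X using TensorProduct.induction_on with
  | zero => exact ⟨0, 0, by simp⟩
  | tmul c v =>
    refine ⟨c.re • v, c.im • v, ?_⟩
    rw [← TensorProduct.smul_tmul, ← TensorProduct.smul_tmul, ← TensorProduct.add_tmul]
    congr 1
    apply Complex.ext <;> simp
  | add X Y hX hY =>
    obtain ⟨a, b, rfl⟩ := hX
    obtain ⟨a', b', rfl⟩ := hY
    exact ⟨a + a', b + b', by simp only [TensorProduct.tmul_add]; abel⟩

theorem simpleForm_apply {p : ℕ} (θ : Fin p → V →L[ℝ] ℂ) (w : Fin p → V) :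
    simpleForm θ w = ((p.factorial : ℂ)⁻¹) * (Matrix.of fun i j => θ i (w j)).det := by
  rw [simpleForm, ContinuousAlternatingMap.smul_apply,
    ContinuousMultilinearMap.alternatization_apply_apply, ← Matrix.det_transpose, Matrix.det_apply]
  rw [Complex.real_smul]
  push_cast
  congr 1

theorem simpleForm_compContinuousLinearMap {V' : Type*} [AddCommGroup V'] [Module ℝ V']
    [TopologicalSpace V'] {p : ℕ} (θ : Fin p → V →L[ℝ] ℂ) (L : V' →L[ℝ] V) :
    (simpleForm θ).compContinuousLinearMap L = simpleForm fun i => θ i ∘L L := by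
  ext w
  simp [simpleForm_apply]

theorem linearIndependent_complexCovector {p : ℕ} {θ : Fin p → V →L[ℝ] ℂ} :
    LinearIndependent ℂ (fun i => complexCovector (θ i)) ↔ LinearIndependent ℂ θ := by
  rw [Fintype.linearIndependent_iff, Fintype.linearIndependent_iff]
  refine forall_congr' fun c => imp_congr ⟨fun h => ?_, fun h => ?_⟩ Iff.rfl
  · ext v
    simpa using LinearMap.congr_fun h ((1 : ℂ) ⊗ₜ v)
  · refine LinearMap.ext fun X => ?_
    obtain ⟨a, b, rfl⟩ := exists_eq_tmul_add_tmul X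
    have ha := DFunLike.congr_fun h a
    have hb := DFunLike.congr_fun h b
    simp only [_root_.sum_apply, _root_.smul_apply, smul_eq_mul, _root_.zero_apply] at ha hb
    simp only [map_add, LinearMap.coe_sum, Finset.sum_apply, LinearMap.smul_apply,
      complexCovector_tmul, smul_eq_mul, LinearMap.zero_apply, one_mul]
    simp_rw [mul_left_comm _ Complex.I]
    rw [← Finset.mul_sum, ha, hb]
    simp

/-- The vectors `(θ i v)ᵢ`, with `v` real, span ℂᵖ, since a functional vanishing on all of them is a
linear relation between the `θ i`. A basis chosen among them gives `w`. -/
theorem exists_det_ne_zero {p : ℕ} {θ : Fin p → V →L[ℝ] ℂ} (hθ : LinearIndependent ℂ θ) :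
    ∃ w : Fin p → V, (Matrix.of fun i j => θ i (w j)).det ≠ 0 := by
  set S : Set (Fin p → ℂ) := Set.range fun v : V => fun i => θ i v with hS
  have htop : Submodule.span ℂ S = ⊤ := by
    by_contra hne
    obtain ⟨f, hf0, hf⟩ := Submodule.exists_le_ker_of_lt_top _ (lt_top_iff_ne_top.2 hne)
    have hfe : ∀ u, f u = ∑ i, f (Pi.single i 1) * u i := by
      intro u
      conv_lhs => rw [← Finset.univ_sum_single u, map_sum]
      refine Finset.sum_congr rfl fun i _ => ?_
      have : Pi.single i (u i) = u i • (Pi.single i (1 : ℂ) : Fin p → ℂ) := by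
        rw [← Pi.single_smul]; simp
      rw [this, map_smul, smul_eq_mul, mul_comm]
    have h0 := Fintype.linearIndependent_iff.1 hθ (fun i => f (Pi.single i 1)) (by
      ext v
      have : f (fun i => θ i v) = 0 := hf (Submodule.subset_span ⟨v, rfl⟩)
      rw [hfe] at this
      simpa using this)
    exact hf0 (LinearMap.ext fun u => by rw [hfe]; simp [h0])
  obtain ⟨f, hf, -, hli⟩ := Submodule.exists_fun_fin_finrank_span_eq ℂ S
  have hp : finrank ℂ (Submodule.span ℂ S) = p := by rw [htop]; simp
  choose w hw using hf
  refine ⟨fun j => w (Fin.cast hp.symm j), ?_⟩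
  have hli' : LinearIndependent ℂ (fun j : Fin p => f (Fin.cast hp.symm j)) :=
    hli.comp _ (Fin.cast_injective _)
  have := (Matrix.linearIndependent_rows_iff_isUnit
    (A := Matrix.of fun j i => f (Fin.cast hp.symm j) i)).1 hli'
  rw [Matrix.isUnit_iff_isUnit_det, isUnit_iff_ne_zero, ← Matrix.det_transpose] at this
  convert this using 2
  ext i j
  simp [← hw]

theorem exists_simpleForm_apply_ne_zero {p : ℕ} {θ : Fin p → V →L[ℝ] ℂ}
    (hθ : LinearIndependent ℂ θ) : ∃ w : Fin p → V, simpleForm θ w ≠ 0 := by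
  obtain ⟨w, hw⟩ := exists_det_ne_zero hθ
  refine ⟨w, ?_⟩
  rw [simpleForm_apply]
  exact mul_ne_zero (inv_ne_zero (by exact_mod_cast p.factorial_ne_zero)) hw

/-- The inclusion of kernels puts every `θ' j` into the span of the `θ i`; the factor is the
determinant of the transition matrix, nonzero because `simpleForm θ'` is. -/
theorem exists_simpleForm_eq_smul [Module.Finite ℝ V] {p : ℕ} {θ θ' : Fin p → V →L[ℝ] ℂ}
    (hθ' : LinearIndependent ℂ θ')
    (hker : ⨅ i, LinearMap.ker (complexCovector (θ i)) ≤
      ⨅ i, LinearMap.ker (complexCovector (θ' i))) :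
    ∃ c : ℂ, c ≠ 0 ∧ simpleForm θ' = c • simpleForm θ := by
  have hmem : ∀ j, ∃ c : Fin p → ℂ, ∑ i, c i • complexCovector (θ i) = complexCovector (θ' j) :=
    fun j => (Submodule.mem_span_range_iff_exists_fun ℂ).1
      (FiniteDimensional.mem_span_of_iInf_ker_le_ker (hker.trans (iInf_le _ j)))
  choose A hA using hmem
  have hA' : ∀ j v, θ' j v = ∑ i, A j i * θ i v := by
    intro j v
    have := LinearMap.congr_fun (hA j) ((1 : ℂ) ⊗ₜ v)
    simpa using this.symm
  have hdet : ∀ w : Fin p → V, simpleForm θ' w = (Matrix.of A).det * simpleForm θ w := by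
    intro w
    rw [simpleForm_apply, simpleForm_apply, mul_left_comm, ← Matrix.det_mul]
    congr 2
    ext i j
    simp [Matrix.mul_apply, hA']
  refine ⟨(Matrix.of A).det, fun h => ?_, ?_⟩
  · obtain ⟨w, hw⟩ := exists_simpleForm_apply_ne_zero hθ'
    exact hw (by rw [hdet, h, zero_mul])
  · ext w
    exact hdet w

/-- The form takes real arguments, so its contraction with the complex vector `a + i b` appears as
the value at `a` plus `I` times the value at `b`. -/
theorem simpleForm_update_add {p : ℕ} (θ : Fin p → V →L[ℝ] ℂ) (w : Fin p → V) (j : Fin p)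
    (a b : V) : simpleForm θ (Function.update w j a) +
      Complex.I * simpleForm θ (Function.update w j b) = ((p.factorial : ℂ)⁻¹) *
      ((Matrix.of fun i j => θ i (w j)).updateCol j fun i =>
        complexCovector (θ i) ((1 : ℂ) ⊗ₜ a + Complex.I ⊗ₜ b)).det := by
  have key : ∀ c : V, (Matrix.of fun i k => θ i (Function.update w j c k)) =
      (Matrix.of fun i k => θ i (w k)).updateCol j fun i => θ i c := by
    intro c
    ext i k
    by_cases h : k = j
    · subst h; simp
    · simp [h]
  rw [simpleForm_apply, simpleForm_apply, key, key, mul_left_comm, ← mul_add,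
    ← Matrix.det_updateCol_smul, ← Matrix.det_updateCol_add]
  congr 3
  ext i
  simp

/-- The contractions are, up to `1/p!`, the entries of Cramer's vector for the right-hand side `t i
= θ i (a + i b)`; if they vanish and the determinant does not, then `t = 0`. -/
theorem complexCovector_eq_zero_iff {p : ℕ} {θ : Fin p → V →L[ℝ] ℂ}
    (hθ : LinearIndependent ℂ θ) (a b : V) :
    (∀ i, complexCovector (θ i) ((1 : ℂ) ⊗ₜ a + Complex.I ⊗ₜ b) = 0) ↔
      ∀ (w : Fin p → V) (j : Fin p), simpleForm θ (Function.update w j a) +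
        Complex.I * simpleForm θ (Function.update w j b) = 0 := by
  constructor
  · intro h w j
    rw [simpleForm_update_add]
    simp only [h]
    rw [Matrix.det_eq_zero_of_column_eq_zero j (by simp), mul_zero]
  · intro h
    obtain ⟨w, hw⟩ := exists_det_ne_zero hθ
    set t : Fin p → ℂ := fun i => complexCovector (θ i) ((1 : ℂ) ⊗ₜ a + Complex.I ⊗ₜ b)
    set A : Matrix (Fin p) (Fin p) ℂ := Matrix.of fun i j => θ i (w j)
    have hc : A.cramer t = 0 := by
      ext j
      have := h w j
      rw [simpleForm_update_add] at this
      rw [Matrix.cramer_apply]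
      exact (mul_eq_zero.1 this).resolve_left
        (inv_ne_zero (by exact_mod_cast p.factorial_ne_zero))
    have := Matrix.mulVec_cramer A t
    rw [hc, Matrix.mulVec_zero] at this
    have ht := (smul_eq_zero.1 this.symm).resolve_left hw
    exact fun i => congrFun ht i

end LinearAlgebra

end NullForms

namespace NullForms

/-! ### The Hodge dual of a null form at a point -/

section Contraction

variable {W ι κ ν : Type*} [AddCommGroup W] [Module ℂ W] [Fintype ι] [DecidableEq ι] [Fintype ν]

theorem map_sumElim_sum_smul (F : W [⋀^ι ⊕ κ]→ₗ[ℂ] ℂ) (w : κ → W) (T : ι → ν → ℂ) (f : ν → W) :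
    F (Sum.elim (fun i => ∑ k, T i k • f k) w) =
      ∑ a : ι → ν, (∏ i, T i (a i)) * F (Sum.elim (f ∘ a) w) := by
  classical
  have h1 := congrArg (fun f => f w) (MultilinearMap.map_sum
    (MultilinearMap.currySum F.toMultilinearMap) (fun i k => T i k • f k))
  simp only [_root_.sum_apply] at h1
  refine h1.trans (Finset.sum_congr rfl fun a _ => ?_)
  exact congrArg (fun f => f w) (MultilinearMap.map_smul_univ
    (MultilinearMap.currySum F.toMultilinearMap) (fun i => T i (a i)) (f ∘ a))

/-- Each permutation in the determinant contributes the same amount: after reindexing `a`, its sign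
cancels against that of the alternating `F`. This evaluates the sum over all index tuples in the
Hodge dual. -/
theorem sum_det_mul_map_sumElim [Fintype κ] [DecidableEq κ] (F : W [⋀^ι ⊕ κ]→ₗ[ℂ] ℂ) (w : κ → W) (T : ι → ν → ℂ)
    (f : ν → W) :
    ∑ a : ι → ν, (Matrix.of fun i j => T i (a j)).det * F (Sum.elim (f ∘ a) w) =
      (Fintype.card ι).factorial * F (Sum.elim (fun i => ∑ k, T i k • f k) w) := by
  have h1 : ∀ σ : Equiv.Perm ι, ∑ a : ι → ν, (Equiv.Perm.sign σ : ℂ) *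
      (∏ i, T i (a (σ i))) * F (Sum.elim (f ∘ a) w) =
      F (Sum.elim (fun i => ∑ k, T i k • f k) w) := by
    intro σ
    rw [map_sumElim_sum_smul, ← (Equiv.arrowCongr σ (Equiv.refl ν)).sum_comp]
    refine Finset.sum_congr rfl fun a _ => ?_
    have h2 : Sum.elim (f ∘ ((Equiv.arrowCongr σ (Equiv.refl ν)) a)) w =
        Sum.elim (f ∘ a) w ∘ (Equiv.sumCongr σ.symm (Equiv.refl κ)) := by
      ext (i | i) <;> simp [Equiv.arrowCongr]
    rw [h2, F.map_perm, show (Equiv.sumCongr σ.symm (Equiv.refl κ)) =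
      Equiv.Perm.sumCongr σ⁻¹ 1 from rfl, Equiv.Perm.sign_sumCongr]
    simp only [Equiv.arrowCongr, Equiv.coe_fn_mk, Equiv.coe_refl, Function.comp_apply, id_eq,
      Equiv.symm_apply_apply, Equiv.Perm.sign_inv, Equiv.Perm.sign_one, mul_one]
    rcases Int.units_eq_one_or (Equiv.Perm.sign σ) with h | h <;> simp [h]
  simp_rw [← Matrix.det_transpose (Matrix.of _), Matrix.det_apply', Finset.sum_mul]
  rw [Finset.sum_comm]
  simp only [Matrix.transpose_apply, Matrix.of_apply]
  rw [Finset.sum_congr rfl fun σ _ => h1 σ]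
  simp [Fintype.card_perm]

end Contraction

section Hodge

variable {V : Type*} [AddCommGroup V] [Module ℝ V] [TopologicalSpace V] {p q : ℕ}

/-- The complex-multilinear extension of a form of top degree. -/
def complexVolume (b : Basis (Fin p ⊕ Fin q) ℝ V) (ε : V [⋀^Fin (p + q)]→L[ℝ] ℝ) :
    (ℂ ⊗[ℝ] V) [⋀^Fin p ⊕ Fin q]→ₗ[ℂ] ℂ :=
  (ε (b ∘ finSumFinEquiv.symm) : ℂ) • (b.baseChange ℂ).det

theorem complexVolume_tmul (b : Basis (Fin p ⊕ Fin q) ℝ V) (ε : V [⋀^Fin (p + q)]→L[ℝ] ℝ)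
    (u : Fin p → V) (w : Fin q → V) :
    complexVolume b ε (Sum.elim (fun i => (1 : ℂ) ⊗ₜ u i) (fun i => (1 : ℂ) ⊗ₜ w i)) =
      (ε (Fin.append u w) : ℂ) := by
  have h := (ε.toAlternatingMap.domDomCongr finSumFinEquiv.symm).eq_smul_basis_det b
  have h2 := AlternatingMap.congr_fun h (Sum.elim u w)
  have h3 : Sum.elim u w ∘ finSumFinEquiv.symm = Fin.append u w := by
    funext j
    refine Fin.addCases (fun a => ?_) (fun a => ?_) j <;> simp
  have h4 : ε (Fin.append u w) = ε (b ∘ finSumFinEquiv.symm) * b.det (Sum.elim u w) := by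
    rw [← h3]
    exact h2
  rw [h4, complexVolume, AlternatingMap.smul_apply, smul_eq_mul, Complex.ofReal_mul]
  congr 1
  rw [Basis.det_apply, Basis.det_apply, ← Complex.ofRealHom_eq_coe, RingHom.map_det]
  congr 1
  ext i j
  rcases j with j | j <;> simp [Basis.toMatrix_apply]

theorem tmul_eq_sum_dualBasis {V : Type*} [AddCommGroup V] [Module ℝ V] [Module.Finite ℝ V]
    (B : LinearMap.BilinForm ℝ V)
    (hB : B.Nondegenerate) {ι : Type*} [Finite ι] [Fintype ι] [DecidableEq ι] (e : Basis ι ℝ V)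
    (X : ℂ ⊗[ℝ] V) :
    X = ∑ k, B.baseChange ℂ X ((1 : ℂ) ⊗ₜ e k) • ((1 : ℂ) ⊗ₜ[ℝ] B.dualBasis hB e k) := by
  have h1 : ∀ (c : ℂ) (v : V), c ⊗ₜ[ℝ] v =
      ∑ k, B.baseChange ℂ (c ⊗ₜ[ℝ] v) ((1 : ℂ) ⊗ₜ e k) •
        ((1 : ℂ) ⊗ₜ[ℝ] B.dualBasis hB e k) := by
    intro c v
    conv_lhs => rw [← (B.dualBasis hB e).sum_repr v, TensorProduct.tmul_sum]
    refine Finset.sum_congr rfl fun k _ => ?_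
    rw [LinearMap.BilinForm.dualBasis_repr_apply, LinearMap.BilinForm.baseChange_tmul, mul_one,
      TensorProduct.smul_tmul', smul_eq_mul, mul_one, ← TensorProduct.smul_tmul]
  obtain ⟨a, b, rfl⟩ := exists_eq_tmul_add_tmul X
  simp only [map_add, LinearMap.add_apply, add_smul, Finset.sum_add_distrib]
  rw [← h1, ← h1]

/-- Raising the index of `θ i` with the dual basis recovers the vector `X i`. Contracting over all
tuples yields `p!` equal terms, which cancel one of the two factors `1/p!`. -/
theorem hodgeDual_simpleForm [Module.Finite ℝ V] (B : LinearMap.BilinForm ℝ V)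
    (hB : B.Nondegenerate) (ε : V [⋀^Fin (p + q)]→L[ℝ] ℝ) (b : Basis (Fin p ⊕ Fin q) ℝ V)
    {θ : Fin p → V →L[ℝ] ℂ} {X : Fin p → ℂ ⊗[ℝ] V}
    (hθ : ∀ i v, B.baseChange ℂ (X i) ((1 : ℂ) ⊗ₜ v) = θ i v) (w : Fin q → V) :
    hodgeDual B hB ε (simpleForm θ) w =
      (p.factorial : ℂ)⁻¹ * complexVolume b ε (Sum.elim X fun i => (1 : ℂ) ⊗ₜ w i) := by
  have hX : X = fun i => ∑ k, θ i (finBasis ℝ V k) •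
      ((1 : ℂ) ⊗ₜ[ℝ] B.dualBasis hB (finBasis ℝ V) k) := by
    funext i
    conv_lhs => rw [tmul_eq_sum_dualBasis B hB (finBasis ℝ V) (X i)]
    simp only [hθ]
  have key := sum_det_mul_map_sumElim (complexVolume b ε) (fun i => (1 : ℂ) ⊗ₜ w i)
    (fun i k => θ i (finBasis ℝ V k)) (fun k => (1 : ℂ) ⊗ₜ[ℝ] B.dualBasis hB (finBasis ℝ V) k)
  rw [← hX, Fintype.card_fin] at key
  have hp : (p.factorial : ℂ) ≠ 0 := by exact_mod_cast p.factorial_ne_zero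
  rw [← mul_right_inj' hp, ← mul_assoc _ (_ : ℂ)⁻¹, mul_inv_cancel₀ hp, one_mul]
  rw [← mul_right_inj' hp, ← key, hodgeDual, ContinuousAlternatingMap.smul_apply,
    Complex.real_smul]
  push_cast
  rw [mul_inv_cancel_left₀ hp, ContinuousAlternatingMap.sum_apply, Finset.mul_sum]
  refine Finset.sum_congr rfl fun a _ => ?_
  rw [ContinuousAlternatingMap.smul_apply, simpleForm_apply, smul_eq_mul, ← mul_assoc, ← mul_assoc,
    mul_inv_cancel₀ hp, one_mul]
  congr 1
  exact (complexVolume_tmul b ε _ w).symm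

/-- The Gram determinant factors as `det u · det G · det u'`, with `G` the Gram matrix of the real
basis `b`. The sign `s` is that of `det G`, hence independent of `u` and `u'`. -/
theorem complexVolume_mul (B : LinearMap.BilinForm ℝ V) (ε : V [⋀^Fin (p + q)]→L[ℝ] ℝ)
    (hε : ∀ v, ε v ^ 2 = |(Matrix.of fun i j => B (v i) (v j)).det|)
    (b : Basis (Fin p ⊕ Fin q) ℝ V) :
    ∃ s : ℂ, (s = 1 ∨ s = -1) ∧ ∀ u u' : Fin p ⊕ Fin q → ℂ ⊗[ℝ] V,
      complexVolume b ε u * complexVolume b ε u' =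
        s * (Matrix.of fun i j => B.baseChange ℂ (u i) (u' j)).det := by
  set G : Matrix (Fin p ⊕ Fin q) (Fin p ⊕ Fin q) ℝ := Matrix.of fun i j => B (b i) (b j) with hG
  have hGε : ε (b ∘ finSumFinEquiv.symm) ^ 2 = |G.det| := by
    rw [hε, ← Matrix.det_reindex_self finSumFinEquiv]
    rfl
  have hdet : ∀ u u' : Fin p ⊕ Fin q → ℂ ⊗[ℝ] V,
      (Matrix.of fun i j => B.baseChange ℂ (u i) (u' j)).det =
        (b.baseChange ℂ).det u * (G.det : ℂ) * (b.baseChange ℂ).det u' := by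
    intro u u'
    rw [Basis.det_apply, Basis.det_apply, ← Matrix.det_transpose ((b.baseChange ℂ).toMatrix u),
      ← Complex.ofRealHom_eq_coe, RingHom.map_det, ← Matrix.det_mul, ← Matrix.det_mul]
    congr 1
    ext i j
    rw [Matrix.of_apply, LinearMap.BilinForm.apply_eq_dotProduct_toMatrix_mulVec (b.baseChange ℂ),
      Matrix.mul_assoc, Matrix.mul_apply, dotProduct]
    refine Finset.sum_congr rfl fun k _ => ?_
    rw [Matrix.mul_apply, Matrix.mulVec, dotProduct, Matrix.transpose_apply, Basis.toMatrix_apply]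
    refine congrArg _ (Finset.sum_congr rfl fun l _ => ?_)
    simp [LinearMap.BilinForm.toMatrix_apply, hG, Basis.toMatrix_apply]
  have hs : ∃ s : ℂ, (s = 1 ∨ s = -1) ∧ (|G.det| : ℝ) = s * (G.det : ℂ) := by
    rcases abs_choice G.det with h | h
    · exact ⟨1, Or.inl rfl, by rw [h]; simp⟩
    · exact ⟨-1, Or.inr rfl, by rw [h]; simp⟩
  obtain ⟨s, hs, hsG⟩ := hs
  refine ⟨s, hs, fun u u' => ?_⟩
  rw [hdet, complexVolume, AlternatingMap.smul_apply, AlternatingMap.smul_apply, smul_eq_mul,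
    smul_eq_mul]
  have : (ε (b ∘ finSumFinEquiv.symm) : ℂ) ^ 2 = s * (G.det : ℂ) := by
    rw [← hsG, ← hGε]; push_cast; rfl
  linear_combination (b.baseChange ℂ).det u * (b.baseChange ℂ).det u' * this

/-- Exchanging the two blocks of columns makes the matrix block triangular; `t` is the sign of this
exchange and depends only on `p`. -/
theorem det_sum_zero_left {p : ℕ} : ∃ t : ℂ, (t = 1 ∨ t = -1) ∧
    ∀ (A : Matrix (Fin p) (Fin p) ℂ) (C : Matrix (Fin p) (Fin p) ℂ)
      (F : Matrix (Fin p) (Fin p) ℂ),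
      (Matrix.fromBlocks 0 A C F).det = t * (A.det * C.det) := by
  set σ : Equiv.Perm (Fin p ⊕ Fin p) := Equiv.sumComm _ _
  refine ⟨(Equiv.Perm.sign σ : ℂ), ?_, fun A C F => ?_⟩
  · rcases Int.units_eq_one_or (Equiv.Perm.sign σ) with h | h <;> simp [h]
  · have h := Matrix.det_permute' σ (Matrix.fromBlocks 0 A C F)
    have h2 : (Matrix.fromBlocks 0 A C F).submatrix id σ = Matrix.fromBlocks A 0 F C := by
      ext (i | i) (j | j) <;> simp [σ]
    rw [h2, Matrix.det_fromBlocks_zero₁₂] at h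
    rw [h]
    rcases Int.units_eq_one_or (Equiv.Perm.sign σ) with h | h <;> simp [h]

/-- The null `p`-form of a maximal isotropic subspace is an eigenvector of the Hodge dual. -/
theorem exists_hodgeDual_simpleForm [Module.Finite ℝ V] (B : LinearMap.BilinForm ℝ V)
    (hB : B.Nondegenerate) (ε : V [⋀^Fin (p + p)]→L[ℝ] ℝ)
    (hε : ∀ v, ε v ^ 2 = |(Matrix.of fun i j => B (v i) (v j)).det|)
    (b : Basis (Fin p ⊕ Fin p) ℝ V)
    {θ : Fin p → V →L[ℝ] ℂ} {X : Fin p → ℂ ⊗[ℝ] V}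
    (hθ : ∀ i v, B.baseChange ℂ (X i) ((1 : ℂ) ⊗ₜ v) = θ i v)
    (hθ' : ∀ i v, B.baseChange ℂ ((1 : ℂ) ⊗ₜ v) (X i) = θ i v)
    (hli : LinearIndependent ℂ θ) (hX : ∀ i j, B.baseChange ℂ (X i) (X j) = 0) :
    ∃ c : ℂ, c ^ 4 = 1 ∧ hodgeDual B hB ε (simpleForm θ) = c • simpleForm θ := by
  obtain ⟨s, hs, hvol⟩ := complexVolume_mul B ε hε b
  obtain ⟨t, ht, hblock⟩ := det_sum_zero_left (p := p)
  set Δ : (Fin p → V) → ℂ := fun w => (Matrix.of fun i j => θ i (w j)).det with hΔ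
  set e : (Fin p → V) → ℂ := fun w => complexVolume b ε (Sum.elim X fun i => (1 : ℂ) ⊗ₜ w i)
  -- Isotropy kills the upper left block of the Gram matrix of `(X, w')` against `(X, w)`. The
  -- resulting identity in two independent arguments forces `e` to be a multiple of `Δ`, the square
  -- of the factor being `s t = ± 1`.
  have hmul : ∀ w w', e w' * e w = s * t * (Δ w * Δ w') := by
    intro w w'
    rw [hvol, mul_assoc, hΔ]
    congr 1
    simp only
    rw [← Matrix.det_transpose (Matrix.of fun i j => θ i (w' j)),
      ← hblock _ _ (Matrix.of fun i j => B.baseChange ℂ ((1 : ℂ) ⊗ₜ w' i) ((1 : ℂ) ⊗ₜ w j))]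
    congr 1
    ext (i | i) (j | j) <;> simp [hX, hθ, hθ', -LinearMap.BilinForm.baseChange_tmul]
  have hst : (s * t) ^ 2 = 1 := by
    rcases hs with rfl | rfl <;> rcases ht with rfl | rfl <;> norm_num
  have hst0 : s * t ≠ 0 := fun h => by rw [h] at hst; norm_num at hst
  obtain ⟨w₀, hw₀⟩ := exists_det_ne_zero hli
  have hΔ0 : Δ w₀ ≠ 0 := hw₀
  have he0 : e w₀ ≠ 0 := by
    intro h
    have := hmul w₀ w₀
    rw [h, mul_zero] at this
    exact mul_ne_zero hst0 (mul_ne_zero hΔ0 hΔ0) this.symm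
  have hsq : (e w₀ / Δ w₀) ^ 2 = s * t := by
    rw [div_pow, div_eq_iff (pow_ne_zero _ hΔ0)]
    linear_combination hmul w₀ w₀
  refine ⟨e w₀ / Δ w₀, ?_, ?_⟩
  · rw [show (4 : ℕ) = 2 * 2 from rfl, pow_mul, hsq, hst]
  · ext w
    rw [hodgeDual_simpleForm B hB ε b hθ, ContinuousAlternatingMap.smul_apply, simpleForm_apply,
      smul_eq_mul, mul_left_comm]
    congr 1
    change e w = e w₀ / Δ w₀ * Δ w
    rw [← mul_right_inj' he0, hmul w w₀, ← hsq]
    field_simp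

end Hodge

/-! ### Isotropic subspaces of half the dimension -/

section Isotropic

variable {V : Type*} [AddCommGroup V] [Module ℝ V]
  (B : LinearMap.BilinForm ℝ V)

theorem baseChange_nondegenerate (hB : B.Nondegenerate) (hsymm : ∀ v w, B v w = B w v) :
    (B.baseChange ℂ).Nondegenerate ∧ ∀ X Y, B.baseChange ℂ X Y = B.baseChange ℂ Y X := by
  have hs : ∀ X Y, B.baseChange ℂ X Y = B.baseChange ℂ Y X := by
    intro X Y
    obtain ⟨a, b, rfl⟩ := exists_eq_tmul_add_tmul X
    obtain ⟨c, d, rfl⟩ := exists_eq_tmul_add_tmul Y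
    simp only [map_add, LinearMap.add_apply, LinearMap.BilinForm.baseChange_tmul, hsymm c, hsymm d]
    ring_nf
  have hl : ∀ X, (∀ Y, B.baseChange ℂ X Y = 0) → X = 0 := by
    intro X hX
    obtain ⟨a, b, rfl⟩ := exists_eq_tmul_add_tmul X
    have h : ∀ v, B a v = 0 ∧ B b v = 0 := by
      intro v
      have := hX ((1 : ℂ) ⊗ₜ v)
      simp only [map_add, LinearMap.add_apply, LinearMap.BilinForm.baseChange_tmul] at this
      have h1 := congrArg Complex.re this
      have h2 := congrArg Complex.im this
      simp at h1 h2
      exact ⟨h1, h2⟩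
    rw [hB.1 a fun v => (h v).1, hB.1 b fun v => (h v).2]
    simp
  exact ⟨⟨hl, fun X hX => hl X fun Y => by rw [hs]; exact hX Y⟩, hs⟩

/-- An isotropic subspace of half the dimension is its own orthogonal complement. -/
theorem mem_iff_of_isotropic [Module.Finite ℝ V] (hB : B.Nondegenerate) (hsymm : ∀ v w, B v w = B w v)
    (W : Submodule ℂ (ℂ ⊗[ℝ] V)) (hW : ∀ X ∈ W, ∀ Y ∈ W, B.baseChange ℂ X Y = 0)
    (hdim : finrank ℝ V = 2 * finrank ℂ W) (X : ℂ ⊗[ℝ] V) :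
    X ∈ W ↔ ∀ Y ∈ W, B.baseChange ℂ Y X = 0 := by
  obtain ⟨hN, hs⟩ := baseChange_nondegenerate B hB hsymm
  have hle : W ≤ LinearMap.BilinForm.orthogonal (B.baseChange ℂ) W := by
    intro Y hY Z hZ
    exact hW Z hZ Y hY
  have hfin := LinearMap.BilinForm.finrank_orthogonal hN W
  rw [Module.finrank_baseChange, hdim, two_mul, Nat.add_sub_cancel] at hfin
  have heq := Submodule.eq_of_le_of_finrank_eq hle hfin.symm
  refine ⟨fun h Y hY => hW Y hY X h, fun h => ?_⟩
  rw [heq]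
  exact fun Y hY => h Y hY

end Isotropic

end NullForms

namespace NullForms
open Filter Topology Set

/-! ### Fields, brackets and covectors in charts -/

section Charts

variable {E : Type*} [NormedAddCommGroup E] [NormedSpace ℝ E]
  {M : Type*} [TopologicalSpace M] [ChartedSpace E M]

/-- The derivative of the inverse of the chart at `x₀`. -/
def chartInv (x₀ : M) (q : E) :
    E →L[ℝ] TangentSpace 𝓘(ℝ, E) ((extChartAt 𝓘(ℝ, E) x₀).symm q) :=
  mfderiv 𝓘(ℝ, E) 𝓘(ℝ, E) (extChartAt 𝓘(ℝ, E) x₀).symm q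

/-- The derivative of the chart at `x₀`. -/
def chartDeriv (x₀ : M) (x : M) : TangentSpace 𝓘(ℝ, E) x →L[ℝ] E :=
  mfderiv 𝓘(ℝ, E) 𝓘(ℝ, E) (extChartAt 𝓘(ℝ, E) x₀) x

/-- The expression of a vector field in the chart at `x₀`. -/
def chartField (x₀ : M) (V : ∀ x : M, TangentSpace 𝓘(ℝ, E) x) (q : E) : E :=
  chartDeriv x₀ ((extChartAt 𝓘(ℝ, E) x₀).symm q) (V ((extChartAt 𝓘(ℝ, E) x₀).symm q))

/-- The vector field with a given expression in the chart at `x₀`. -/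
def chartLift (x₀ : M) (v : E → E) : ∀ x : M, TangentSpace 𝓘(ℝ, E) x :=
  VectorField.mpullback 𝓘(ℝ, E) 𝓘(ℝ, E) (extChartAt 𝓘(ℝ, E) x₀) v

variable [IsManifold 𝓘(ℝ, E) 1 M] {x₀ : M}

theorem chartDeriv_chartInv {q : E} (hq : q ∈ (extChartAt 𝓘(ℝ, E) x₀).target) (e : E) :
    chartDeriv x₀ ((extChartAt 𝓘(ℝ, E) x₀).symm q) (chartInv x₀ q e) = e := by
  have h := mfderiv_extChartAt_comp_mfderivWithin_extChartAt_symm hq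
  simp only [modelWithCornersSelf_coe, range_id, mfderivWithin_univ] at h
  exact DFunLike.congr_fun h e

theorem chartInv_chartDeriv {q : E} (hq : q ∈ (extChartAt 𝓘(ℝ, E) x₀).target)
    (v : TangentSpace 𝓘(ℝ, E) ((extChartAt 𝓘(ℝ, E) x₀).symm q)) :
    chartInv x₀ q (chartDeriv x₀ ((extChartAt 𝓘(ℝ, E) x₀).symm q) v) = v := by
  have h := mfderivWithin_extChartAt_symm_comp_mfderiv_extChartAt hq
  simp only [modelWithCornersSelf_coe, range_id, mfderivWithin_univ] at h
  exact DFunLike.congr_fun h v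

theorem isInvertible_mfderiv_extChartAt_symm {q : E}
    (hq : q ∈ (extChartAt 𝓘(ℝ, E) x₀).target) :
    (mfderiv 𝓘(ℝ, E) 𝓘(ℝ, E) (extChartAt 𝓘(ℝ, E) x₀).symm q).IsInvertible := by
  have h := isInvertible_mfderivWithin_extChartAt_symm hq
  simpa only [modelWithCornersSelf_coe, range_id, mfderivWithin_univ] using h

theorem inverse_chartInv {q : E} (hq : q ∈ (extChartAt 𝓘(ℝ, E) x₀).target) :
    (chartInv x₀ q).inverse = chartDeriv x₀ ((extChartAt 𝓘(ℝ, E) x₀).symm q) :=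
  ContinuousLinearMap.inverse_eq (ContinuousLinearMap.ext (chartInv_chartDeriv hq))
    (ContinuousLinearMap.ext (chartDeriv_chartInv hq))

theorem inverse_chartDeriv {q : E} (hq : q ∈ (extChartAt 𝓘(ℝ, E) x₀).target) :
    (chartDeriv x₀ ((extChartAt 𝓘(ℝ, E) x₀).symm q)).inverse = chartInv x₀ q :=
  ContinuousLinearMap.inverse_eq (ContinuousLinearMap.ext (chartDeriv_chartInv hq))
    (ContinuousLinearMap.ext (chartInv_chartDeriv hq))

theorem chartField_eq_mpullback {q : E} (hq : q ∈ (extChartAt 𝓘(ℝ, E) x₀).target)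
    (V : ∀ x : M, TangentSpace 𝓘(ℝ, E) x) :
    chartField x₀ V q =
      VectorField.mpullback 𝓘(ℝ, E) 𝓘(ℝ, E) (extChartAt 𝓘(ℝ, E) x₀).symm V q := by
  rw [chartField, ← inverse_chartInv hq]
  rfl

theorem chartInv_chartField {q : E} (hq : q ∈ (extChartAt 𝓘(ℝ, E) x₀).target)
    (V : ∀ x : M, TangentSpace 𝓘(ℝ, E) x) :
    chartInv x₀ q (chartField x₀ V q) = V ((extChartAt 𝓘(ℝ, E) x₀).symm q) :=
  chartInv_chartDeriv hq _

theorem chartLift_symm {q : E} (hq : q ∈ (extChartAt 𝓘(ℝ, E) x₀).target) (v : E → E) :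
    chartLift x₀ v ((extChartAt 𝓘(ℝ, E) x₀).symm q) = chartInv x₀ q (v q) := by
  rw [← inverse_chartDeriv hq]
  have h : ∀ q', q' = q → (chartDeriv x₀ ((extChartAt 𝓘(ℝ, E) x₀).symm q)).inverse (v q') =
      (chartDeriv x₀ ((extChartAt 𝓘(ℝ, E) x₀).symm q)).inverse (v q) := by
    rintro _ rfl
    rfl
  exact h _ ((extChartAt 𝓘(ℝ, E) x₀).right_inv hq)

theorem chartField_chartLift {q : E} (hq : q ∈ (extChartAt 𝓘(ℝ, E) x₀).target) (v : E → E) :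
    chartField x₀ (chartLift x₀ v) q = v q := by
  rw [chartField, chartLift_symm hq, chartDeriv_chartInv hq]

theorem chartDeriv_self (x : M) (v : TangentSpace 𝓘(ℝ, E) x) : chartDeriv x x v = v :=
  DFunLike.congr_fun (mfderiv_extChartAt_self (I := 𝓘(ℝ, E)) (x := x)) v

variable {r : WithTop ℕ∞}

theorem contMDiffAt_extChartAt_symm [IsManifold 𝓘(ℝ, E) r M] {q : E} (hq : q ∈ (extChartAt 𝓘(ℝ, E) x₀).target) :
    ContMDiffAt 𝓘(ℝ, E) 𝓘(ℝ, E) r (extChartAt 𝓘(ℝ, E) x₀).symm q :=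
  (contMDiffOn_extChartAt_symm x₀).contMDiffAt ((isOpen_extChartAt_target x₀).mem_nhds hq)

theorem eventually_mem_extChartAt_target {q : E} (hq : q ∈ (extChartAt 𝓘(ℝ, E) x₀).target) :
    ∀ᶠ q' in 𝓝 q, q' ∈ (extChartAt 𝓘(ℝ, E) x₀).target :=
  (isOpen_extChartAt_target x₀).mem_nhds hq

/-- Moving vector fields through the derivative of a chart costs one derivative; the classes `∞` and
`ω` absorb it. -/
theorem add_one_eq_of_smooth (hr : r = ∞ ∨ r = ω) : r + 1 = r := by
  rcases hr with rfl | rfl <;> rfl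

theorem nat_le_of_smooth (hr : r = ∞ ∨ r = ω) (k : ℕ) : (k : WithTop ℕ∞) ≤ r := by
  rcases hr with rfl | rfl
  · exact_mod_cast le_top
  · exact le_top

theorem ne_zero_of_smooth (hr : r = ∞ ∨ r = ω) : r ≠ 0 := by
  rcases hr with rfl | rfl <;> simp

variable [IsManifold 𝓘(ℝ, E) r M] [CompleteSpace E]

theorem contDiffAt_chartField (hr : r = ∞ ∨ r = ω) {q : E}
    (hq : q ∈ (extChartAt 𝓘(ℝ, E) x₀).target) {V : ∀ x : M, TangentSpace 𝓘(ℝ, E) x}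
    (hV : ContMDiffAt 𝓘(ℝ, E) 𝓘(ℝ, E).tangent r
      (fun x => (⟨x, V x⟩ : TangentBundle 𝓘(ℝ, E) M)) ((extChartAt 𝓘(ℝ, E) x₀).symm q)) :
    ContDiffAt ℝ r (chartField x₀ V) q := by
  have h : ContDiffAt ℝ r (fun q' => (VectorField.mpullback 𝓘(ℝ, E) 𝓘(ℝ, E)
      (extChartAt 𝓘(ℝ, E) x₀).symm V q' : E)) q :=
    contMDiffAt_vectorSpace_iff_contDiffAt.1
      (ContMDiffAt.mpullback_vectorField_preimage (n := r) hV (contMDiffAt_extChartAt_symm hq)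
        (isInvertible_mfderiv_extChartAt_symm hq) (add_one_eq_of_smooth hr).le)
  refine h.congr_of_eventuallyEq ?_
  filter_upwards [eventually_mem_extChartAt_target hq] with q' hq'
  exact chartField_eq_mpullback hq' V

theorem contMDiffAt_chartLift (hr : r = ∞ ∨ r = ω) {x : M} (hx : x ∈ (chartAt E x₀).source)
    {v : E → E} (hv : ContDiffAt ℝ r v (extChartAt 𝓘(ℝ, E) x₀ x)) :
    ContMDiffAt 𝓘(ℝ, E) 𝓘(ℝ, E).tangent r
      (fun x => (⟨x, chartLift x₀ v x⟩ : TangentBundle 𝓘(ℝ, E) M)) x :=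
  ContMDiffAt.mpullback_vectorField_preimage (n := r)
    (contMDiffAt_vectorSpace_iff_contDiffAt.2 hv) (contMDiffAt_extChartAt' hx)
    (isInvertible_mfderiv_extChartAt (by simpa using hx)) (add_one_eq_of_smooth hr).le

/-- The bracket is natural under pullback by the inverse chart, and on the model space it is the
usual commutator of derivatives. -/
theorem chartField_mlieBracket (hr : r = ∞ ∨ r = ω) {q : E}
    (hq : q ∈ (extChartAt 𝓘(ℝ, E) x₀).target) {V W : ∀ x : M, TangentSpace 𝓘(ℝ, E) x}
    (hV : ContMDiffAt 𝓘(ℝ, E) 𝓘(ℝ, E).tangent r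
      (fun x => (⟨x, V x⟩ : TangentBundle 𝓘(ℝ, E) M)) ((extChartAt 𝓘(ℝ, E) x₀).symm q))
    (hW : ContMDiffAt 𝓘(ℝ, E) 𝓘(ℝ, E).tangent r
      (fun x => (⟨x, W x⟩ : TangentBundle 𝓘(ℝ, E) M)) ((extChartAt 𝓘(ℝ, E) x₀).symm q)) :
    chartField x₀ (VectorField.mlieBracket 𝓘(ℝ, E) V W) q =
      fderiv ℝ (chartField x₀ W) q (chartField x₀ V q) -
        fderiv ℝ (chartField x₀ V) q (chartField x₀ W q) := by
  have h2 : minSmoothness ℝ 2 ≤ r := by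
    rw [minSmoothness_of_isRCLikeNormedField]
    exact_mod_cast nat_le_of_smooth hr 2
  have : IsManifold 𝓘(ℝ, E) (minSmoothness ℝ 2) M := IsManifold.of_le h2
  have h := VectorField.mpullback_mlieBracket (n := r)
    (hV.mdifferentiableAt (ne_zero_of_smooth hr)) (hW.mdifferentiableAt (ne_zero_of_smooth hr))
    (contMDiffAt_extChartAt_symm hq) h2
  have hcongr : ∀ V : ∀ x : M, TangentSpace 𝓘(ℝ, E) x,
      (fun q' => (VectorField.mpullback 𝓘(ℝ, E) 𝓘(ℝ, E)
        (extChartAt 𝓘(ℝ, E) x₀).symm V q' : E)) =ᶠ[𝓝 q] chartField x₀ V := fun V => by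
    filter_upwards [eventually_mem_extChartAt_target hq] with q' hq'
    exact (chartField_eq_mpullback hq' V).symm
  refine (chartField_eq_mpullback hq _).trans (h.trans ?_)
  refine (congrFun (VectorField.mlieBracketWithin_univ (I := 𝓘(ℝ, E))).symm q).trans ?_
  refine (congrFun VectorField.mlieBracketWithin_eq_lieBracketWithin q).trans ?_
  refine (congrFun VectorField.lieBracketWithin_univ q).trans ?_
  exact (hcongr V).lieBracket_vectorField_eq (hcongr W)

theorem contMDiffAt_inner (g : PseudoMetric r E M) {x : M} {V W : ∀ x : M, TangentSpace 𝓘(ℝ, E) x}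
    (hV : ContMDiffAt 𝓘(ℝ, E) 𝓘(ℝ, E).tangent r
      (fun x => (⟨x, V x⟩ : TangentBundle 𝓘(ℝ, E) M)) x)
    (hW : ContMDiffAt 𝓘(ℝ, E) 𝓘(ℝ, E).tangent r
      (fun x => (⟨x, W x⟩ : TangentBundle 𝓘(ℝ, E) M)) x) :
    ContMDiffAt 𝓘(ℝ, E) 𝓘(ℝ, ℝ) r (fun x => g.inner x (V x) (W x)) x := by
  have h : ContMDiffAt 𝓘(ℝ, E) (𝓘(ℝ, E).prod 𝓘(ℝ)) r
      (fun m ↦ TotalSpace.mk' ℝ (E := Bundle.Trivial M ℝ) m (g.inner m (V m) (W m))) x := by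
    apply ContMDiffAt.clm_bundle_apply₂ (F₁ := E) (F₂ := E)
    · exact g.contMDiff x
    · exact hV
    · exact hW
  simp only [contMDiffAt_totalSpace] at h
  exact h.2

variable [FiniteDimensional ℝ E]

/-- The covector of a complex vector field in the chart at `x₀`. -/
def chartFlat (g : PseudoMetric r E M) (x₀ : M) (V : ComplexVectorField E M) (q : E) :
    E →L[ℝ] ℂ :=
  g.flat V ((extChartAt 𝓘(ℝ, E) x₀).symm q) ∘L chartInv x₀ q

theorem contDiffAt_clm_apply' {F G H : Type*} [NormedAddCommGroup F] [NormedSpace ℝ F]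
    [NormedAddCommGroup G] [NormedSpace ℝ G] [FiniteDimensional ℝ G]
    [NormedAddCommGroup H] [NormedSpace ℝ H] {f : F → G →L[ℝ] H} {a : F} {s : WithTop ℕ∞}
    (h : ∀ w, ContDiffAt ℝ s (fun q => f q w) a) : ContDiffAt ℝ s f a := by
  let e := (finBasis ℝ G).equivFunL
  have h1 : f = fun q => ∑ i, ((ContinuousLinearMap.proj i : (Fin (finrank ℝ G) → ℝ) →L[ℝ] ℝ) ∘L
      (e : G →L[ℝ] _)).smulRight (f q (finBasis ℝ G i)) := by
    funext q
    refine ContinuousLinearMap.ext fun v => ?_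
    conv_lhs => rw [← (finBasis ℝ G).sum_repr v, map_sum]
    simp [e]
  rw [h1]
  refine ContDiffAt.sum fun i _ => ?_
  exact (ContinuousLinearMap.smulRightL ℝ G H _).contDiff.contDiffAt.comp a (h _)

theorem contDiffAt_chartFlat (hr : r = ∞ ∨ r = ω) (g : PseudoMetric r E M) {q : E}
    (hq : q ∈ (extChartAt 𝓘(ℝ, E) x₀).target) {U : Set M} (hU : IsOpen U)
    (hqU : (extChartAt 𝓘(ℝ, E) x₀).symm q ∈ U) {V : ComplexVectorField E M}
    (hV : V.SmoothOn r U) : ContDiffAt ℝ r (chartFlat g x₀ V) q := by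
  refine contDiffAt_clm_apply' fun w => ?_
  have hx : (extChartAt 𝓘(ℝ, E) x₀).symm q ∈ (chartAt E x₀).source := by
    simpa using (extChartAt 𝓘(ℝ, E) x₀).map_target hq
  have hW := contMDiffAt_chartLift (v := fun _ => w) hr hx contDiffAt_const
  have hUn := hU.mem_nhds hqU
  have h1 := (contMDiffAt_inner g (hV.1.contMDiffAt hUn) hW).comp q
    (contMDiffAt_extChartAt_symm (r := r) hq)
  have h2 := (contMDiffAt_inner g (hV.2.contMDiffAt hUn) hW).comp q
    (contMDiffAt_extChartAt_symm (r := r) hq)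
  have h3 := (Complex.ofRealCLM.contDiff.contDiffAt.comp q h1.contDiffAt).add
    ((contDiffAt_const (c := Complex.I)).mul
      (Complex.ofRealCLM.contDiff.contDiffAt.comp q h2.contDiffAt))
  refine h3.congr_of_eventuallyEq ?_
  filter_upwards [eventually_mem_extChartAt_target hq] with q' hq'
  simp only [Function.comp_apply, chartLift_symm hq']
  rfl

theorem norm_alternatization_le {G : Type*} [NormedAddCommGroup G] [NormedSpace ℝ G] {p : ℕ}
    (f : ContinuousMultilinearMap ℝ (fun _ : Fin p => G) ℂ) :
    ‖ContinuousMultilinearMap.alternatization f‖ ≤ p.factorial * ‖f‖ := by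
  refine ContinuousAlternatingMap.opNorm_le_bound _
    (mul_nonneg (Nat.cast_nonneg _) (norm_nonneg _)) fun v => ?_
  rw [ContinuousMultilinearMap.alternatization_apply_apply]
  refine (norm_sum_le _ _).trans ?_
  have h : ∀ σ : Equiv.Perm (Fin p), ‖Equiv.Perm.sign σ • f (v ∘ σ)‖ ≤ ‖f‖ * ∏ i, ‖v i‖ := by
    intro σ
    have h1 : ‖Equiv.Perm.sign σ • f (v ∘ σ)‖ = ‖f (v ∘ σ)‖ := by
      rcases Int.units_eq_one_or (Equiv.Perm.sign σ) with h | h <;> simp [h]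
    rw [h1]
    refine (f.le_opNorm _).trans_eq ?_
    rw [← Equiv.prod_comp σ fun i => ‖v i‖]
    rfl
  refine (Finset.sum_le_sum fun σ _ => h σ).trans_eq ?_
  simp [Fintype.card_perm]
  ring

/-- The form is a continuous linear map, alternatization, applied to a continuous multilinear
expression in `θ`; `norm_alternatization_le` supplies the continuity. -/
theorem contDiff_simpleForm {G : Type*} [NormedAddCommGroup G] [NormedSpace ℝ G]
    {p : ℕ} {s : WithTop ℕ∞} : ContDiff ℝ s (fun θ : Fin p → G →L[ℝ] ℂ => simpleForm θ) := by
  let A : ContinuousMultilinearMap ℝ (fun _ : Fin p => G) ℂ →L[ℝ] G [⋀^Fin p]→L[ℝ] ℂ :=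
    LinearMap.mkContinuous
      { toFun := fun f => ContinuousMultilinearMap.alternatization f
        map_add' := fun f f' => map_add _ f f'
        map_smul' := fun c f => by
          ext v
          simp [ContinuousMultilinearMap.alternatization_apply_apply, Finset.smul_sum,
            smul_comm c] } p.factorial
      fun f => norm_alternatization_le f
  have h : (fun θ : Fin p → G →L[ℝ] ℂ => simpleForm θ) = fun θ => ((p.factorial : ℝ)⁻¹) •
      A (ContinuousMultilinearMap.compContinuousLinearMapContinuousMultilinear ℝ
        (fun _ : Fin p => G) (fun _ : Fin p => ℂ) ℂ θ
          (ContinuousMultilinearMap.mkPiAlgebra ℝ (Fin p) ℂ)) := by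
    rfl
  rw [h]
  have h1 : ContDiff ℝ s fun θ : Fin p → G →L[ℝ] ℂ =>
      ContinuousMultilinearMap.compContinuousLinearMapContinuousMultilinear ℝ
        (fun _ : Fin p => G) (fun _ : Fin p => ℂ) ℂ θ :=
    ContinuousMultilinearMap.contDiff _
  exact (A.contDiff.comp (h1.clm_apply contDiff_const)).const_smul _

end Charts

/-! ### Closed forms annihilate brackets -/

section Contraction

variable {E : Type*} [NormedAddCommGroup E] [NormedSpace ℝ E] {k : ℕ} {p : E}

theorem hasFDerivAt_apply_cons {α : E → E [⋀^Fin (k + 1)]→L[ℝ] ℂ} {a : E → E}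
    (hα : DifferentiableAt ℝ α p) (ha : DifferentiableAt ℝ a p) (w : Fin k → E) :
    ∃ L : E →L[ℝ] ℂ, HasFDerivAt (fun q => α q (Fin.cons (a q) w)) L p ∧
      ∀ v, L v = fderiv ℝ α p v (Fin.cons (a p) w) + α p (Fin.cons (fderiv ℝ a p v) w) := by
  let g : Fin (k + 1) → E → E := Fin.cons a fun i _ => w i
  let g' : Fin (k + 1) → E →L[ℝ] E := Fin.cons (fderiv ℝ a p) fun _ => 0
  have hg : ∀ i, HasFDerivAt (g i) (g' i) p := by
    refine Fin.cases ?_ fun i => ?_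
    · exact ha.hasFDerivAt
    · exact hasFDerivAt_const _ _
  have hgq : ∀ q, (fun i => g i q) = Fin.cons (a q) w := by
    intro q
    funext i
    refine Fin.cases ?_ (fun i => ?_) i <;> rfl
  have h := hα.hasFDerivAt.continuousAlternatingMap_apply hg
  simp only [hgq] at h
  refine ⟨_, h, fun v => ?_⟩
  have hu : ∀ z, Function.update (Fin.cons (a p) w : Fin (k + 1) → E) 0 z = Fin.cons z w := by
    intro z
    exact Fin.update_cons_zero _ _ _
  rw [_root_.add_apply, _root_.sum_apply, Fin.sum_univ_succ]
  have h0 : ∀ i : Fin k, g' i.succ = 0 := fun i => rfl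
  simp only [h0, ContinuousLinearMap.comp_zero, _root_.zero_apply, Finset.sum_const_zero, add_zero]
  congr 1
  change α p (Function.update _ 0 _) = _
  rw [hu]
  rfl

/-- The product rule for the vanishing contraction moves the derivative from the form to the field
`a + i b`. -/
theorem fderiv_contraction {α : E → E [⋀^Fin (k + 1)]→L[ℝ] ℂ} {a b : E → E}
    (hα : DifferentiableAt ℝ α p) (ha : DifferentiableAt ℝ a p) (hb : DifferentiableAt ℝ b p)
    (h : ∀ᶠ q in 𝓝 p, ∀ w : Fin k → E,
      α q (Fin.cons (a q) w) + Complex.I * α q (Fin.cons (b q) w) = 0) (v : E) (w : Fin k → E) :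
    fderiv ℝ α p v (Fin.cons (a p) w) + Complex.I * fderiv ℝ α p v (Fin.cons (b p) w) =
      -(α p (Fin.cons (fderiv ℝ a p v) w) + Complex.I * α p (Fin.cons (fderiv ℝ b p v) w)) := by
  obtain ⟨L, hL, hLv⟩ := hasFDerivAt_apply_cons hα ha w
  obtain ⟨L', hL', hLv'⟩ := hasFDerivAt_apply_cons hα hb w
  have h1 := (hL.add (hL'.const_mul Complex.I)).congr_of_eventuallyEq
    (f₁ := fun _ => (0 : ℂ)) (by
      filter_upwards [h] with q hq
      exact (hq w).symm)
  have h2 := DFunLike.congr_fun (h1.unique (hasFDerivAt_const 0 p)) v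
  simp only [_root_.add_apply, _root_.smul_apply, smul_eq_mul, _root_.zero_apply, hLv, hLv'] at h2
  linear_combination h2

theorem apply_cons_swap {F : Type*} [AddCommGroup F] [Module ℝ F] [TopologicalSpace F]
    (β : F [⋀^Fin (k + 2)]→L[ℝ] ℂ) (x y : F) (w : Fin k → F) :
    β (Fin.cons x (Fin.cons y w)) = -β (Fin.cons y (Fin.cons x w)) := by
  have h := β.toAlternatingMap.map_swap (Fin.cons y (Fin.cons x w))
    (i := (0 : Fin (k + 2))) (j := 1) (by simp)
  have h2 : (Fin.cons y (Fin.cons x w) : Fin (k + 2) → F) ∘ Equiv.swap (0 : Fin (k + 2)) 1 =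
      Fin.cons x (Fin.cons y w) := by
    funext i
    refine Fin.cases ?_ (fun i => ?_) i
    · simp
    · refine Fin.cases ?_ (fun i => ?_) i
      · simp
      · rw [Function.comp_apply, Equiv.swap_apply_of_ne_of_ne (Fin.succ_ne_zero _)]
        · rfl
        · intro h
          exact Fin.succ_ne_zero i (Fin.succ_injective _ h)
  rw [h2] at h
  exact h

theorem extDeriv_apply_cons_cons {α : E → E [⋀^Fin (k + 1)]→L[ℝ] ℂ}
    (hα : DifferentiableAt ℝ α p) (x y : E) (w : Fin k → E) :
    extDeriv α p (Fin.cons x (Fin.cons y w)) =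
      fderiv ℝ α p x (Fin.cons y w) - fderiv ℝ α p y (Fin.cons x w) +
      ∑ j : Fin k, (-1 : ℂ) ^ (j : ℕ) * fderiv ℝ α p (w j)
        (j.succ.succ.removeNth (Fin.cons x (Fin.cons y w) : Fin (k + 2) → E)) := by
  have hc : ∀ (u : Fin (k + 1) → E) (v : E), fderiv ℝ (fun q => α q u) p v = fderiv ℝ α p v u := by
    intro u v
    have h := (hα.hasFDerivAt.continuousAlternatingMap_apply (g := fun i _ => u i)
      (g' := fun _ => 0) fun i => hasFDerivAt_const _ _)
    rw [h.fderiv]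
    simp
  rw [extDeriv_apply hα, Fin.sum_univ_succ, Fin.sum_univ_succ]
  simp only [hc]
  have h1 : ((0 : Fin (k + 2)).removeNth (Fin.cons x (Fin.cons y w) : Fin (k + 2) → E)) =
      Fin.cons y w := by
    funext i; rfl
  have h2 : (Fin.succ (0 : Fin (k + 1))).removeNth (Fin.cons x (Fin.cons y w) : Fin (k + 2) → E) =
      Fin.cons x w := by
    funext i
    refine Fin.cases rfl (fun i => ?_) i
    rfl
  rw [h1, h2, ← add_assoc]
  congr 1
  · simp [sub_eq_add_neg]
  · refine Finset.sum_congr rfl fun j _ => ?_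
    simp [pow_succ]

/-- If a form is closed at a point and annihilates two complex vector fields near it, then it
annihilates their bracket at the point. -/
theorem apply_bracket_eq_zero {α : E → E [⋀^Fin (k + 1)]→L[ℝ] ℂ} {a b c d : E → E}
    (hα : DifferentiableAt ℝ α p) (ha : DifferentiableAt ℝ a p) (hb : DifferentiableAt ℝ b p)
    (hc : DifferentiableAt ℝ c p) (hd : DifferentiableAt ℝ d p) (hdα : extDeriv α p = 0)
    (hab : ∀ᶠ q in 𝓝 p, ∀ w : Fin k → E,
      α q (Fin.cons (a q) w) + Complex.I * α q (Fin.cons (b q) w) = 0)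
    (hcd : ∀ᶠ q in 𝓝 p, ∀ w : Fin k → E,
      α q (Fin.cons (c q) w) + Complex.I * α q (Fin.cons (d q) w) = 0) (w : Fin k → E) :
    α p (Fin.cons ((fderiv ℝ c p (a p) - fderiv ℝ a p (c p)) -
        (fderiv ℝ d p (b p) - fderiv ℝ b p (d p))) w) +
      Complex.I * α p (Fin.cons ((fderiv ℝ d p (a p) - fderiv ℝ a p (d p)) +
        (fderiv ℝ c p (b p) - fderiv ℝ b p (c p))) w) = 0 := by
  have hadd : ∀ x y : E, α p (Fin.cons (x + y) w) = α p (Fin.cons x w) + α p (Fin.cons y w) := by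
    intro x y
    have h := (α p).map_update_add (Fin.cons 0 w) 0 x y
    simpa only [Fin.update_cons_zero] using h
  have hsub : ∀ x y : E, α p (Fin.cons (x - y) w) = α p (Fin.cons x w) - α p (Fin.cons y w) := by
    intro x y
    have h := (α p).map_update_sub (Fin.cons 0 w) 0 x y
    simpa only [Fin.update_cons_zero] using h
  -- `R x y` collects the terms of `dα(x, y, w)` in which the derivative is taken along some `w j`,
  -- so that `x` and `y` both remain arguments.
  set R : E → E → ℂ := fun x y => ∑ j : Fin k, (-1 : ℂ) ^ (j : ℕ) * fderiv ℝ α p (w j)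
    (j.succ.succ.removeNth (Fin.cons x (Fin.cons y w) : Fin (k + 2) → E)) with hR
  have hd0 : ∀ x y, fderiv ℝ α p x (Fin.cons y w) - fderiv ℝ α p y (Fin.cons x w) + R x y = 0 := by
    intro x y
    rw [hR, ← extDeriv_apply_cons_cons hα, hdα]
    rfl
  have h1 := fderiv_contraction hα ha hb hab
  have h2 := fderiv_contraction hα hc hd hcd
  -- In each term the derivative is shifted from the form to `a + i b`; the form itself is then
  -- still contracted with `c + i d`, which gives zero.
  have hRsum : R (a p) (c p) + Complex.I * R (b p) (c p) +
      Complex.I * (R (a p) (d p) + Complex.I * R (b p) (d p)) = 0 := by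
    simp only [hR, Finset.mul_sum, ← Finset.sum_add_distrib]
    refine Finset.sum_eq_zero fun j _ => ?_
    cases k with
    | zero => exact j.elim0
    | succ k =>
      have hrem : ∀ x y, j.succ.succ.removeNth (Fin.cons x (Fin.cons y w) : Fin (k + 3) → E) =
          Fin.cons x (Fin.cons y (j.removeNth w)) := by
        intro x y
        funext i
        refine Fin.cases rfl (fun i => ?_) i
        refine Fin.cases rfl (fun i => ?_) i
        simp [Fin.removeNth]
      simp only [hrem]
      have e1 := h1 (w j) (Fin.cons (c p) (j.removeNth w))
      have e2 := h1 (w j) (Fin.cons (d p) (j.removeNth w))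
      have f1 := hcd.self_of_nhds (Fin.cons (fderiv ℝ a p (w j)) (j.removeNth w))
      have f2 := hcd.self_of_nhds (Fin.cons (fderiv ℝ b p (w j)) (j.removeNth w))
      rw [apply_cons_swap (α p) (c p), apply_cons_swap (α p) (d p)] at f1 f2
      linear_combination (-1 : ℂ) ^ (j : ℕ) * (e1 + Complex.I * e2) +
        (-1 : ℂ) ^ (j : ℕ) * (f1 + Complex.I * f2)
  simp only [hadd, hsub]
  have g1 := h1 (c p) w
  have g2 := h1 (d p) w
  have g3 := h2 (a p) w
  have g4 := h2 (b p) w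
  have d1 := hd0 (a p) (c p)
  have d2 := hd0 (b p) (c p)
  have d3 := hd0 (a p) (d p)
  have d4 := hd0 (b p) (d p)
  have hI : Complex.I * Complex.I = -1 := Complex.I_mul_I
  -- This is `dα(a + i b, c + i d, w) = 0` expanded complex-bilinearly; `hI` turns the `I²` terms
  -- into the contribution of the imaginary parts to the real part of the bracket.
  linear_combination g3 + Complex.I * g4 - g1 - Complex.I * g2 - d1 - Complex.I * d2 -
    Complex.I * d3 - Complex.I * Complex.I * d4 + hRsum -
    (α p (Fin.cons (fderiv ℝ d p (b p)) w) - α p (Fin.cons (fderiv ℝ b p (d p)) w)) * hI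

end Contraction

/-! ### The null form and its distribution at a point -/

section Pointwise

variable {E : Type*} [NormedAddCommGroup E] [NormedSpace ℝ E]
  {M : Type*} [TopologicalSpace M] [ChartedSpace E M] [IsManifold 𝓘(ℝ, E) 1 M]
  {r : WithTop ℕ∞} {n : ℕ}

theorem complexBilin_value (g : PseudoMetric r E M) (X : ComplexVectorField E M) (x : M)
    (Y : ℂ ⊗[ℝ] TangentSpace 𝓘(ℝ, E) x) :
    g.complexBilin x (X.value x) Y = complexCovector (g.flat X x) Y := by
  obtain ⟨a, b, rfl⟩ := exists_eq_tmul_add_tmul Y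
  simp only [PseudoMetric.complexBilin, ComplexVectorField.value, map_add, LinearMap.add_apply,
    LinearMap.BilinForm.baseChange_tmul, complexCovector_tmul]
  simp only [PseudoMetric.flat, PseudoMetric.bilin, LinearMap.mk₂_apply, _root_.add_apply,
    _root_.smul_apply, ContinuousLinearMap.comp_apply, Complex.ofRealCLM_apply, Complex.real_smul,
    smul_eq_mul]
  ring

theorem complexBilin_nondegenerate (g : PseudoMetric r E M) (x : M) :
    (g.complexBilin x).Nondegenerate ∧ ∀ X Y, g.complexBilin x X Y = g.complexBilin x Y X :=
  baseChange_nondegenerate _ (g.bilin_nondegenerate x) (g.symm x)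

theorem linearIndependent_flat (g : PseudoMetric r E M) {V : Fin n → ComplexVectorField E M}
    {x : M} (hV : LinearIndependent ℂ fun i => (V i).value x) :
    LinearIndependent ℂ fun i => g.flat (V i) x := by
  rw [← linearIndependent_complexCovector, Fintype.linearIndependent_iff]
  intro c hc
  refine Fintype.linearIndependent_iff.1 hV c ?_
  refine (complexBilin_nondegenerate g x).1.1 _ fun Y => ?_
  have h := LinearMap.congr_fun hc Y
  simp only [LinearMap.coe_sum, Finset.sum_apply, LinearMap.smul_apply, ← complexBilin_value,
    LinearMap.zero_apply] at h
  simpa only [map_sum, map_smul, LinearMap.coe_sum, Finset.sum_apply, LinearMap.smul_apply] using h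

variable [FiniteDimensional ℝ E]

theorem mem_iff_orthogonal (hdim : finrank ℝ E = 2 * n) (g : PseudoMetric r E M)
    {V : Fin n → ComplexVectorField E M} {x : M}
    {W : Submodule ℂ (ℂ ⊗[ℝ] TangentSpace 𝓘(ℝ, E) x)}
    (hV : LinearIndependent ℂ fun i => (V i).value x)
    (hW : W = Submodule.span ℂ (range fun i => (V i).value x)) (hiso : IsIsotropic g x W)
    (X : ℂ ⊗[ℝ] TangentSpace 𝓘(ℝ, E) x) : X ∈ W ↔ ∀ Y ∈ W, g.complexBilin x Y X = 0 := by
  refine mem_iff_of_isotropic _ (g.bilin_nondegenerate x) (g.symm x) W hiso ?_ X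
  rw [hW, finrank_span_eq_card hV, Fintype.card_fin]
  exact hdim

/-- The bridge between form and distribution: `W` equals its orthogonal complement, which the
covectors of its own frame cut out. -/
theorem mem_iff_flat (hdim : finrank ℝ E = 2 * n) (g : PseudoMetric r E M)
    {V : Fin n → ComplexVectorField E M} {x : M}
    {W : Submodule ℂ (ℂ ⊗[ℝ] TangentSpace 𝓘(ℝ, E) x)}
    (hV : LinearIndependent ℂ fun i => (V i).value x)
    (hW : W = Submodule.span ℂ (range fun i => (V i).value x)) (hiso : IsIsotropic g x W)
    (X : ℂ ⊗[ℝ] TangentSpace 𝓘(ℝ, E) x) :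
    X ∈ W ↔ ∀ i, complexCovector (g.flat (V i) x) X = 0 := by
  rw [mem_iff_orthogonal hdim g hV hW hiso]
  simp only [← complexBilin_value]
  refine ⟨fun h i => h _ (hW ▸ Submodule.subset_span ⟨i, rfl⟩), fun h Y hY => ?_⟩
  rw [hW] at hY
  induction hY using Submodule.span_induction with
  | mem Y hY => obtain ⟨i, rfl⟩ := hY; exact h i
  | zero => simp
  | add Y Z _ _ hY hZ => rw [map_add, LinearMap.add_apply, hY, hZ, add_zero]
  | smul c Y _ hY => rw [map_smul, LinearMap.smul_apply, hY, smul_zero]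

/-- An isotropic subspace containing `W` is orthogonal to `W`, hence contained in `W`. -/
theorem maximal_isIsotropic (hdim : finrank ℝ E = 2 * n) (g : PseudoMetric r E M)
    {V : Fin n → ComplexVectorField E M} {x : M}
    {W : Submodule ℂ (ℂ ⊗[ℝ] TangentSpace 𝓘(ℝ, E) x)}
    (hV : LinearIndependent ℂ fun i => (V i).value x)
    (hW : W = Submodule.span ℂ (range fun i => (V i).value x)) (hiso : IsIsotropic g x W) :
    Maximal (IsIsotropic g x) W := by
  refine ⟨hiso, fun W' hW' hle X hX => ?_⟩
  rw [mem_iff_orthogonal hdim g hV hW hiso]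
  exact fun Y hY => hW' Y (hle hY) X hX

theorem exists_hodge_eq_smul (hdim : finrank ℝ E = 2 * n) (g : PseudoMetric r E M)
    {ε : Form E M (n + n) ℝ} (hε : IsVolumeForm g ε)
    {V : Fin n → ComplexVectorField E M} {x : M}
    (hV : LinearIndependent ℂ fun i => (V i).value x)
    (hiso : ∀ i j, g.complexBilin x ((V i).value x) ((V j).value x) = 0) :
    ∃ c : ℂ, c ^ 4 = 1 ∧ hodgeDual (g.bilin x) (g.bilin_nondegenerate x) (ε x)
      (simpleForm fun i => g.flat (V i) x) = c • simpleForm fun i => g.flat (V i) x := by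
  have hcard : finrank ℝ (TangentSpace 𝓘(ℝ, E) x) = n + n := hdim.trans (two_mul n)
  let b : Basis (Fin n ⊕ Fin n) ℝ (TangentSpace 𝓘(ℝ, E) x) :=
    (finBasisOfFinrankEq ℝ _ hcard).reindex finSumFinEquiv.symm
  have h : ∀ i v, g.complexBilin x ((V i).value x) ((1 : ℂ) ⊗ₜ v) = g.flat (V i) x v := by
    intro i v
    rw [complexBilin_value, complexCovector_tmul, one_mul]
  refine exists_hodgeDual_simpleForm (g.bilin x) (g.bilin_nondegenerate x) (ε x) ?_ b h ?_
    (linearIndependent_flat g hV) hiso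
  · exact hε.2 x
  · intro i v
    rw [← h i v]
    exact (complexBilin_nondegenerate g x).2 _ _

theorem hodge_smul (g : PseudoMetric r E M) (ε : Form E M (n + n) ℝ) (h : M → ℂ)
    (K : Form E M n ℂ) (x : M) :
    Form.hodge g ε (fun y => h y • K y) x = h x • Form.hodge g ε K x := by
  ext w
  simp only [Form.hodge, hodgeDual, ContinuousAlternatingMap.smul_apply,
    ContinuousAlternatingMap.sum_apply, Finset.smul_sum, Complex.real_smul, smul_eq_mul]
  refine Finset.sum_congr rfl fun ν _ => ?_
  ring

end Pointwise

/-! ### Forms built from differentials are closed -/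

section ClosedForms

variable {E : Type*} [NormedAddCommGroup E] [NormedSpace ℝ E]
  {M : Type*} [TopologicalSpace M] [ChartedSpace E M]

/-- The differential of a complex-valued function as a complex covector. -/
def differential (z : M → ℂ) (x : M) : TangentSpace 𝓘(ℝ, E) x →L[ℝ] ℂ :=
  mfderiv 𝓘(ℝ, E) 𝓘(ℝ, ℂ) z x

theorem complexDifferential_eq (z : M → ℂ) (x : M) :
    complexDifferential (E := E) z x = complexCovector (differential z x) := rfl

variable [IsManifold 𝓘(ℝ, E) 1 M] {r : WithTop ℕ∞} [IsManifold 𝓘(ℝ, E) r M]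

theorem tendsto_extChartAt_symm {x₀ x : M} (hx : x ∈ (extChartAt 𝓘(ℝ, E) x₀).source) :
    Tendsto (extChartAt 𝓘(ℝ, E) x₀).symm (𝓝 (extChartAt 𝓘(ℝ, E) x₀ x)) (𝓝 x) := by
  have h := continuousAt_extChartAt_symm' (I := 𝓘(ℝ, E)) hx
  rwa [ContinuousAt, (extChartAt 𝓘(ℝ, E) x₀).left_inv hx] at h

theorem differential_comp_chartInv (hr : r = ∞ ∨ r = ω) {x₀ : M} {q : E}
    (hq : q ∈ (extChartAt 𝓘(ℝ, E) x₀).target) {z : M → ℂ}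
    (hz : ContMDiffAt 𝓘(ℝ, E) 𝓘(ℝ, ℂ) r z ((extChartAt 𝓘(ℝ, E) x₀).symm q)) :
    differential z ((extChartAt 𝓘(ℝ, E) x₀).symm q) ∘L chartInv x₀ q =
      fderiv ℝ (z ∘ (extChartAt 𝓘(ℝ, E) x₀).symm) q := by
  have h := mfderiv_comp q (hz.mdifferentiableAt (ne_zero_of_smooth hr))
    ((contMDiffAt_extChartAt_symm (r := r) hq).mdifferentiableAt (ne_zero_of_smooth hr))
  rw [mfderiv_eq_fderiv] at h
  exact h.symm

/-- In the chart the form is the pullback, under the map with components `z j`, of a constant form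
on ℂᵖ, and the exterior derivative commutes with pullback. The constant `c` allows the same argument
for the Hodge dual. -/
theorem extDeriv_eq_zero_of_eq_simpleForm (hr : r = ∞ ∨ r = ω) {p : ℕ} {α : Form E M p ℂ}
    {z : Fin p → M → ℂ} {x : M} {c : ℂ}
    (hz : ∀ᶠ y in 𝓝 x, ∀ j, ContMDiffAt 𝓘(ℝ, E) 𝓘(ℝ, ℂ) r (z j) y)
    (hα : ∀ᶠ y in 𝓝 x, α y = c • simpleForm fun j => differential (z j) y) :
    Form.extDeriv α x = 0 := by
  set φ := extChartAt 𝓘(ℝ, E) x with hφ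
  set Z : E → Fin p → ℂ := fun q j => z j (φ.symm q) with hZ
  set K : (Fin p → ℂ) [⋀^Fin p]→L[ℝ] ℂ :=
    c • simpleForm fun j => (ContinuousLinearMap.proj j : (Fin p → ℂ) →L[ℝ] ℂ) with hK
  have hZsmooth : ∀ q ∈ φ.target, (∀ j, ContMDiffAt 𝓘(ℝ, E) 𝓘(ℝ, ℂ) r (z j) (φ.symm q)) →
      ∀ j, ContDiffAt ℝ r (fun q => Z q j) q := by
    intro q hq h j
    exact ((h j).comp q (contMDiffAt_extChartAt_symm (r := r) hq)).contDiffAt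
  have ht := tendsto_extChartAt_symm (mem_extChartAt_source (I := 𝓘(ℝ, E)) x)
  have hloc : α.inChart x =ᶠ[𝓝 (φ x)] fun q => K.compContinuousLinearMap (fderiv ℝ Z q) := by
    filter_upwards [ht.eventually hz, ht.eventually hα,
      eventually_mem_extChartAt_target (mem_extChartAt_target (I := 𝓘(ℝ, E)) x)] with q hzq hαq hq
    rw [← hφ] at hzq hαq
    have h1 : α.inChart x q = (α (φ.symm q)).compContinuousLinearMap (chartInv x q) := rfl
    rw [h1, hαq]
    have h2 : fderiv ℝ Z q = ContinuousLinearMap.pi fun j => fderiv ℝ (fun q => Z q j) q :=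
      fderiv_pi fun j => (hZsmooth q hq hzq j).differentiableAt (ne_zero_of_smooth hr)
    have h3 : ∀ j v, differential (z j) (φ.symm q) (chartInv x q v) =
        fderiv ℝ (fun q => Z q j) q v := fun j v =>
      DFunLike.congr_fun (differential_comp_chartInv hr hq (hzq j)) v
    ext w
    simp only [hK, h2, ContinuousAlternatingMap.compContinuousLinearMap_apply,
      ContinuousAlternatingMap.smul_apply, simpleForm_apply, ContinuousLinearMap.proj_apply,
      ContinuousLinearMap.coe_pi', Function.comp_apply, h3]
  have hzx := hz.self_of_nhds
  have hZx : ContDiffAt ℝ r Z (φ x) := by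
    refine contDiffAt_pi.2 (hZsmooth _ (mem_extChartAt_target x) ?_)
    rw [hφ, extChartAt_to_inv]
    exact hzx
  have h2 : minSmoothness ℝ 2 ≤ r := by
    rw [minSmoothness_of_isRCLikeNormedField]
    exact_mod_cast nat_le_of_smooth hr 2
  have hext : _root_.extDeriv (α.inChart x) (φ x) = 0 := by
    rw [hloc.extDeriv_eq]
    refine (extDeriv_pullback (differentiableAt_const K) hZx h2).trans ?_
    have : _root_.extDeriv (fun _ : Fin p → ℂ => K) (Z (φ x)) = 0 := by
      ext v
      simp [_root_.extDeriv, ContinuousAlternatingMap.alternatizeUncurryFin_apply]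
    rw [this]
    ext w
    rfl
  have h4 : Form.extDeriv α x = (_root_.extDeriv (α.inChart x) (φ x)).compContinuousLinearMap
      (chartDeriv x x) := rfl
  rw [h4, hext]
  ext w
  rfl

end ClosedForms

theorem finite_setOf_pow_four_eq_one : {c : ℂ | c ^ 4 = 1}.Finite := by
  refine Set.Finite.subset (s := {1, -1, Complex.I, -Complex.I}) (by simp) fun c hc => ?_
  have h : (c - 1) * ((c + 1) * ((c - Complex.I) * (c + Complex.I))) = 0 := by
    have hI : Complex.I ^ 2 = -1 := Complex.I_sq
    have hc' : c ^ 4 = 1 := hc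
    linear_combination hc' - (c ^ 2 - 1) * hI
  simp only [mul_eq_zero, sub_eq_zero, add_eq_zero_iff_eq_neg] at h
  simpa using h

theorem eventually_eq_of_finite {X Y : Type*} [TopologicalSpace X] [TopologicalSpace Y] [T1Space Y]
    {f : X → Y} {x : X} {S : Set Y} (hf : ContinuousAt f x) (hS : S.Finite)
    (h : ∀ᶠ y in 𝓝 x, f y ∈ S) : ∀ᶠ y in 𝓝 x, f y = f x := by
  have h1 : (S \ {f x})ᶜ ∈ 𝓝 (f x) := (hS.subset sdiff_subset).isClosed.isOpen_compl.mem_nhds (by simp)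
  filter_upwards [h, hf.eventually h1] with y hy hy'
  by_contra hne
  exact hy' ⟨hy, hne⟩

/-! ### Local constancy of the Hodge eigenvalue -/

section Hodge

variable {E : Type*} [NormedAddCommGroup E] [NormedSpace ℝ E] [FiniteDimensional ℝ E]
  {M : Type*} [TopologicalSpace M] [ChartedSpace E M] [IsManifold 𝓘(ℝ, E) 1 M]
  {r : WithTop ℕ∞} [IsManifold 𝓘(ℝ, E) r M] {n : ℕ}

theorem simpleForm_flat_chartInv (g : PseudoMetric r E M) (V : Fin n → ComplexVectorField E M)
    (x₀ : M) (q : E) (w : Fin n → E) :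
    simpleForm (fun i => g.flat (V i) ((extChartAt 𝓘(ℝ, E) x₀).symm q))
      (fun j => chartInv x₀ q (w j)) = simpleForm (fun i => chartFlat g x₀ (V i) q) w := by
  rw [simpleForm_apply, simpleForm_apply]
  rfl

/-- The coordinate basis of a tangent space in the chart at `x₀`. -/
def chartBasis {ι : Type*} (b : Basis ι ℝ E) {x₀ : M} {q : E}
    (hq : q ∈ (extChartAt 𝓘(ℝ, E) x₀).target) :
    Basis ι ℝ (TangentSpace 𝓘(ℝ, E) ((extChartAt 𝓘(ℝ, E) x₀).symm q)) :=
  b.map (LinearEquiv.ofLinearMap (chartInv x₀ q).toLinearMap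
    (chartDeriv x₀ ((extChartAt 𝓘(ℝ, E) x₀).symm q)).toLinearMap
    (LinearMap.ext (chartInv_chartDeriv hq)) (LinearMap.ext (chartDeriv_chartInv hq)))

theorem chartBasis_repr {ι : Type*} (b : Basis ι ℝ E) {x₀ : M} {q : E}
    (hq : q ∈ (extChartAt 𝓘(ℝ, E) x₀).target)
    (v : TangentSpace 𝓘(ℝ, E) ((extChartAt 𝓘(ℝ, E) x₀).symm q)) (i : ι) :
    (chartBasis b hq).repr v i = b.repr (chartDeriv x₀ ((extChartAt 𝓘(ℝ, E) x₀).symm q) v) i :=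
  rfl

/-- The definition of the dual involves bases that depend arbitrarily on the point. This formula, in
a fixed basis `b` of the model space, makes continuity in `q` visible. -/
theorem hodgeDual_flat_chart (g : PseudoMetric r E M) (ε : Form E M (n + n) ℝ)
    (V : Fin n → ComplexVectorField E M) (b : Basis (Fin n ⊕ Fin n) ℝ E) {x₀ : M} {q : E}
    (hq : q ∈ (extChartAt 𝓘(ℝ, E) x₀).target) (w : Fin n → E) :
    hodgeDual (g.bilin ((extChartAt 𝓘(ℝ, E) x₀).symm q)) (g.bilin_nondegenerate _) (ε _)
      (simpleForm fun i => g.flat (V i) ((extChartAt 𝓘(ℝ, E) x₀).symm q))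
      (fun j => chartInv x₀ q (w j)) =
    (n.factorial : ℂ)⁻¹ * ((ε.inChart x₀ q (b ∘ finSumFinEquiv.symm) : ℂ) *
      (Matrix.of fun (k l : Fin n ⊕ Fin n) => Sum.elim
        (fun i => (b.repr (chartField x₀ (V i).re q) k : ℂ) +
          Complex.I * (b.repr (chartField x₀ (V i).im q) k : ℂ))
        (fun j => (b.repr (w j) k : ℂ)) l).det) := by
  have h : ∀ i v, g.complexBilin ((extChartAt 𝓘(ℝ, E) x₀).symm q)
      ((V i).value ((extChartAt 𝓘(ℝ, E) x₀).symm q)) ((1 : ℂ) ⊗ₜ v) =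
        g.flat (V i) ((extChartAt 𝓘(ℝ, E) x₀).symm q) v := by
    intro i v
    rw [complexBilin_value, complexCovector_tmul, one_mul]
  rw [hodgeDual_simpleForm _ _ _ (chartBasis b hq) h, complexVolume, AlternatingMap.smul_apply,
    smul_eq_mul, Basis.det_apply]
  congr 3
  ext k l
  rcases l with i | j
  · rw [Basis.toMatrix_apply, Sum.elim_inl, ComplexVectorField.value, map_add, Finsupp.add_apply,
      Basis.baseChange_repr_tmul, Basis.baseChange_repr_tmul, chartBasis_repr, chartBasis_repr]
    simp only [Complex.real_smul, mul_one, mul_comm Complex.I]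
    rfl
  · rw [Basis.toMatrix_apply, Sum.elim_inr, Basis.baseChange_repr_tmul, chartBasis_repr,
      chartDeriv_chartInv hq]
    simp

theorem continuousAt_hodgeDual_flat_chart (hr : r = ∞ ∨ r = ω) (hdim : finrank ℝ E = 2 * n)
    (g : PseudoMetric r E M) {ε : Form E M (n + n) ℝ} (hε : IsVolumeForm g ε)
    {V : Fin n → ComplexVectorField E M} {U : Set M} (hU : IsOpen U)
    (hV : ∀ i, (V i).SmoothOn r U) {x₀ : M} {q : E} (hq : q ∈ (extChartAt 𝓘(ℝ, E) x₀).target)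
    (hqU : (extChartAt 𝓘(ℝ, E) x₀).symm q ∈ U) (w : Fin n → E) :
    ContinuousAt (fun q => hodgeDual (g.bilin ((extChartAt 𝓘(ℝ, E) x₀).symm q))
      (g.bilin_nondegenerate _) (ε _)
      (simpleForm fun i => g.flat (V i) ((extChartAt 𝓘(ℝ, E) x₀).symm q))
      (fun j => chartInv x₀ q (w j))) q := by
  let b : Basis (Fin n ⊕ Fin n) ℝ E :=
    (finBasisOfFinrankEq ℝ E (hdim.trans (two_mul n))).reindex finSumFinEquiv.symm
  have hUn := hU.mem_nhds hqU
  have hεc : ContinuousAt (fun q => ε.inChart x₀ q (b ∘ finSumFinEquiv.symm)) q := by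
    have h := ((hε.1 x₀).contDiffAt ((isOpen_extChartAt_target x₀).mem_nhds hq)).continuousAt
    exact (continuous_eval_const (b ∘ finSumFinEquiv.symm)).continuousAt.comp h
  have hrepr : ∀ (v : E → E) (k : Fin n ⊕ Fin n), ContinuousAt v q →
      ContinuousAt (fun q => (b.repr (v q) k : ℂ)) q := by
    intro v k hv
    have hl : Continuous (b.coord k) := LinearMap.continuous_of_finiteDimensional _
    exact Complex.continuous_ofReal.continuousAt.comp (hl.continuousAt.comp hv)
  have hM : ContinuousAt (fun q => (Matrix.of fun (k l : Fin n ⊕ Fin n) => Sum.elim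
        (fun i => (b.repr (chartField x₀ (V i).re q) k : ℂ) +
          Complex.I * (b.repr (chartField x₀ (V i).im q) k : ℂ))
        (fun j => (b.repr (w j) k : ℂ)) l)) q := by
    refine continuousAt_pi.2 fun k => continuousAt_pi.2 fun l => ?_
    rcases l with i | j
    · exact (hrepr _ k (contDiffAt_chartField hr hq ((hV i).1.contMDiffAt hUn)).continuousAt).add
        (continuousAt_const.mul
          (hrepr _ k (contDiffAt_chartField hr hq ((hV i).2.contMDiffAt hUn)).continuousAt))
    · exact continuousAt_const
  have hdet : Continuous fun A : Matrix (Fin n ⊕ Fin n) (Fin n ⊕ Fin n) ℂ => A.det :=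
    continuous_id.matrix_det
  refine (continuousAt_const.mul ((Complex.continuous_ofReal.continuousAt.comp hεc).mul
    (hdet.continuousAt.comp hM)) : ContinuousAt (fun q => (n.factorial : ℂ)⁻¹ * _) q).congr ?_
  filter_upwards [eventually_mem_extChartAt_target hq] with q' hq'
  exact (hodgeDual_flat_chart g ε V b hq' w).symm

theorem tendsto_extChartAt (x : M) : Tendsto (extChartAt 𝓘(ℝ, E) x) (𝓝 x)
    (𝓝 (extChartAt 𝓘(ℝ, E) x x)) :=
  continuousAt_extChartAt x

theorem eventually_of_chart {x₀ : M} {P : M → Prop}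
    (h : ∀ᶠ q in 𝓝 (extChartAt 𝓘(ℝ, E) x₀ x₀), P ((extChartAt 𝓘(ℝ, E) x₀).symm q)) :
    ∀ᶠ x in 𝓝 x₀, P x := by
  filter_upwards [(tendsto_extChartAt x₀).eventually h,
    extChartAt_source_mem_nhds (I := 𝓘(ℝ, E)) x₀] with x hx hxs
  rwa [(extChartAt 𝓘(ℝ, E) x₀).left_inv hxs] at hx

/-- One constant tuple of vectors in the chart detects the form near `x₀`; ratios of forms become
ratios of their values on it, hence regular functions. -/
theorem exists_frame_ne_zero (g : PseudoMetric r E M) {V : Fin n → ComplexVectorField E M} {x₀ : M}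
    (hV : LinearIndependent ℂ fun i => (V i).value x₀) :
    ∃ w : Fin n → E, simpleForm (fun i => chartFlat g x₀ (V i) (extChartAt 𝓘(ℝ, E) x₀ x₀)) w ≠ 0 := by
  have hV' : LinearIndependent ℂ fun i => (V i).value
      ((extChartAt 𝓘(ℝ, E) x₀).symm (extChartAt 𝓘(ℝ, E) x₀ x₀)) := by
    rwa [extChartAt_to_inv]
  obtain ⟨w, hw⟩ := exists_simpleForm_apply_ne_zero (linearIndependent_flat g hV')
  refine ⟨fun j => chartDeriv x₀ _ (w j), ?_⟩
  rw [← simpleForm_flat_chartInv]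
  simpa only [chartInv_chartDeriv (mem_extChartAt_target x₀)] using hw

theorem contDiffAt_simpleForm_chartFlat (hr : r = ∞ ∨ r = ω) (g : PseudoMetric r E M)
    {V : Fin n → ComplexVectorField E M} {U : Set M} (hU : IsOpen U)
    (hV : ∀ i, (V i).SmoothOn r U) {x₀ : M} {q : E} (hq : q ∈ (extChartAt 𝓘(ℝ, E) x₀).target)
    (hqU : (extChartAt 𝓘(ℝ, E) x₀).symm q ∈ U) :
    ContDiffAt ℝ r (fun q => simpleForm fun i => chartFlat g x₀ (V i) q) q :=
  contDiff_simpleForm.contDiffAt.comp q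
    (contDiffAt_pi.2 fun i => contDiffAt_chartFlat hr g hq hU hqU (hV i))

/-- The Hodge dual multiplies the null form by a constant, near every point. -/
theorem exists_eventually_hodge_eq_smul (hr : r = ∞ ∨ r = ω) (hdim : finrank ℝ E = 2 * n)
    (g : PseudoMetric r E M) {ε : Form E M (n + n) ℝ} (hε : IsVolumeForm g ε)
    {N : Form E M n ℂ} {V : Fin n → ComplexVectorField E M} {U : Set M} (hU : IsOpen U)
    (hV : ∀ i, (V i).SmoothOn r U)
    (hli : ∀ x ∈ U, LinearIndependent ℂ fun i => (V i).value x)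
    (hiso : ∀ x ∈ U, ∀ i j, g.complexBilin x ((V i).value x) ((V j).value x) = 0)
    (hN : ∀ x ∈ U, N x = simpleForm fun i => g.flat (V i) x) {x₀ : M} (hx₀ : x₀ ∈ U) :
    ∃ c : ℂ, ∀ᶠ x in 𝓝 x₀, Form.hodge g ε N x = c • N x := by
  have hex : ∀ x, ∃ c : ℂ, x ∈ U → c ^ 4 = 1 ∧ hodgeDual (g.bilin x) (g.bilin_nondegenerate x) (ε x)
      (simpleForm fun i => g.flat (V i) x) = c • simpleForm fun i => g.flat (V i) x := by
    intro x
    by_cases hx : x ∈ U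
    · obtain ⟨c, hc⟩ := exists_hodge_eq_smul hdim g hε (hli x hx) (hiso x hx)
      exact ⟨c, fun _ => hc⟩
    · exact ⟨0, fun h => absurd h hx⟩
  choose c hc using hex
  obtain ⟨w, hw⟩ := exists_frame_ne_zero g (hli x₀ hx₀)
  have hq₀ := mem_extChartAt_target (I := 𝓘(ℝ, E)) x₀
  have hq₀U : (extChartAt 𝓘(ℝ, E) x₀).symm (extChartAt 𝓘(ℝ, E) x₀ x₀) ∈ U := by
    rwa [extChartAt_to_inv]
  have hUev : ∀ᶠ q in 𝓝 (extChartAt 𝓘(ℝ, E) x₀ x₀), (extChartAt 𝓘(ℝ, E) x₀).symm q ∈ U :=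
    (tendsto_extChartAt_symm (mem_extChartAt_source x₀)).eventually (hU.mem_nhds hx₀)
  have hden : ContinuousAt (fun q => simpleForm (fun i => chartFlat g x₀ (V i) q) w)
      (extChartAt 𝓘(ℝ, E) x₀ x₀) :=
    (continuous_eval_const w).continuousAt.comp
      (contDiffAt_simpleForm_chartFlat hr g hU hV hq₀ hq₀U).continuousAt
  have hnum := continuousAt_hodgeDual_flat_chart hr hdim g hε hU hV hq₀ hq₀U w
  -- The eigenvalue, chosen separately at each point, is the quotient of the values of the dual and
  -- of the form on `w`, hence continuous; being a fourth root of unity, it is locally constant.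
  have hcont : ContinuousAt (fun q => c ((extChartAt 𝓘(ℝ, E) x₀).symm q))
      (extChartAt 𝓘(ℝ, E) x₀ x₀) := by
    refine (hnum.div hden hw).congr ?_
    filter_upwards [hden.eventually_ne hw, hUev] with q hq hqU
    simp only [Pi.div_apply]
    rw [(hc _ hqU).2, ContinuousAlternatingMap.smul_apply, simpleForm_flat_chartInv, smul_eq_mul,
      mul_div_cancel_right₀ _ hq]
  refine ⟨c ((extChartAt 𝓘(ℝ, E) x₀).symm (extChartAt 𝓘(ℝ, E) x₀ x₀)),
    eventually_of_chart (E := E) ?_⟩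
  filter_upwards [eventually_eq_of_finite hcont finite_setOf_pow_four_eq_one
    (hUev.mono fun q hq => (hc _ hq).1), hUev] with q hq hqU
  rw [← hq, Form.hodge, hN _ hqU]
  exact (hc _ hqU).2

end Hodge

/-! ### Integrability gives closed multiples -/

section IntegrableClosed

variable {E : Type*} [NormedAddCommGroup E] [NormedSpace ℝ E] [FiniteDimensional ℝ E]
  {M : Type*} [TopologicalSpace M] [ChartedSpace E M] [IsManifold 𝓘(ℝ, E) 1 M]
  {r : WithTop ℕ∞} [IsManifold 𝓘(ℝ, E) r M] {n : ℕ}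

theorem isotropic_frame {g : PseudoMetric r E M} {V : Fin n → ComplexVectorField E M} {x : M}
    {W : Submodule ℂ (ℂ ⊗[ℝ] TangentSpace 𝓘(ℝ, E) x)}
    (hW : W = Submodule.span ℂ (range fun i => (V i).value x)) (hiso : IsIsotropic g x W) (i j : Fin n) :
    g.complexBilin x ((V i).value x) ((V j).value x) = 0 :=
  hiso _ (hW ▸ Submodule.subset_span ⟨i, rfl⟩) _ (hW ▸ Submodule.subset_span ⟨j, rfl⟩)

theorem isMaximallyIsotropic_of_generating (hdim : finrank ℝ E = 2 * n) {g : PseudoMetric r E M}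
    {N : Form E M n ℂ} {D : Distribution E M} (hN : IsNullFormGenerating g N D) :
    IsMaximallyIsotropic g D := by
  intro x
  obtain ⟨U, -, hx, V, -, hV⟩ := hN.1 x
  obtain ⟨hli, hD, -⟩ := hV x hx
  exact maximal_isIsotropic hdim g hli hD (hN.2 x)

theorem eq_smul_simpleForm_differential (hdim : finrank ℝ E = 2 * n) {g : PseudoMetric r E M}
    {V : Fin n → ComplexVectorField E M} {x : M}
    {W : Submodule ℂ (ℂ ⊗[ℝ] TangentSpace 𝓘(ℝ, E) x)}
    (hV : LinearIndependent ℂ fun i => (V i).value x)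
    (hW : W = Submodule.span ℂ (range fun i => (V i).value x)) (hiso : IsIsotropic g x W)
    {z : Fin n → M → ℂ}
    (hz : LinearIndependent ℂ fun j => complexDifferential (E := E) (z j) x)
    (hWz : W = ⨅ j, LinearMap.ker (complexDifferential (E := E) (z j) x)) :
    ∃ c : ℂ, c ≠ 0 ∧ simpleForm (fun j => differential (z j) x) =
      c • simpleForm fun i => g.flat (V i) x := by
  refine exists_simpleForm_eq_smul (linearIndependent_complexCovector.1 hz) ?_
  simp only [← complexDifferential_eq]
  rw [← hWz]
  intro X hX
  rw [mem_iff_flat hdim g hV hW hiso]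
  simpa [Submodule.mem_iInf] using hX

theorem contDiffAt_simpleForm_differential (hr : r = ∞ ∨ r = ω) {z : Fin n → M → ℂ} {U : Set M}
    (hU : IsOpen U) (hz : ∀ j, ContMDiffOn 𝓘(ℝ, E) 𝓘(ℝ, ℂ) r (z j) U) {x₀ : M} {q : E}
    (hq : q ∈ (extChartAt 𝓘(ℝ, E) x₀).target) (hqU : (extChartAt 𝓘(ℝ, E) x₀).symm q ∈ U) :
    ContDiffAt ℝ r (fun q => simpleForm fun j =>
      differential (z j) ((extChartAt 𝓘(ℝ, E) x₀).symm q) ∘L chartInv x₀ q) q := by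
  refine contDiff_simpleForm.contDiffAt.comp q (contDiffAt_pi.2 fun j => ?_)
  have hsm : ∀ q' ∈ (extChartAt 𝓘(ℝ, E) x₀).target, (extChartAt 𝓘(ℝ, E) x₀).symm q' ∈ U →
      ContMDiffAt 𝓘(ℝ, E) 𝓘(ℝ, ℂ) r (z j) ((extChartAt 𝓘(ℝ, E) x₀).symm q') := fun q' _ h =>
    (hz j).contMDiffAt (hU.mem_nhds h)
  have h1 : ContDiffAt ℝ r (z j ∘ (extChartAt 𝓘(ℝ, E) x₀).symm) q :=
    ((hsm q hq hqU).comp q (contMDiffAt_extChartAt_symm (r := r) hq)).contDiffAt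
  refine (h1.fderiv_right (add_one_eq_of_smooth hr).le).congr_of_eventuallyEq ?_
  have hev := (contMDiffAt_extChartAt_symm (r := r) hq).continuousAt.eventually
    (hU.mem_nhds hqU)
  filter_upwards [eventually_mem_extChartAt_target hq, hev] with q' hq' hqU'
  exact differential_comp_chartInv hr hq' (hsm q' hq' hqU')

/-- The multiplier is the quotient of `dz¹ ∧ … ∧ dzⁿ` by `N`, evaluated on a tuple `w` that detects
`N`. The rescaled form is then the form of the differentials, and its Hodge dual is the same form
times a local constant; both are closed. -/
theorem hasClosedCoclosedMultiple_of_isLocallyIntegrable (hr : r = ∞ ∨ r = ω)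
    (hdim : finrank ℝ E = 2 * n) {g : PseudoMetric r E M} {ε : Form E M (n + n) ℝ}
    (hε : IsVolumeForm g ε) {N : Form E M n ℂ} {D : Distribution E M}
    (hN : IsNullFormGenerating g N D) (hD : IsLocallyIntegrable r n D) :
    HasClosedCoclosedMultiple g ε N := by
  intro x₀
  obtain ⟨U₁, hU₁, hx₁, V, hVs, hV⟩ := hN.1 x₀
  obtain ⟨U₂, hU₂, hx₂, z, hzs, hz⟩ := hD x₀
  obtain ⟨c, hc⟩ := exists_eventually_hodge_eq_smul hr hdim g hε hU₁ hVs (fun x hx => (hV x hx).1)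
    (fun x hx => isotropic_frame (hV x hx).2.1 (hN.2 x)) (fun x hx => (hV x hx).2.2) hx₁
  obtain ⟨w, hw⟩ := exists_frame_ne_zero g (hV x₀ hx₁).1
  set φ := extChartAt 𝓘(ℝ, E) x₀ with hφ
  set den : E → ℂ := fun q => simpleForm (fun i => chartFlat g x₀ (V i) q) w with hden
  set num : E → ℂ := fun q => simpleForm (fun j =>
    differential (z j) (φ.symm q) ∘L chartInv x₀ q) w with hnum
  have hden_smooth : ∀ x ∈ U₁, x ∈ φ.source → ContDiffAt ℝ r den (φ x) := by
    intro x hx hxs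
    exact ((ContinuousAlternatingMap.apply ℝ E ℂ w).contDiff.contDiffAt).comp _
      (contDiffAt_simpleForm_chartFlat hr g hU₁ hVs (φ.map_source hxs)
        (by rwa [φ.left_inv hxs]))
  have hnum_smooth : ∀ x ∈ U₂, x ∈ φ.source → ContDiffAt ℝ r num (φ x) := by
    intro x hx hxs
    exact ((ContinuousAlternatingMap.apply ℝ E ℂ w).contDiff.contDiffAt).comp _
      (contDiffAt_simpleForm_differential hr hU₂ hzs (φ.map_source hxs)
        (by rwa [φ.left_inv hxs]))
  have hne : ∀ᶠ x in 𝓝 x₀, den (φ x) ≠ 0 :=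
    ((hden_smooth x₀ hx₁ (mem_extChartAt_source x₀)).continuousAt.comp
      (continuousAt_extChartAt (I := 𝓘(ℝ, E)) x₀)).eventually_ne hw
  have hn₁ : ∀ᶠ x in 𝓝 x₀, x ∈ U₁ := hU₁.mem_nhds hx₁
  have hn₂ : ∀ᶠ x in 𝓝 x₀, x ∈ U₂ := hU₂.mem_nhds hx₂
  have hns : ∀ᶠ x in 𝓝 x₀, x ∈ φ.source := extChartAt_source_mem_nhds x₀
  obtain ⟨T, hT, hTo, hxT⟩ := eventually_nhds_iff.1 (((hne.and hc).and (hn₁.and hn₂)).and hns)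
  have key : ∀ x ∈ T, num (φ x) / den (φ x) ≠ 0 ∧
      (num (φ x) / den (φ x)) • N x = simpleForm fun j => differential (z j) x := by
    intro x hx
    obtain ⟨⟨⟨hx1, hx2⟩, hx3, hx4⟩, hx5⟩ := hT x hx
    obtain ⟨a, ha, haeq⟩ := eq_smul_simpleForm_differential hdim (hV x hx3).1 (hV x hx3).2.1
      (hN.2 x) (hz x hx4).1 (hz x hx4).2
    have h1 : num (φ x) = a * den (φ x) := by
      -- Stated for a free point `y`, since the tangent space at `φ.symm (φ x)` has to be identified
      -- with the one at `x`.
      have h2 : ∀ y, y = x → ∀ L : E →L[ℝ] TangentSpace 𝓘(ℝ, E) y,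
          simpleForm (fun j => differential (z j) y ∘L L) w =
            a * simpleForm (fun i => g.flat (V i) y ∘L L) w := by
        rintro y rfl L
        rw [← simpleForm_compContinuousLinearMap, ← simpleForm_compContinuousLinearMap, haeq]
        rfl
      exact h2 _ (φ.left_inv hx5) (chartInv x₀ (φ x))
    have h3 : num (φ x) / den (φ x) = a := by
      rw [h1, mul_div_cancel_right₀ _ hx1]
    rw [h3, haeq, (hV x hx3).2.2]
    exact ⟨ha, rfl⟩
  refine ⟨T, hTo, hxT, fun x => num (φ x) / den (φ x), ?_, fun x hx => (key x hx).1, ?_⟩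
  · intro x hx
    obtain ⟨⟨⟨hx1, hx2⟩, hx3, hx4⟩, hx5⟩ := hT x hx
    have h1 : ContDiffAt ℝ r (fun q => num q / den q) (φ x) := by
      simp only [div_eq_mul_inv]
      exact (hnum_smooth x hx4 hx5).mul ((hden_smooth x hx3 hx5).inv hx1)
    have h2 : ContMDiffAt 𝓘(ℝ, E) 𝓘(ℝ, E) r φ x :=
      contMDiffAt_extChartAt' (by simpa [hφ] using hx5)
    exact (h1.contMDiffAt.comp x h2).contMDiffWithinAt
  · intro x hx
    have hTn : ∀ᶠ y in 𝓝 x, y ∈ T := hTo.mem_nhds hx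
    have hzn : ∀ᶠ y in 𝓝 x, ∀ j, ContMDiffAt 𝓘(ℝ, E) 𝓘(ℝ, ℂ) r (z j) y := by
      filter_upwards [hTn] with y hy j
      exact (hzs j).contMDiffAt (hU₂.mem_nhds (hT y hy).1.2.2)
    refine ⟨extDeriv_eq_zero_of_eq_simpleForm (c := 1) hr hzn ?_,
      extDeriv_eq_zero_of_eq_simpleForm (c := c) hr hzn ?_⟩
    · filter_upwards [hTn] with y hy
      rw [one_smul]
      exact (key y hy).2
    · filter_upwards [hTn] with y hy
      rw [hodge_smul, (hT y hy).1.1.2, smul_comm, (key y hy).2]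

end IntegrableClosed

/-! ### Closed multiples give involutivity -/

section ClosedInvolutive

variable {E : Type*} [NormedAddCommGroup E] [NormedSpace ℝ E] [FiniteDimensional ℝ E]
  {M : Type*} [TopologicalSpace M] [ChartedSpace E M] [IsManifold 𝓘(ℝ, E) 1 M]
  {r : WithTop ℕ∞} [IsManifold 𝓘(ℝ, E) r M] {n : ℕ}

/-- A transposition brings slot `j` to the front, so the bracket identity, proved for the first
slot, applies to every slot. -/
theorem eq_update_zero {F : Type*} [AddCommGroup F] [Module ℝ F] [TopologicalSpace F] {k : ℕ}
    (β : F [⋀^Fin (k + 1)]→L[ℝ] ℂ) (w : Fin (k + 1) → F) (j : Fin (k + 1)) :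
    ∃ (s : ℂ) (w' : Fin k → F), ∀ a, β (Function.update w j a) = s * β (Fin.cons a w') := by
  refine ⟨(Equiv.Perm.sign (Equiv.swap 0 j) : ℂ), Fin.tail (w ∘ Equiv.swap 0 j), fun a => ?_⟩
  have h := β.toAlternatingMap.map_perm (Function.update w j a) (Equiv.swap 0 j)
  have h2 : Function.update w j a ∘ Equiv.swap 0 j = Fin.cons a (Fin.tail (w ∘ Equiv.swap 0 j)) := by
    funext i
    refine Fin.cases ?_ (fun i => ?_) i
    · simp
    · have : Equiv.swap 0 j i.succ ≠ j := by
        intro h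
        have := congrArg (Equiv.swap 0 j) h
        rw [Equiv.swap_apply_self, Equiv.swap_apply_right] at this
        exact Fin.succ_ne_zero _ this
      rw [Function.comp_apply, Function.update_of_ne this]
      rfl
  rw [h2] at h
  change β (Fin.cons a _) = _ • β _ at h
  rw [h]
  rcases Int.units_eq_one_or (Equiv.Perm.sign (Equiv.swap 0 j)) with h | h <;> simp [h]

theorem linearIndependent_chartFlat (g : PseudoMetric r E M) {V : Fin n → ComplexVectorField E M}
    {x₀ : M} {q : E} (hq : q ∈ (extChartAt 𝓘(ℝ, E) x₀).target)
    (hV : LinearIndependent ℂ fun i => (V i).value ((extChartAt 𝓘(ℝ, E) x₀).symm q)) :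
    LinearIndependent ℂ fun i => chartFlat g x₀ (V i) q := by
  refine Fintype.linearIndependent_iff.2 fun c hc => ?_
  refine Fintype.linearIndependent_iff.1 (linearIndependent_flat g hV) c ?_
  refine ContinuousLinearMap.ext fun v => ?_
  have h := DFunLike.congr_fun hc (chartDeriv x₀ _ v)
  rw [_root_.sum_apply] at h ⊢
  simp only [_root_.smul_apply, chartFlat, ContinuousLinearMap.comp_apply,
    chartInv_chartDeriv hq] at h
  exact h

theorem value_mem_iff_chartFlat (hdim : finrank ℝ E = 2 * n) (g : PseudoMetric r E M)
    {V : Fin n → ComplexVectorField E M} {x₀ : M} {q : E}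
    (hq : q ∈ (extChartAt 𝓘(ℝ, E) x₀).target)
    {W : Submodule ℂ (ℂ ⊗[ℝ] TangentSpace 𝓘(ℝ, E) ((extChartAt 𝓘(ℝ, E) x₀).symm q))}
    (hV : LinearIndependent ℂ fun i => (V i).value ((extChartAt 𝓘(ℝ, E) x₀).symm q))
    (hW : W = Submodule.span ℂ (range fun i => (V i).value ((extChartAt 𝓘(ℝ, E) x₀).symm q)))
    (hiso : IsIsotropic g _ W) (X : ComplexVectorField E M) :
    X.value ((extChartAt 𝓘(ℝ, E) x₀).symm q) ∈ W ↔
      ∀ i, complexCovector (chartFlat g x₀ (V i) q)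
        ((1 : ℂ) ⊗ₜ chartField x₀ X.re q + Complex.I ⊗ₜ chartField x₀ X.im q) = 0 := by
  rw [mem_iff_flat hdim g hV hW hiso]
  refine forall_congr' fun i => ?_
  rw [ComplexVectorField.value, map_add, map_add, complexCovector_tmul, complexCovector_tmul,
    complexCovector_tmul, complexCovector_tmul, chartFlat, ContinuousLinearMap.comp_apply,
    ContinuousLinearMap.comp_apply, chartInv_chartField hq, chartInv_chartField hq]

theorem chartField_bracket (hr : r = ∞ ∨ r = ω) {x₀ : M} {q : E}
    (hq : q ∈ (extChartAt 𝓘(ℝ, E) x₀).target) {U : Set M} (hU : IsOpen U)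
    (hqU : (extChartAt 𝓘(ℝ, E) x₀).symm q ∈ U) {X Y : ComplexVectorField E M}
    (hX : X.SmoothOn r U) (hY : Y.SmoothOn r U) :
    chartField x₀ (X.bracket Y).re q =
      (fderiv ℝ (chartField x₀ Y.re) q (chartField x₀ X.re q) -
        fderiv ℝ (chartField x₀ X.re) q (chartField x₀ Y.re q)) -
      (fderiv ℝ (chartField x₀ Y.im) q (chartField x₀ X.im q) -
        fderiv ℝ (chartField x₀ X.im) q (chartField x₀ Y.im q)) ∧
    chartField x₀ (X.bracket Y).im q =
      (fderiv ℝ (chartField x₀ Y.im) q (chartField x₀ X.re q) -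
        fderiv ℝ (chartField x₀ X.re) q (chartField x₀ Y.im q)) +
      (fderiv ℝ (chartField x₀ Y.re) q (chartField x₀ X.im q) -
        fderiv ℝ (chartField x₀ X.im) q (chartField x₀ Y.re q)) := by
  have hUn := hU.mem_nhds hqU
  rw [← chartField_mlieBracket hr hq (hX.1.contMDiffAt hUn) (hY.1.contMDiffAt hUn),
    ← chartField_mlieBracket hr hq (hX.2.contMDiffAt hUn) (hY.2.contMDiffAt hUn),
    ← chartField_mlieBracket hr hq (hX.1.contMDiffAt hUn) (hY.2.contMDiffAt hUn),
    ← chartField_mlieBracket hr hq (hX.2.contMDiffAt hUn) (hY.1.contMDiffAt hUn)]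
  exact ⟨map_sub (chartDeriv x₀ _) _ _, map_add (chartDeriv x₀ _) _ _⟩

theorem isInvolutive_of_hasClosedCoclosedMultiple (hr : r = ∞ ∨ r = ω)
    (hdim : finrank ℝ E = 2 * n) {g : PseudoMetric r E M} {ε : Form E M (n + n) ℝ}
    {N : Form E M n ℂ} {D : Distribution E M}
    (hN : IsNullFormGenerating g N D) (hC : HasClosedCoclosedMultiple g ε N) :
    IsInvolutive r D := by
  intro W hWo X Y hX hY hXD hYD x hx
  cases n with
  -- For `n = 0` there is no slot to contract, but then all tangent spaces are zero.
  | zero =>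
    have hE : Subsingleton E := finrank_zero_iff.1 (by simpa using hdim)
    have hsub : Subsingleton (TangentSpace 𝓘(ℝ, E) x) := hE
    rw [ComplexVectorField.value, Subsingleton.elim ((X.bracket Y).re x) 0,
      Subsingleton.elim ((X.bracket Y).im x) 0]
    simp
  | succ k =>
    obtain ⟨U₁, hU₁, hx₁, V, hVs, hV⟩ := hN.1 x
    obtain ⟨U₂, hU₂, hx₂, h, hhs, hne, hh⟩ := hC x
    set φ := extChartAt 𝓘(ℝ, E) x with hφ
    set α : Form E M (k + 1) ℂ := fun y => h y • N y with hα
    have hp := mem_extChartAt_target (I := 𝓘(ℝ, E)) x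
    have hpx : φ.symm (φ x) = x := extChartAt_to_inv x
    have ht := tendsto_extChartAt_symm (mem_extChartAt_source (I := 𝓘(ℝ, E)) x)
    -- The exterior derivative at `x` is taken in the chart at `x`, whose derivative at `x` is the
    -- identity. So closedness passes to the chart, at the single point `φ x`, which is enough for
    -- the bracket identity.
    have hclosed : _root_.extDeriv (α.inChart x) (φ x) = 0 := by
      have h1 : Form.extDeriv α x = (_root_.extDeriv (α.inChart x) (φ x)).compContinuousLinearMap
        (chartDeriv x x) := rfl
      rw [(hh x hx₂).1] at h1
      ext v
      have h2 : _root_.extDeriv (α.inChart x) (φ x) (fun i => chartDeriv x x (v i)) = 0 :=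
        (DFunLike.congr_fun h1 v).symm
      have h3 : (fun i => chartDeriv x x (v i)) = v := funext fun i => chartDeriv_self x (v i)
      rw [h3] at h2
      exact h2
    have hloc : ∀ᶠ q in 𝓝 (φ x), α.inChart x q =
        h (φ.symm q) • simpleForm fun i => chartFlat g x (V i) q := by
      filter_upwards [ht.eventually (hU₁.mem_nhds hx₁)] with q hq
      have h1 : α.inChart x q = (α (φ.symm q)).compContinuousLinearMap (chartInv x q) := rfl
      rw [h1, hα]
      simp only
      rw [(hV _ hq).2.2]
      have h2 : simpleForm (fun i => chartFlat g x (V i) q) =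
        (simpleForm fun i => g.flat (V i) (φ.symm q)).compContinuousLinearMap (chartInv x q) :=
        (simpleForm_compContinuousLinearMap _ _).symm
      rw [h2]
      rfl
    have hdiff : DifferentiableAt ℝ (α.inChart x) (φ x) := by
      have h1 : ContDiffAt ℝ r (fun q => h (φ.symm q)) (φ x) :=
        ((hhs.contMDiffAt (hU₂.mem_nhds (by rwa [hpx]))).comp (φ x)
          (contMDiffAt_extChartAt_symm (r := r) hp)).contDiffAt
      have h2 := contDiffAt_simpleForm_chartFlat hr g hU₁ hVs hp (by rwa [← hφ, hpx])
      exact ((h1.smul h2).differentiableAt (ne_zero_of_smooth hr)).congr_of_eventuallyEq hloc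
    have hann : ∀ Z : ComplexVectorField E M, (∀ y ∈ W, Z.value y ∈ D y) →
        ∀ᶠ q in 𝓝 (φ x), ∀ w : Fin k → E,
          α.inChart x q (Fin.cons (chartField x Z.re q) w) +
            Complex.I * α.inChart x q (Fin.cons (chartField x Z.im q) w) = 0 := by
      intro Z hZ
      filter_upwards [hloc, ht.eventually (hU₁.mem_nhds hx₁), ht.eventually (hWo.mem_nhds hx),
        eventually_mem_extChartAt_target hp] with q hq hqU hqW hqt w
      have h1 := (value_mem_iff_chartFlat hdim g hqt (hV _ hqU).1 (hV _ hqU).2.1 (hN.2 _) Z).1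
        (hZ _ hqW)
      have h2 := simpleForm_update_add (fun i => chartFlat g x (V i) q)
        (Fin.cons 0 w : Fin (k + 1) → E) 0 (chartField x Z.re q) (chartField x Z.im q)
      simp only [h1, Fin.update_cons_zero] at h2
      rw [Matrix.det_eq_zero_of_column_eq_zero 0 (by simp), mul_zero] at h2
      rw [hq, ContinuousAlternatingMap.smul_apply, ContinuousAlternatingMap.smul_apply, smul_eq_mul,
        smul_eq_mul]
      linear_combination h (φ.symm q) * h2
    have hpW : φ.symm (φ x) ∈ W := by rwa [hpx]
    have hpU : φ.symm (φ x) ∈ U₁ := by rwa [hpx]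
    have hd : ∀ Z : ∀ x : M, TangentSpace 𝓘(ℝ, E) x, ContMDiffOn 𝓘(ℝ, E) 𝓘(ℝ, E).tangent r
        (fun x => (⟨x, Z x⟩ : TangentBundle 𝓘(ℝ, E) M)) W →
        DifferentiableAt ℝ (chartField x Z) (φ x) := fun Z hZ =>
      (contDiffAt_chartField hr hp (hZ.contMDiffAt (hWo.mem_nhds hpW))).differentiableAt
        (ne_zero_of_smooth hr)
    have hzero := apply_bracket_eq_zero hdiff (hd _ hX.1) (hd _ hX.2) (hd _ hY.1) (hd _ hY.2)
      hclosed (hann X hXD) (hann Y hYD)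
    obtain ⟨hre, him⟩ := chartField_bracket hr hp hWo hpW hX hY
    rw [← hφ] at hre him
    rw [← hre, ← him] at hzero
    have hmem : (X.bracket Y).value (φ.symm (φ x)) ∈ D (φ.symm (φ x)) := by
      rw [value_mem_iff_chartFlat hdim g hp (hV _ hpU).1 (hV _ hpU).2.1 (hN.2 _),
        complexCovector_eq_zero_iff (linearIndependent_chartFlat g hp (hV _ hpU).1)]
      intro w j
      obtain ⟨s, w', hs⟩ := eq_update_zero
        (simpleForm fun i => chartFlat g x (V i) (φ x)) w j
      have h1 := hzero w'
      rw [hloc.self_of_nhds, ContinuousAlternatingMap.smul_apply,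
        ContinuousAlternatingMap.smul_apply, smul_eq_mul, smul_eq_mul, mul_left_comm, ← mul_add,
        hpx] at h1
      rw [hs, hs, mul_left_comm, ← mul_add, (mul_eq_zero.1 h1).resolve_left (hne x hx₂), mul_zero]
    rwa [hpx] at hmem

end ClosedInvolutive

/-! ### Transfer of the distribution to real coordinates -/

section Complexify

variable {V : Type*} [AddCommGroup V] [Module ℝ V] {ι : Type*} [Fintype ι]

/-- The complex-linear extension of a real linear map to coordinate space. -/
def complexify (L : V →ₗ[ℝ] (ι → ℝ)) : ℂ ⊗[ℝ] V →ₗ[ℂ] (ι → ℂ) :=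
  LinearMap.liftBaseChange ℂ ((ofRealPi ι).toLinearMap ∘ₗ L)

theorem complexify_tmul (L : V →ₗ[ℝ] (ι → ℝ)) (c : ℂ) (v : V) :
    complexify L (c ⊗ₜ v) = c • ofRealPi ι (L v) := by
  simp [complexify]

theorem complexify_tmul_add_tmul (L : V →ₗ[ℝ] (ι → ℝ)) (a b : V) :
    complexify L ((1 : ℂ) ⊗ₜ a + Complex.I ⊗ₜ b) =
      ofRealPi ι (L a) + Complex.I • ofRealPi ι (L b) := by
  rw [map_add, complexify_tmul, complexify_tmul, one_smul]

theorem rePi_ofRealPi_add (a b : ι → ℝ) :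
    rePi ι (ofRealPi ι a + Complex.I • ofRealPi ι b) = a := by
  ext i
  simp

theorem imPi_ofRealPi_add (a b : ι → ℝ) :
    imPi ι (ofRealPi ι a + Complex.I • ofRealPi ι b) = b := by
  ext i
  simp

theorem complexify_injective {L : V →ₗ[ℝ] (ι → ℝ)} (hL : Function.Injective L) :
    Function.Injective (complexify L) := by
  rw [injective_iff_map_eq_zero]
  intro X hX
  obtain ⟨a, b, rfl⟩ := exists_eq_tmul_add_tmul X
  rw [complexify_tmul_add_tmul] at hX
  have ha := congrArg (rePi ι) hX
  have hb := congrArg (imPi ι) hX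
  rw [rePi_ofRealPi_add, map_zero] at ha
  rw [imPi_ofRealPi_add, map_zero] at hb
  rw [(map_eq_zero_iff L hL).1 ha, (map_eq_zero_iff L hL).1 hb]
  simp

/-- A complexified subspace is spanned by real vectors, which conjugation fixes. -/
theorem star_mem_map_complexify (L : V →ₗ[ℝ] (ι → ℝ)) (W : Submodule ℝ V) {w : ι → ℂ}
    (hw : w ∈ (W.baseChange ℂ).map (complexify L)) :
    star w ∈ (W.baseChange ℂ).map (complexify L) := by
  rw [Submodule.baseChange_eq_span, Submodule.map_span] at hw ⊢
  induction hw using Submodule.span_induction with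
  | mem x hx =>
    have h : star x = x := by
      obtain ⟨_, ⟨v, hv, rfl⟩, rfl⟩ := hx
      ext i
      simp [complexify_tmul]
    rw [h]
    exact Submodule.subset_span hx
  | zero => rw [star_zero]; exact Submodule.zero_mem _
  | add x y _ _ hx hy => rw [star_add]; exact Submodule.add_mem _ hx hy
  | smul c x _ hx => rw [star_smul]; exact Submodule.smul_mem _ _ hx

theorem eq_iInf_ker_of_le {K F : Type*} [Field K] [AddCommGroup F] [Module K F]
    [FiniteDimensional K F] {k : ℕ} {f : Fin k → F →ₗ[K] K} (hf : LinearIndependent K f)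
    {W : Submodule K F} (hW : finrank K W + k = finrank K F)
    (hle : W ≤ ⨅ j, LinearMap.ker (f j)) : W = ⨅ j, LinearMap.ker (f j) := by
  refine Submodule.eq_of_le_of_finrank_eq hle ?_
  have h1 := Subspace.finrank_add_finrank_dualCoannihilator_eq (Submodule.span K (range f))
  have h2 : (Submodule.span K (range f)).dualCoannihilator = ⨅ j, LinearMap.ker (f j) := by
    ext x
    simp only [Submodule.mem_iInf, LinearMap.mem_ker, Submodule.mem_dualCoannihilator]
    refine ⟨fun h j => h _ (Submodule.subset_span ⟨j, rfl⟩), fun h φ hφ => ?_⟩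
    induction hφ using Submodule.span_induction with
    | mem y hy => obtain ⟨j, rfl⟩ := hy; exact h j
    | zero => simp
    | add y z _ _ hy hz => rw [LinearMap.add_apply, hy, hz, add_zero]
    | smul c y _ hy => rw [LinearMap.smul_apply, hy, smul_zero]
  rw [h2, finrank_span_eq_card hf, Fintype.card_fin] at h1
  omega

end Complexify

section Coordinates

variable {E : Type*} [NormedAddCommGroup E] [NormedSpace ℝ E]
  {M : Type*} [TopologicalSpace M] [ChartedSpace E M] {d n : ℕ}

/-- The linear coordinates of the tangent vectors at `x`, in the chart at `x₀`. -/
def tangentCoord (ℓ : E ≃L[ℝ] (Fin d → ℝ)) (x₀ x : M) :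
    TangentSpace 𝓘(ℝ, E) x →ₗ[ℝ] (Fin d → ℝ) :=
  (ℓ : E →L[ℝ] (Fin d → ℝ)).toLinearMap ∘ₗ (chartDeriv x₀ x).toLinearMap

/-- The expression of a complex vector field in coordinates. -/
def coordField (ℓ : E ≃L[ℝ] (Fin d → ℝ)) (x₀ : M) (X : ComplexVectorField E M)
    (p : Fin d → ℝ) : Fin d → ℂ :=
  ofRealPi _ (ℓ (chartField x₀ X.re (ℓ.symm p))) +
    Complex.I • ofRealPi _ (ℓ (chartField x₀ X.im (ℓ.symm p)))

/-- The expression of a family of complex vector fields in coordinates. -/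
def coordFrame (ℓ : E ≃L[ℝ] (Fin d → ℝ)) (x₀ : M) (V : Fin n → ComplexVectorField E M)
    (p : Fin d → ℝ) : (Fin n → ℂ) →L[ℂ] (Fin d → ℂ) :=
  ∑ i, (ContinuousLinearMap.proj i : (Fin n → ℂ) →L[ℂ] ℂ).smulRight (coordField ℓ x₀ (V i) p)

/-- The complex vector field with a given expression in coordinates. -/
def coordLift (ℓ : E ≃L[ℝ] (Fin d → ℝ)) (x₀ : M) (X : (Fin d → ℝ) → Fin d → ℂ) :
    ComplexVectorField E M where
  re := chartLift x₀ fun q => ℓ.symm (rePi _ (X (ℓ q)))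
  im := chartLift x₀ fun q => ℓ.symm (imPi _ (X (ℓ q)))

variable {ℓ : E ≃L[ℝ] (Fin d → ℝ)} {x₀ : M}

theorem complexify_value (X : ComplexVectorField E M) (p : Fin d → ℝ) :
    complexify (tangentCoord ℓ x₀ ((extChartAt 𝓘(ℝ, E) x₀).symm (ℓ.symm p)))
      (X.value ((extChartAt 𝓘(ℝ, E) x₀).symm (ℓ.symm p))) = coordField ℓ x₀ X p :=
  complexify_tmul_add_tmul _ _ _

theorem coordFrame_apply (V : Fin n → ComplexVectorField E M) (p : Fin d → ℝ) (u : Fin n → ℂ) :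
    coordFrame ℓ x₀ V p u = ∑ i, u i • coordField ℓ x₀ (V i) p := by
  simp [coordFrame]

theorem mem_range_coordFrame (V : Fin n → ComplexVectorField E M) (p : Fin d → ℝ)
    (w : Fin d → ℂ) : w ∈ range (coordFrame ℓ x₀ V p) ↔
      w ∈ (Submodule.span ℂ (range fun i => (V i).value
        ((extChartAt 𝓘(ℝ, E) x₀).symm (ℓ.symm p)))).map
          (complexify (tangentCoord ℓ x₀ ((extChartAt 𝓘(ℝ, E) x₀).symm (ℓ.symm p)))) := by
  rw [Submodule.map_span, ← range_comp]
  have h : (complexify (tangentCoord ℓ x₀ ((extChartAt 𝓘(ℝ, E) x₀).symm (ℓ.symm p))) ∘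
      fun i => (V i).value ((extChartAt 𝓘(ℝ, E) x₀).symm (ℓ.symm p))) =
      fun i => coordField ℓ x₀ (V i) p := funext fun i => complexify_value (V i) p
  rw [h, Submodule.mem_span_range_iff_exists_fun]
  simp only [mem_range, coordFrame_apply]

variable [IsManifold 𝓘(ℝ, E) 1 M]

theorem tangentCoord_injective {q : E} (hq : q ∈ (extChartAt 𝓘(ℝ, E) x₀).target) :
    Function.Injective (tangentCoord ℓ x₀ ((extChartAt 𝓘(ℝ, E) x₀).symm q)) := by
  intro a b hab
  have h := ℓ.injective hab
  have h2 := congrArg (chartInv x₀ q) h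
  exact (chartInv_chartDeriv hq a).symm.trans (h2.trans (chartInv_chartDeriv hq b))

theorem coordField_coordLift {p : Fin d → ℝ} (hp : ℓ.symm p ∈ (extChartAt 𝓘(ℝ, E) x₀).target)
    (X : (Fin d → ℝ) → Fin d → ℂ) : coordField ℓ x₀ (coordLift ℓ x₀ X) p = X p := by
  simp only [coordField, coordLift, chartField_chartLift hp, ContinuousLinearEquiv.apply_symm_apply]
  exact ofRealPi_rePi_add _

theorem value_mem_iff_coordField {V : Fin n → ComplexVectorField E M} {p : Fin d → ℝ}
    (hp : ℓ.symm p ∈ (extChartAt 𝓘(ℝ, E) x₀).target)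
    {W : Submodule ℂ (ℂ ⊗[ℝ] TangentSpace 𝓘(ℝ, E) ((extChartAt 𝓘(ℝ, E) x₀).symm (ℓ.symm p)))}
    (hW : W = Submodule.span ℂ (range fun i => (V i).value
      ((extChartAt 𝓘(ℝ, E) x₀).symm (ℓ.symm p)))) (X : ComplexVectorField E M) :
    X.value ((extChartAt 𝓘(ℝ, E) x₀).symm (ℓ.symm p)) ∈ W ↔
      coordField ℓ x₀ X p ∈ range (coordFrame ℓ x₀ V p) := by
  rw [mem_range_coordFrame, ← hW, ← complexify_value]
  refine ⟨fun h => Submodule.mem_map_of_mem h, ?_⟩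
  rintro ⟨Y, hY, hXY⟩
  rwa [← complexify_injective (tangentCoord_injective hp) hXY]

theorem coordFrame_injective {V : Fin n → ComplexVectorField E M} {p : Fin d → ℝ}
    (hp : ℓ.symm p ∈ (extChartAt 𝓘(ℝ, E) x₀).target)
    (hV : LinearIndependent ℂ fun i => (V i).value
      ((extChartAt 𝓘(ℝ, E) x₀).symm (ℓ.symm p))) :
    Function.Injective (coordFrame ℓ x₀ V p) := by
  rw [injective_iff_map_eq_zero]
  intro u hu
  have h := hV.map' _ (LinearMap.ker_eq_bot.2
    (complexify_injective (tangentCoord_injective (ℓ := ℓ) hp)))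
  refine funext (Fintype.linearIndependent_iff.1 h u ?_)
  rw [coordFrame_apply] at hu
  simp only [Function.comp_apply, complexify_value]
  exact hu

variable {r : WithTop ℕ∞} [IsManifold 𝓘(ℝ, E) r M] [FiniteDimensional ℝ E]

theorem contDiffAt_coordField (hr : r = ∞ ∨ r = ω) {p : Fin d → ℝ}
    (hp : ℓ.symm p ∈ (extChartAt 𝓘(ℝ, E) x₀).target) {U : Set M} (hU : IsOpen U)
    (hpU : (extChartAt 𝓘(ℝ, E) x₀).symm (ℓ.symm p) ∈ U) {X : ComplexVectorField E M}
    (hX : X.SmoothOn r U) : ContDiffAt ℝ r (coordField ℓ x₀ X) p := by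
  have h1 := contDiffAt_chartField hr hp (hX.1.contMDiffAt (hU.mem_nhds hpU))
  have h2 := contDiffAt_chartField hr hp (hX.2.contMDiffAt (hU.mem_nhds hpU))
  have hs : ContDiffAt ℝ r ℓ.symm p := ℓ.symm.contDiff.contDiffAt
  have e1 := (ofRealPi (Fin d)).contDiff.contDiffAt.comp p
    (ℓ.contDiff.contDiffAt.comp p (h1.comp p hs))
  have e2 := (ofRealPi (Fin d)).contDiff.contDiffAt.comp p
    (ℓ.contDiff.contDiffAt.comp p (h2.comp p hs))
  exact e1.add (e2.const_smul Complex.I)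

theorem contDiffAt_coordFrame (hr : r = ∞ ∨ r = ω) {p : Fin d → ℝ}
    (hp : ℓ.symm p ∈ (extChartAt 𝓘(ℝ, E) x₀).target) {U : Set M} (hU : IsOpen U)
    (hpU : (extChartAt 𝓘(ℝ, E) x₀).symm (ℓ.symm p) ∈ U) {V : Fin n → ComplexVectorField E M}
    (hV : ∀ i, (V i).SmoothOn r U) : ContDiffAt ℝ r (coordFrame ℓ x₀ V) p := by
  refine ContDiffAt.sum fun i _ => ?_
  exact ((ContinuousLinearMap.smulRightL ℂ (Fin n → ℂ) (Fin d → ℂ)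
    (ContinuousLinearMap.proj i)).restrictScalars ℝ).contDiff.contDiffAt.comp p
      (contDiffAt_coordField hr hp hU hpU (hV i))

theorem smoothOn_coordLift (hr : r = ∞ ∨ r = ω) {X : (Fin d → ℝ) → Fin d → ℂ} {U : Set M}
    (hU : ∀ x ∈ U, x ∈ (chartAt E x₀).source ∧
      ContDiffAt ℝ r X (ℓ (extChartAt 𝓘(ℝ, E) x₀ x))) :
    (coordLift ℓ x₀ X).SmoothOn r U := by
  have h : ∀ P : (Fin d → ℂ) →L[ℝ] (Fin d → ℝ), ∀ x ∈ U,
      ContDiffAt ℝ r (fun q => ℓ.symm (P (X (ℓ q)))) (extChartAt 𝓘(ℝ, E) x₀ x) :=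
    fun P x hx => ℓ.symm.contDiff.contDiffAt.comp _ (P.contDiff.contDiffAt.comp _
      ((hU x hx).2.comp _ ℓ.contDiff.contDiffAt))
  exact ⟨fun x hx => (contMDiffAt_chartLift hr (hU x hx).1 (h _ x hx)).contMDiffWithinAt,
    fun x hx => (contMDiffAt_chartLift hr (hU x hx).1 (h _ x hx)).contMDiffWithinAt⟩

theorem fderiv_coordField {X : ComplexVectorField E M} {p : Fin d → ℝ}
    (h1 : DifferentiableAt ℝ (chartField x₀ X.re) (ℓ.symm p))
    (h2 : DifferentiableAt ℝ (chartField x₀ X.im) (ℓ.symm p)) (v : Fin d → ℝ) :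
    fderiv ℝ (coordField ℓ x₀ X) p v =
      ofRealPi _ (ℓ (fderiv ℝ (chartField x₀ X.re) (ℓ.symm p) (ℓ.symm v))) +
        Complex.I • ofRealPi _ (ℓ (fderiv ℝ (chartField x₀ X.im) (ℓ.symm p) (ℓ.symm v))) := by
  have e1 := (ofRealPi (Fin d)).hasFDerivAt.comp p
    (ℓ.hasFDerivAt.comp p (h1.hasFDerivAt.comp p ℓ.symm.hasFDerivAt))
  have e2 := (ofRealPi (Fin d)).hasFDerivAt.comp p
    (ℓ.hasFDerivAt.comp p (h2.hasFDerivAt.comp p ℓ.symm.hasFDerivAt))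
  have e := (e1.add (e2.const_smul Complex.I)).fderiv
  exact DFunLike.congr_fun e v

theorem coordField_bracket (hr : r = ∞ ∨ r = ω) {p : Fin d → ℝ}
    (hp : ℓ.symm p ∈ (extChartAt 𝓘(ℝ, E) x₀).target) {U : Set M} (hU : IsOpen U)
    (hpU : (extChartAt 𝓘(ℝ, E) x₀).symm (ℓ.symm p) ∈ U) {X Y : ComplexVectorField E M}
    (hX : X.SmoothOn r U) (hY : Y.SmoothOn r U) :
    coordField ℓ x₀ (X.bracket Y) p =
      complexBracket (coordField ℓ x₀ X) (coordField ℓ x₀ Y) p := by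
  have hd : ∀ Z : ∀ x : M, TangentSpace 𝓘(ℝ, E) x, ContMDiffOn 𝓘(ℝ, E) 𝓘(ℝ, E).tangent r
      (fun x => (⟨x, Z x⟩ : TangentBundle 𝓘(ℝ, E) M)) U →
      DifferentiableAt ℝ (chartField x₀ Z) (ℓ.symm p) := fun Z hZ =>
    (contDiffAt_chartField hr hp (hZ.contMDiffAt (hU.mem_nhds hpU))).differentiableAt
      (ne_zero_of_smooth hr)
  obtain ⟨h1, h2⟩ := chartField_bracket hr hp hU hpU hX hY
  rw [coordField, h1, h2]
  have e1 : ∀ Z : ComplexVectorField E M, rePi _ (coordField ℓ x₀ Z p) =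
    ℓ (chartField x₀ Z.re (ℓ.symm p)) := fun Z => rePi_ofRealPi_add _ _
  have e2 : ∀ Z : ComplexVectorField E M, imPi _ (coordField ℓ x₀ Z p) =
    ℓ (chartField x₀ Z.im (ℓ.symm p)) := fun Z => imPi_ofRealPi_add _ _
  simp only [complexBracket, complexDeriv, e1, e2, fderiv_coordField (hd _ hX.1) (hd _ hX.2),
    fderiv_coordField (hd _ hY.1) (hd _ hY.2), ContinuousLinearEquiv.symm_apply_apply,
    map_sub, map_add, smul_add, smul_sub, smul_smul, Complex.I_mul_I, neg_smul, one_smul]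
  abel

theorem complexDifferential_coord (hr : r = ∞ ∨ r = ω) {p : Fin d → ℝ}
    (hp : ℓ.symm p ∈ (extChartAt 𝓘(ℝ, E) x₀).target) {z : (Fin d → ℝ) → ℂ}
    (hz : ContDiffAt ℝ r z p) (X : ℂ ⊗[ℝ] TangentSpace 𝓘(ℝ, E)
      ((extChartAt 𝓘(ℝ, E) x₀).symm (ℓ.symm p))) :
    complexDifferential (fun x => z (ℓ (extChartAt 𝓘(ℝ, E) x₀ x)))
      ((extChartAt 𝓘(ℝ, E) x₀).symm (ℓ.symm p)) X =
      complexDeriv z p (complexify (tangentCoord ℓ x₀ _) X) := by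
  obtain ⟨a, b, rfl⟩ := exists_eq_tmul_add_tmul X
  set φ := extChartAt 𝓘(ℝ, E) x₀ with hφ
  set z' : M → ℂ := fun x => z (ℓ (φ x)) with hz'
  have hcomp : (z' ∘ φ.symm) =ᶠ[𝓝 (ℓ.symm p)] fun q => z (ℓ q) := by
    filter_upwards [eventually_mem_extChartAt_target hp] with q hq
    exact congrArg (fun q => z (ℓ q)) (φ.right_inv hq)
  have hzp : ContDiffAt ℝ r z (ℓ (ℓ.symm p)) := by rwa [ℓ.apply_symm_apply]
  have hz'p : ContMDiffAt 𝓘(ℝ, E) 𝓘(ℝ, ℂ) r z' (φ.symm (ℓ.symm p)) := by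
    have h1 : ContDiffAt ℝ r (fun q => z (ℓ q)) (φ (φ.symm (ℓ.symm p))) := by
      rw [φ.right_inv hp]
      exact hzp.comp _ ℓ.contDiff.contDiffAt
    have h2 : ContMDiffAt 𝓘(ℝ, E) 𝓘(ℝ, E) r φ (φ.symm (ℓ.symm p)) :=
      contMDiffAt_extChartAt' (by simpa [hφ] using φ.map_target hp)
    exact h1.contMDiffAt.comp _ h2
  have hd : fderiv ℝ (z' ∘ φ.symm) (ℓ.symm p) = fderiv ℝ z p ∘L (ℓ : E →L[ℝ] (Fin d → ℝ)) := by
    rw [hcomp.fderiv_eq]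
    have h1 := ((hzp.differentiableAt (ne_zero_of_smooth hr)).hasFDerivAt.comp (ℓ.symm p)
      ℓ.hasFDerivAt).fderiv
    rw [ℓ.apply_symm_apply] at h1
    exact h1
  have hv : ∀ v, differential z' (φ.symm (ℓ.symm p)) v =
      fderiv ℝ z p (tangentCoord ℓ x₀ _ v) := fun v => by
    have h1 := DFunLike.congr_fun ((differential_comp_chartInv hr hp hz'p).trans hd)
      (chartDeriv x₀ _ v)
    refine Eq.trans ?_ h1
    exact congrArg (differential z' (φ.symm (ℓ.symm p))) (chartInv_chartDeriv hp v).symm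
  rw [complexDifferential_eq, complexify_tmul_add_tmul, map_add, complexCovector_tmul,
    complexCovector_tmul, complexDeriv, rePi_ofRealPi_add, imPi_ofRealPi_add, hv, hv, one_mul,
    smul_eq_mul]

theorem linearIndependent_complexDifferential_coord (hr : r = ∞ ∨ r = ω) {p : Fin d → ℝ}
    (hp : ℓ.symm p ∈ (extChartAt 𝓘(ℝ, E) x₀).target) {z : Fin n → (Fin d → ℝ) → ℂ}
    (hz : ∀ j, ContDiffAt ℝ r (z j) p) (hli : LinearIndependent ℂ fun j => fderiv ℝ (z j) p) :
    LinearIndependent ℂ fun j => complexDifferential (E := E)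
      (fun x => z j (ℓ (extChartAt 𝓘(ℝ, E) x₀ x)))
        ((extChartAt 𝓘(ℝ, E) x₀).symm (ℓ.symm p)) := by
  refine Fintype.linearIndependent_iff.2 fun c hc => Fintype.linearIndependent_iff.1 hli c ?_
  refine ContinuousLinearMap.ext fun v => ?_
  have h := LinearMap.congr_fun hc ((1 : ℂ) ⊗ₜ chartInv x₀ (ℓ.symm p) (ℓ.symm v))
  have hv : tangentCoord ℓ x₀ ((extChartAt 𝓘(ℝ, E) x₀).symm (ℓ.symm p))
      (chartInv x₀ (ℓ.symm p) (ℓ.symm v)) = v :=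
    (congrArg ℓ (chartDeriv_chartInv hp _)).trans (ℓ.apply_symm_apply v)
  have hv2 := rePi_ofRealPi_add v 0
  have hv3 := imPi_ofRealPi_add v 0
  rw [map_zero, smul_zero, add_zero] at hv2 hv3
  simp only [LinearMap.sum_apply, LinearMap.smul_apply, complexDifferential_coord hr hp (hz _),
    complexify_tmul, hv, complexDeriv, one_smul, hv2, hv3, map_zero, smul_zero, add_zero] at h
  rw [_root_.sum_apply]
  exact h

end Coordinates

/-! ### Involutivity gives integrability -/

section InvolutiveIntegrable

variable {E : Type*} [NormedAddCommGroup E] [NormedSpace ℝ E] [FiniteDimensional ℝ E]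
  {M : Type*} [TopologicalSpace M] [ChartedSpace E M] [IsManifold 𝓘(ℝ, E) 1 M]
  {r : WithTop ℕ∞} [IsManifold 𝓘(ℝ, E) r M] {d n m : ℕ}

/-- Involutivity in coordinates. -/
theorem complexBracket_mem_range_coordFrame (hr : r = ∞ ∨ r = ω) {D : Distribution E M}
    (hD : IsInvolutive r D) {ℓ : E ≃L[ℝ] (Fin d → ℝ)} {x₀ : M} {U : Set M}
    {V : Fin n → ComplexVectorField E M}
    (hV : ∀ x ∈ U, D x = Submodule.span ℂ (range fun i => (V i).value x))
    {T : Set (Fin d → ℝ)} (hT : IsOpen T)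
    (hTt : ∀ p ∈ T, ℓ.symm p ∈ (extChartAt 𝓘(ℝ, E) x₀).target)
    (hTU : ∀ p ∈ T, (extChartAt 𝓘(ℝ, E) x₀).symm (ℓ.symm p) ∈ U)
    {X Y : (Fin d → ℝ) → Fin d → ℂ} (hX : ContDiffOn ℝ r X T) (hY : ContDiffOn ℝ r Y T)
    (hXV : ∀ p ∈ T, X p ∈ range (coordFrame ℓ x₀ V p))
    (hYV : ∀ p ∈ T, Y p ∈ range (coordFrame ℓ x₀ V p)) {p : Fin d → ℝ} (hp : p ∈ T) :
    complexBracket X Y p ∈ range (coordFrame ℓ x₀ V p) := by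
  set φ := extChartAt 𝓘(ℝ, E) x₀ with hφ
  -- The coordinate fields are lifted to `S` only. Involutivity is a condition on fields over
  -- arbitrary open sets, so no cut-off functions, unavailable in the analytic case, are needed.
  let S : Set M := φ.source ∩ φ ⁻¹' (ℓ ⁻¹' T)
  have hS : IsOpen S := (continuousOn_extChartAt x₀).isOpen_inter_preimage
    (isOpen_extChartAt_source x₀) (hT.preimage ℓ.continuous)
  have hsm : ∀ Z : (Fin d → ℝ) → Fin d → ℂ, ContDiffOn ℝ r Z T →
      (coordLift ℓ x₀ Z).SmoothOn r S := fun Z hZ =>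
    smoothOn_coordLift hr fun x hx =>
      ⟨by simpa [hφ] using hx.1, hZ.contDiffAt (hT.mem_nhds hx.2)⟩
  have hmem : ∀ Z : (Fin d → ℝ) → Fin d → ℂ, (∀ p ∈ T, Z p ∈ range (coordFrame ℓ x₀ V p)) →
      ∀ x ∈ S, (coordLift ℓ x₀ Z).value x ∈ D x := fun Z hZ x hx => by
    have h1 := (value_mem_iff_coordField (hTt _ hx.2) (hV _ (hTU _ hx.2))
      (coordLift ℓ x₀ Z)).2 (by rw [coordField_coordLift (hTt _ hx.2)]; exact hZ _ hx.2)
    rwa [ℓ.symm_apply_apply, ← hφ, φ.left_inv hx.1] at h1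
  have hpS : φ.symm (ℓ.symm p) ∈ S := by
    refine ⟨φ.map_target (hTt p hp), ?_⟩
    rw [mem_preimage, mem_preimage, φ.right_inv (hTt p hp), ℓ.apply_symm_apply]
    exact hp
  have h := hD S hS _ _ (hsm X hX) (hsm Y hY) (hmem X hXV) (hmem Y hYV) _ hpS
  rw [value_mem_iff_coordField (hTt p hp) (hV _ (hTU p hp)),
    coordField_bracket hr (hTt p hp) hS hpS (hsm X hX) (hsm Y hY)] at h
  have hev : ∀ Z : (Fin d → ℝ) → Fin d → ℂ, coordField ℓ x₀ (coordLift ℓ x₀ Z) =ᶠ[𝓝 p] Z :=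
    fun Z => by
      filter_upwards [hT.mem_nhds hp] with q hq
      exact coordField_coordLift (hTt q hq) Z
  simpa only [complexBracket, complexDeriv, (hev _).fderiv_eq, (hev _).self_of_nhds] using h

/-- Frobenius' theorem in linear coordinates of the chart gives `m` independent first integrals.
Their differentials annihilate `D`, and since its rank is `n` in dimension `m + n`, the inclusion of
`D` in the common kernel is an equality. -/
theorem isLocallyIntegrable_of_isInvolutive (hr : r = ∞ ∨ r = ω) (hdim : finrank ℝ E = m + n)
    {g : PseudoMetric r E M} {N : Form E M n ℂ} {D : Distribution E M} (hN : Generates g N D)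
    (hreal : r = ω ∨ IsReal D) (hD : IsInvolutive r D) : IsLocallyIntegrable r m D := by
  intro x₀
  obtain ⟨U, hU, hx₀, V, hVs, hV⟩ := hN x₀
  set φ := extChartAt 𝓘(ℝ, E) x₀ with hφ
  let ℓ : E ≃L[ℝ] (Fin (m + n) → ℝ) := ContinuousLinearEquiv.ofFinrankEq (by simp [hdim])
  have hφx : φ.symm (ℓ.symm (ℓ (φ x₀))) = x₀ := by
    rw [ℓ.symm_apply_apply]
    exact extChartAt_to_inv x₀
  let T : Set (Fin (m + n) → ℝ) := ℓ.symm ⁻¹' (φ.target ∩ φ.symm ⁻¹' U)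
  have hT : IsOpen T := ((continuousOn_extChartAt_symm x₀).isOpen_inter_preimage
    (isOpen_extChartAt_target x₀) hU).preimage ℓ.symm.continuous
  have hpT : ℓ (φ x₀) ∈ T := by
    refine ⟨?_, ?_⟩
    · rw [ℓ.symm_apply_apply]
      exact mem_extChartAt_target x₀
    · rw [mem_preimage, hφx]
      exact hx₀
  obtain ⟨z, hz⟩ := exists_complexFirstIntegrals hr (rfl : m + n = m + n)
    (V := coordFrame ℓ x₀ V) (p₀ := ℓ (φ x₀))
    (by filter_upwards [hT.mem_nhds hpT] with p hp
        exact contDiffAt_coordFrame hr hp.1 hU hp.2 hVs)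
    (coordFrame_injective hpT.1 (hV _ hpT.2).1) (hT.mem_nhds hpT)
    (fun U' hU'T hU' X Y hX hY hXV hYV p hp =>
      complexBracket_mem_range_coordFrame hr hD (fun x hx => (hV x hx).2.1) hU'
        (fun p hp => (hU'T hp).1) (fun p hp => (hU'T hp).2) hX hY hXV hYV hp)
    (hreal.imp_right fun hreal => by
      filter_upwards [hT.mem_nhds hpT] with p hp w hw
      obtain ⟨W, hW⟩ := hreal (φ.symm (ℓ.symm p))
      rw [mem_range_coordFrame, ← (hV _ hp.2).2.1, hW] at hw ⊢
      exact star_mem_map_complexify _ W hw)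
  have hzT : ∀ᶠ p in 𝓝 (ℓ (φ x₀)), p ∈ T := hT.mem_nhds hpT
  have hs : ∀ᶠ x in 𝓝 x₀, x ∈ φ.source := extChartAt_source_mem_nhds x₀
  obtain ⟨S, hS, hSo, hxS⟩ := eventually_nhds_iff.1
    (((ℓ.continuous.continuousAt.tendsto.comp (tendsto_extChartAt x₀)).eventually
      (hz.and hzT)).and hs)
  refine ⟨S, hSo, hxS, fun j x => z j (ℓ (φ x)), fun j x hx => ?_, fun x hx => ?_⟩
  · obtain ⟨⟨⟨h1, -, -⟩, -⟩, hxs⟩ := hS x hx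
    have h2 : ContMDiffAt 𝓘(ℝ, E) 𝓘(ℝ, E) r φ x :=
      contMDiffAt_extChartAt' (by simpa [hφ] using hxs)
    have h3 : ContDiffAt ℝ r (fun q => z j (ℓ q)) (φ x) :=
      ContDiffAt.comp (φ x) (h1 j) ℓ.contDiff.contDiffAt
    exact (h3.contMDiffAt.comp x h2).contMDiffWithinAt
  · obtain ⟨⟨⟨h1, h2, h3⟩, hxT⟩, hxs⟩ := hS x hx
    simp only [Function.comp_apply] at h1 h2 h3 hxT
    have hxx : φ.symm (ℓ.symm (ℓ (φ x))) = x := by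
      rw [ℓ.symm_apply_apply, φ.left_inv hxs]
    have hli := linearIndependent_complexDifferential_coord hr hxT.1 h1 h3
    have hle : D (φ.symm (ℓ.symm (ℓ (φ x)))) ≤ ⨅ j, LinearMap.ker (complexDifferential (E := E)
        (fun x => z j (ℓ (φ x))) (φ.symm (ℓ.symm (ℓ (φ x))))) := by
      refine le_iInf fun j X hX => ?_
      rw [LinearMap.mem_ker]
      refine (complexDifferential_coord hr hxT.1 (h1 j) X).trans (h2 j _ ?_)
      rw [mem_range_coordFrame, ← (hV _ hxT.2).2.1]
      exact Submodule.mem_map_of_mem hX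
    have hfin : finrank ℂ (D (φ.symm (ℓ.symm (ℓ (φ x))))) + m =
        finrank ℂ (ℂ ⊗[ℝ] TangentSpace 𝓘(ℝ, E) (φ.symm (ℓ.symm (ℓ (φ x))))) := by
      rw [(hV _ hxT.2).2.1, finrank_span_eq_card (hV _ hxT.2).1, Fintype.card_fin,
        Module.finrank_baseChange, add_comm]
      exact hdim.symm
    have h := And.intro hli (eq_iInf_ker_of_le hli hfin hle)
    rw [← hφ] at h
    rwa [hxx] at h

end InvolutiveIntegrable

end NullForms

end

theorem mainTheorem5
    {E : Type*} [NormedAddCommGroup E] [NormedSpace ℝ E] [FiniteDimensional ℝ E]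
    {M : Type*} [TopologicalSpace M] [ChartedSpace E M]
    (n : ℕ) (hdim : Module.finrank ℝ E = 2 * n)
    (r : WithTop ℕ∞) (hr : r = ∞ ∨ r = ω)
    [IsManifold 𝓘(ℝ, E) 1 M] [IsManifold 𝓘(ℝ, E) r M]
    (g : NullForms.PseudoMetric r E M)
    (ε : NullForms.Form E M (n + n) ℝ) (hε : NullForms.IsVolumeForm g ε)
    (N' : NullForms.Form E M n ℂ) (D : NullForms.Distribution E M)
    (hN' : NullForms.IsNullFormGenerating g N' D) :
    NullForms.IsMaximallyIsotropic g D ∧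
    (r = ω ∨ NullForms.IsReal D →
      (NullForms.IsInvolutive r D ↔ NullForms.HasClosedCoclosedMultiple g ε N') ∧
      (NullForms.IsLocallyIntegrable r n D ↔ NullForms.HasClosedCoclosedMultiple g ε N')) ∧
    (NullForms.IsLocallyIntegrable r n D → NullForms.HasClosedCoclosedMultiple g ε N') ∧
    (NullForms.HasClosedCoclosedMultiple g ε N' → NullForms.IsInvolutive r D) := by
  have hdim' : Module.finrank ℝ E = n + n := by omega
  have hclosed := NullForms.hasClosedCoclosedMultiple_of_isLocallyIntegrable hr hdim hε hN'
  have hinv := NullForms.isInvolutive_of_hasClosedCoclosedMultiple (ε := ε) hr hdim hN'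
  refine ⟨NullForms.isMaximallyIsotropic_of_generating hdim hN', fun hreal => ?_, hclosed, hinv⟩
  -- Frobenius' theorem closes the cycle (Inv) ⇒ (Int) ⇒ (Closed) ⇒ (Inv).
  have hint := NullForms.isLocallyIntegrable_of_isInvolutive hr hdim' hN'.1 hreal
  exact ⟨⟨fun h => hclosed (hint h), hinv⟩, ⟨hclosed, fun h => hint (hinv h)⟩⟩
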